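/- **Model.** A generalised Jackson network has stations $1,\dots,K$ and a routing matrix $P=(p_{kl})_{k,l=1}^K$ of spectral radius less than one. At station $k$ the exogenous arrivals and the services are given by nonnegative times $\xi_k^{(0)},\xi_k^{(1)},\dots$ and $\eta_k^{(0)},\eta_k^{(1)},\dots$, where the first ones, $\xi_k^{(0)}$ and $\eta_k^{(0)}$ (residual times at time $0$), are a.s. positive, the $\xi_k^{(i)}$, $i\ge1$, are distributed as a generic interarrival time $\xi_k$ and the $\eta_k^{(i)}$, $i\ge1$, as a generic service time $\eta_k$, with $0<\mathbf E\xi_k<\infty$ and $0<\mathbf E\eta_k<\infty$. The $i$-th customer departing station $k$ goes to $\zeta_k^{(i)}\in\{0,1,\dots,K\}$ ($0$ meaning departure from the network), $\mathbf P(\zeta_k^{(i)}=l)=p_{kl}$ for $1\le l\le K$. The initial data $(Q_k(0),\xi_k^{(0)},\eta_k^{(0)})_{k}$, whose joint law is arbitrary, and all the variables $\xi_k^{(i)},\eta_k^{(i)}$ ($i\ge1$) and $\zeta_k^{(i)}$ ($i\ge1$) are mutually independent. Let $A_k(t)$ and $S_k(t)$ be the numbers of epochs $\xi_k^{(0)}+\dots+\xi_k^{(i)}$,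 respectively $\eta_k^{(0)}+\dots+\eta_k^{(i)}$, $i\ge0$, in $[0,t]$, and let $\Phi_{kl}(m)=\#\{1\le i\le m:\zeta_k^{(i)}=l\}$. The numbers $Q_k(t)\in\mathbb Z_+$ of customers at the stations are right-continuous in $t$ and satisfy a.s., for all $t\ge0$ and all $k$, $$Q_k(t)=Q_k(0)+A_k(t)+\sum_{l=1}^K\Phi_{lk}(D_l(t))-D_k(t),\qquad D_k(t)=S_k(B_k(t)),\qquad B_k(t)=\int_0^t1_{\{Q_k(s)>0\}}\,ds .$$ Put $\lambda_k=1/\mathbf E\xi_k$, $\mu_k=1/\mathbf E\eta_k$, $\lambda=(\lambda_k)_k$ and $\mu=(\mu_k)_k$. The network is *subcritical* if $\mu>(I-P^T)^{-1}\lambda$ entrywise, and *stationary* if the process $(Q_1(t),\dots,Q_K(t))_{t\ge0}$ is stationary. For a sequence of networks a subscript $n$ is added to this notation; $K$ and $P$ do not depend on $n$. **Theorem.** 1. Suppose that a subcritical generalised Jackson network is stationary. If, for some $\theta>0$, $\mathbf Ee^{\theta\xi_k}<\infty$ and $\mathbf Ee^{\theta\eta_k}<\infty$ for all $k$, then for all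 $k$ and all $t\ge0$ $$\lim_{u\to\infty}\limsup_{n\to\infty}\mathbf P\Bigl(\frac{Q_k(nt)}{n}\ge u\Bigr)^{1/n}=0 .$$ 2. Suppose, for a sequence of subcritical stationary generalised Jackson networks indexed by $n$, that $\lambda_n\to\lambda$ and $\mu_n\to\mu$, where $\lambda,\mu\in\mathbb R^K$ are entrywise positive, and that $\sqrt n\,(\lambda_n-(I-P^T)\mu_n)\to r\in\mathbb R^K$, where all entries of $r$ are negative. If $\sup_n\mathbf E\xi_{n,k}^2<\infty$ and $\sup_n\mathbf E\eta_{n,k}^2<\infty$ for all $k$, then for all $k$ and all $t\ge0$ $$\lim_{u\to\infty}\limsup_{n\to\infty}\mathbf P\Bigl(\frac{Q_{n,k}(nt)}{\sqrt n}\ge u\Bigr)=0 .$$ 3. Suppose, for a sequence of subcritical stationary generalised Jackson networks indexed by $n$, that $\lambda_n\to\lambda$ and $\mu_n\to\mu$, where $\lambda,\mu\in\mathbb R^K$ are entrywise positive, and that $\frac{\sqrt n}{b_n}(\lambda_n-(I-P^T)\mu_n)\to r\in\mathbb R^K$, where all entries of $r$ are negative and where $b_n\to\infty$ and $b_n/\sqrt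 n\to0$. Let either of the following conditions hold: (a) for some $\epsilon>0$ and all $k$, $\sup_n\mathbf E\xi_{n,k}^{2+\epsilon}<\infty$ and $\sup_n\mathbf E\eta_{n,k}^{2+\epsilon}<\infty$, and $\sqrt{\ln n}/b_n\to\infty$; (b) for some $\alpha>0$, $\beta\in(0,1]$ and all $k$, $\sup_n\mathbf E\exp(\alpha\xi_{n,k}^\beta)<\infty$ and $\sup_n\mathbf E\exp(\alpha\eta_{n,k}^\beta)<\infty$, and $n^{\beta/2}/b_n^{2-\beta}\to\infty$. Then for all $k$ and all $t\ge0$ $$\lim_{u\to\infty}\limsup_{n\to\infty}\mathbf P\Bigl(\frac{Q_{n,k}(nt)}{b_n\sqrt n}\ge u\Bigr)^{1/b_n^2}=0 .$$ -/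

import Mathlib

open Filter Topology MeasureTheory ProbabilityTheory

universe u

namespace GenJackson

noncomputable section

/-! ### Sample-path ingredients -/

/-- The renewal counting function of a sequence of spacings `x 0, x 1, …`: the number of epochs
`x 0 + ⋯ + x i` (`i = 0, 1, …`) that do not exceed `t`. -/
def renewalCount (x : ℕ → ℝ) (t : ℝ) : ℕ :=
  {i : ℕ | ∑ j ∈ Finset.range (i + 1), x j ≤ t}.ncard

/-- `Φ l m`: the number of the first `m` departing customers that are routed to station `l`.
A routing decision is an element of `{0, 1, …, K}`; `0` means leaving the network and `l.succ`
means moving to station `l : Fin K`. -/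
def routedCount {K : ℕ} (z : ℕ → Fin (K + 1)) (l : Fin K) (m : ℕ) : ℕ :=
  ((Finset.range m).filter fun i => z i = l.succ).card

/-- Cumulative busy time `∫₀ᵗ 1_{q s > 0} ds`. -/
def busyTime (q : ℝ → ℕ) (t : ℝ) : ℝ :=
  ∫ s in (0 : ℝ)..t, (if 0 < q s then (1 : ℝ) else 0)

/-- Cumulative departures `S (B t)`, where `S` counts service completions in busy time and `B` is
the busy time. -/
def departures (y : ℕ → ℝ) (q : ℝ → ℕ) (t : ℝ) : ℕ :=
  renewalCount y (busyTime q t)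

/-! ### The independent sources of randomness -/

/-- Labels of the independent sources of randomness of a network with `K` stations: the initial
data, the (non-initial) interarrival times, the (non-initial) service times, and the routing
decisions. -/
inductive Source (K : ℕ) : Type
  | init : Source K
  | arr (k : Fin K) (i : ℕ) : Source K
  | svc (k : Fin K) (i : ℕ) : Source K
  | route (k : Fin K) (i : ℕ) : Source K

/-- The σ-algebra generated by each source. The initial data consist of the initial queue lengths,
the epochs `ξ k 0` of the first exogenous arrivals, and the first service times `η k 0` (residual
ones when a customer is in service at time `0`); within the initial data any dependence is
allowed. -/
@[reducible] def sourceSigma {K : ℕ} {Ω : Type u} (ξ η : Fin K → ℕ → Ω → ℝ)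
    (ζ : Fin K → ℕ → Ω → Fin (K + 1)) (Q : Fin K → ℝ → Ω → ℕ) :
    Source K → MeasurableSpace Ω
  | .init => (⨆ k, MeasurableSpace.comap (Q k 0) inferInstance) ⊔
      (⨆ k, MeasurableSpace.comap (ξ k 0) inferInstance) ⊔
      (⨆ k, MeasurableSpace.comap (η k 0) inferInstance)
  | .arr k i => MeasurableSpace.comap (ξ k (i + 1)) inferInstance
  | .svc k i => MeasurableSpace.comap (η k (i + 1)) inferInstance
  | .route k i => MeasurableSpace.comap (ζ k i) inferInstance

/-! ### Generalised Jackson networks -/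

/-- A generalised Jackson network with stations `Fin K` and routing matrix `P` on the probability
space `(Ω, Pr)`. -/
structure Network {K : ℕ} (P : Matrix (Fin K) (Fin K) ℝ) {Ω : Type u} [MeasurableSpace Ω]
    (Pr : Measure Ω) where
  /-- `ξ k 0` is the epoch of the first exogenous arrival at station `k`, and `ξ k i`, `i ≥ 1`, are
  the subsequent interarrival times. -/
  ξ : Fin K → ℕ → Ω → ℝ
  /-- `η k 0` is the first (possibly residual) service time at station `k`, and `η k i`, `i ≥ 1`,
  are the subsequent service times. -/
  η : Fin K → ℕ → Ω → ℝ
  /-- `ζ k i` is the destination of the `i`-th customer (counted from `0`) departing station `k`. -/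
  ζ : Fin K → ℕ → Ω → Fin (K + 1)
  /-- `Q k t` is the number of customers at station `k` at time `t`; only `t ≥ 0` matters. -/
  Q : Fin K → ℝ → Ω → ℕ
  measurable_ξ : ∀ k i, Measurable (ξ k i)
  measurable_η : ∀ k i, Measurable (η k i)
  measurable_ζ : ∀ k i, Measurable (ζ k i)
  measurable_Q : ∀ k t, 0 ≤ t → Measurable (Q k t)
  /-- No arrival and no service completion at time `0`. -/
  ξ_zero_pos : ∀ k, ∀ᵐ ω ∂Pr, 0 < ξ k 0 ω
  η_zero_pos : ∀ k, ∀ᵐ ω ∂Pr, 0 < η k 0 ω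
  ξ_nonneg : ∀ k i, ∀ᵐ ω ∂Pr, 0 ≤ ξ k i ω
  η_nonneg : ∀ k i, ∀ᵐ ω ∂Pr, 0 ≤ η k i ω
  ξ_ident : ∀ k i, IdentDistrib (ξ k (i + 1)) (ξ k 1) Pr Pr
  η_ident : ∀ k i, IdentDistrib (η k (i + 1)) (η k 1) Pr Pr
  /-- The generic interarrival and service times have finite nonzero means. -/
  ξ_integrable : ∀ k, Integrable (ξ k 1) Pr
  η_integrable : ∀ k, Integrable (η k 1) Pr
  ξ_mean_pos : ∀ k, 0 < ∫ ω, ξ k 1 ω ∂Pr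
  η_mean_pos : ∀ k, 0 < ∫ ω, η k 1 ω ∂Pr
  routing_law : ∀ k i l, Pr.real {ω | ζ k i ω = Fin.succ l} = P k l
  /-- Independence of the initial data, the interarrival and service times, and the routing. -/
  indep : iIndep (sourceSigma ξ η ζ Q) Pr
  /-- The queue lengths have right-continuous trajectories. -/
  rightCont : ∀ᵐ ω ∂Pr, ∀ k t, 0 ≤ t →
    ContinuousWithinAt (fun s => Q k s ω) (Set.Ici t) t
  /-- The queueing dynamics
  `Q_k(t) = Q_k(0) + A_k(t) + ∑_l Φ_{lk}(D_l(t)) - D_k(t)` with `D_k(t) = S_k(B_k(t))`. -/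
  dynamics : ∀ᵐ ω ∂Pr, ∀ k t, 0 ≤ t →
    (Q k t ω : ℤ) = Q k 0 ω + renewalCount (fun i => ξ k i ω) t
      + ∑ l, (routedCount (fun i => ζ l i ω) k
          (departures (fun i => η l i ω) (fun s => Q l s ω) t) : ℤ)
      - departures (fun i => η k i ω) (fun s => Q k s ω) t

namespace Network

variable {K : ℕ} {P : Matrix (Fin K) (Fin K) ℝ} {Ω : Type u} [MeasurableSpace Ω] {Pr : Measure Ω}

/-- Generic interarrival time at station `k`. -/
def genArr (N : Network P Pr) (k : Fin K) : Ω → ℝ := N.ξ k 1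

/-- Generic service time at station `k`. -/
def genSvc (N : Network P Pr) (k : Fin K) : Ω → ℝ := N.η k 1

/-- Vector of exogenous arrival rates `1 / E ξ_k`. -/
def arrRate (N : Network P Pr) : Fin K → ℝ := fun k => 1 / ∫ ω, N.genArr k ω ∂Pr

/-- Vector of service rates `1 / E η_k`. -/
def svcRate (N : Network P Pr) : Fin K → ℝ := fun k => 1 / ∫ ω, N.genSvc k ω ∂Pr

/-- Subcriticality: `(I - Pᵀ)⁻¹ λ < μ` entrywise. -/
def Subcritical (N : Network P Pr) : Prop :=
  ∀ k, Matrix.mulVec (1 - P.transpose)⁻¹ N.arrRate k < N.svcRate k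

/-- Stationarity: the finite-dimensional distributions of the vector queue-length process are
invariant under time shifts. (This is implied by stationarity of the queue lengths jointly with the
recurrence times of arrivals and the residual service times.) -/
def Stationary (N : Network P Pr) : Prop :=
  ∀ h : ℝ, 0 ≤ h → ∀ (m : ℕ) (t : Fin m → ℝ), (∀ j, 0 ≤ t j) →
    IdentDistrib (fun ω (j : Fin m) (k : Fin K) => N.Q k (t j + h) ω)
      (fun ω (j : Fin m) (k : Fin K) => N.Q k (t j) ω) Pr Pr

end Network

end

end GenJackson

namespace GenJackson

/-! ### Routing matrices -/

/-! The proof bounds the one-dimensional stationary tail by a time average and controls that average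
path by path. Stationarity gives `n * P(Q_k(0) > z) = E #{1 ≤ s ≤ n : Q_k(s) > z}`, so it suffices
to bound the long-run frequency of integer times at which a queue is long. This needs no ergodicity,
and no stationarity of the residual times: the initial data are bounded by some `M` outside an event
of small probability and are forgotten after a time depending on `M`, which vanishes on division by
`n`.

Deterministic part. Call an index `m` of a driving sequence typical if every sum of centred terms
over a block ending at `m` is at most `x + e * length` (`BackwardBounded`). If all the indices
current at time `t` are typical, the network behaves over every interval ending at `t` like its
fluid limit, up to an error `O(x + e * length)` (`queue_increment_le`). Subcriticality gives a rate
vector `nu < mu` with `(I - Pᵀ) nu = lam + κ`; if `e` is a small multiple of `κ`, the drift `κ`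
absorbs the linear errors. Comparing `mu B` with `nu t` at the time where their gap is extremal, and
using that `I - Pᵀ` has a nonnegative inverse, yields `Q_k(t) ≤ const * x` (`queue_le_of_regular`).

Frequency of atypical indices. The largest block sum ending at `m` is a Lindley recursion. After
truncation at `y` its exponential moments, averaged over `m`, stay bounded; the excess over `y`
contributes at most a multiple of its mean divided by `e`. Hence atypical indices have frequency `p`
of order `exp(-θ x) + V / e`, with `V` a bound for the truncated tail mean
(`sum_not_backwardBounded_le`).

From indices to times. An index is held for as long as the corresponding spacing lasts, so rare
indices could still occupy much time. Spacings longer than a second level are charged to second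
moments; optimising that level turns frequency `p` of indices into frequency `√p` of times
(`measureReal_queue_le`). The loss is harmless, since it only halves exponents.

The outcome, uniform over networks with bounded rates and second moments, is `P(Q_k > A x) ≤ A
√(exp(-θ x) + V / κ)` for `θ` up to a constant times `κ` (`exists_measureReal_queue_le`). The three
regimes follow by substituting the size of `κ` (constant, `1 / √n`, `b_n / √n`) and choosing `θ` and
`y` to suit the available moments. -/

theorem tendsto_pow_zero_of_spectralRadius_lt_one {A : Type*} [NormedRing A] [NormedAlgebra ℂ A]
    [CompleteSpace A] {a : A} (ha : spectralRadius ℂ a < 1) :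
    Tendsto (fun n : ℕ => a ^ n) atTop (𝓝 0) := by
  obtain ⟨r, har, hr⟩ := exists_between ha
  lift r to NNReal using (hr.trans ENNReal.one_lt_top).ne
  have hr1 : r < 1 := by exact_mod_cast hr
  have hev := (spectrum.pow_nnnorm_pow_one_div_tendsto_nhds_spectralRadius a).eventually_lt_const har
  rw [tendsto_zero_iff_norm_tendsto_zero]
  refine squeeze_zero' (Eventually.of_forall fun n => norm_nonneg _) ?_
    (tendsto_pow_atTop_nhds_zero_of_lt_one (r := (r : ℝ)) r.2 (by exact_mod_cast hr1))
  filter_upwards [hev, eventually_gt_atTop 0] with n hn hn0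
  have hn0' : (0 : ℝ) < n := by exact_mod_cast hn0
  have h1 : (‖a ^ n‖₊ : ENNReal) ≤ (r : ENNReal) ^ n := by
    have h2 := ENNReal.rpow_le_rpow hn.le hn0'.le
    rwa [← ENNReal.rpow_mul, one_div_mul_cancel hn0'.ne', ENNReal.rpow_one,
      ENNReal.rpow_natCast] at h2
  have h3 : ‖a ^ n‖₊ ≤ r ^ n := by exact_mod_cast h1
  exact_mod_cast h3

theorem tendsto_matrix_pow_apply_zero {K : ℕ} {P : Matrix (Fin K) (Fin K) ℝ}
    (hP : spectralRadius ℂ (P.map (fun x : ℝ => (x : ℂ))) < 1) (i j : Fin K) :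
    Tendsto (fun n : ℕ => (P ^ n) i j) atTop (𝓝 0) := by
  let _ : NormedRing (Matrix (Fin K) (Fin K) ℂ) := Matrix.linftyOpNormedRing
  let _ : NormedAlgebra ℂ (Matrix (Fin K) (Fin K) ℂ) := Matrix.linftyOpNormedAlgebra
  have _ : CompleteSpace (Matrix (Fin K) (Fin K) ℂ) := FiniteDimensional.complete ℂ _
  have h := tendsto_pow_zero_of_spectralRadius_lt_one hP
  have hc : Continuous fun M : Matrix (Fin K) (Fin K) ℂ => (M i j).re := by fun_prop
  have h2 := (hc.tendsto 0).comp h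
  have hmap (n : ℕ) :
      (P.map (fun x : ℝ => (x : ℂ))) ^ n = (P ^ n).map (fun x : ℝ => (x : ℂ)) :=
    (map_pow (Complex.ofRealHom.mapMatrix) P n).symm
  refine (h2.congr fun n => ?_).trans (by simp)
  simp [hmap]

/-- If `z - Pᵀ z` is nonnegative then it is bounded above by `z`. -/
theorem sub_sum_le_of_nonneg {K : ℕ} {P : Matrix (Fin K) (Fin K) ℝ} (hP0 : ∀ i j, 0 ≤ P i j)
    (hP : spectralRadius ℂ (P.map (fun x : ℝ => (x : ℂ))) < 1) {z : Fin K → ℝ}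
    (hz : ∀ k, 0 ≤ z k - ∑ l, P l k * z l) (k : Fin K) :
    z k - ∑ l, P l k * z l ≤ z k := by
  have hpow (n : ℕ) : ∀ i j, 0 ≤ (P ^ n) i j := by
    induction n with
    | zero => intro i j; by_cases h : i = j <;> simp [h]
    | succ n ih =>
      intro i j
      rw [pow_succ, Matrix.mul_apply]
      exact Finset.sum_nonneg fun l _ => mul_nonneg (ih _ _) (hP0 _ _)
  -- Iterating `Pᵀ z ≤ z` gives `(Pᵀ)ⁿ z ≤ z`. The left side tends to zero, so `z ≥ 0`, and then the
  -- subtracted term `Pᵀ z` is nonnegative too.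
  have hle (n : ℕ) (k : Fin K) : ∑ l, (P ^ n) l k * z l ≤ z k := by
    induction n with
    | zero => simp [Matrix.one_apply]
    | succ n ih =>
      refine le_trans ?_ ih
      have : ∑ l, (P ^ (n + 1)) l k * z l = ∑ j, (P ^ n) j k * ∑ l, P l j * z l := by
        simp_rw [pow_succ', Matrix.mul_apply, Finset.sum_mul, Finset.mul_sum]
        rw [Finset.sum_comm]
        refine Finset.sum_congr rfl fun j _ => Finset.sum_congr rfl fun l _ => by ring
      rw [this]
      exact Finset.sum_le_sum fun j _ =>
        mul_le_mul_of_nonneg_left (by linarith [hz j]) (hpow n j k)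
  have hz0 (k : Fin K) : 0 ≤ z k := by
    have : Tendsto (fun n : ℕ => ∑ l, (P ^ n) l k * z l) atTop (𝓝 (∑ l : Fin K, 0 * z l)) :=
      tendsto_finsetSum _ fun l _ => (tendsto_matrix_pow_apply_zero hP l k).mul_const _
    simp only [zero_mul, Finset.sum_const_zero] at this
    exact le_of_tendsto' this fun n => hle n k
  have : 0 ≤ ∑ l, P l k * z l := Finset.sum_nonneg fun l _ => mul_nonneg (hP0 _ _) (hz0 _)
  linarith

theorem one_sub_transpose_mulVec {K : ℕ} (P : Matrix (Fin K) (Fin K) ℝ) (z : Fin K → ℝ)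
    (k : Fin K) : Matrix.mulVec (1 - P.transpose) z k = z k - ∑ l, P l k * z l := by
  rw [Matrix.sub_mulVec, Matrix.one_mulVec, Pi.sub_apply]
  rfl

/-- Both a kernel vector and its negative satisfy the hypothesis of `sub_sum_le_of_nonneg`, so every
entry is both nonnegative and nonpositive. -/
theorem isUnit_det_one_sub_transpose {K : ℕ} {P : Matrix (Fin K) (Fin K) ℝ}
    (hP0 : ∀ i j, 0 ≤ P i j)
    (hP : spectralRadius ℂ (P.map (fun x : ℝ => (x : ℂ))) < 1) :
    IsUnit (1 - P.transpose).det := by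
  rw [isUnit_iff_ne_zero]
  intro h0
  obtain ⟨v, hv, hv0⟩ := Matrix.exists_mulVec_eq_zero_iff.2 h0
  have hk (k : Fin K) : v k - ∑ l, P l k * v l = 0 := by
    rw [← one_sub_transpose_mulVec, hv0]; rfl
  apply hv
  funext k
  apply le_antisymm
  · have := sub_sum_le_of_nonneg hP0 hP (z := -v) (fun k => by
      have := hk k
      simp only [Pi.neg_apply, mul_neg, Finset.sum_neg_distrib]; linarith) k
    have h2 := hk k
    simp only [Pi.neg_apply, mul_neg, Finset.sum_neg_distrib] at this
    simp only [Pi.zero_apply]; linarith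
  · have := sub_sum_le_of_nonneg hP0 hP (z := v) (fun k => (hk k).ge) k
    rw [hk k] at this; exact this

theorem inv_mulVec_sub_sum {K : ℕ} {P : Matrix (Fin K) (Fin K) ℝ}
    (hP0 : ∀ i j, 0 ≤ P i j)
    (hP : spectralRadius ℂ (P.map (fun x : ℝ => (x : ℂ))) < 1) (v : Fin K → ℝ) (k : Fin K) :
    Matrix.mulVec (1 - P.transpose)⁻¹ v k
      - ∑ l, P l k * Matrix.mulVec (1 - P.transpose)⁻¹ v l = v k := by
  rw [← one_sub_transpose_mulVec, Matrix.mulVec_mulVec,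
    Matrix.mul_nonsing_inv _ (isUnit_det_one_sub_transpose hP0 hP), Matrix.one_mulVec]

/-! ### Renewal counting functions -/

/-- Divergence of the partial sums makes the counted set a finite initial segment of `ℕ`, so that
`ncard` is its true size and not the default value for infinite sets. -/
theorem renewalCount_spec {x : ℕ → ℝ} (hx : ∀ i, 0 ≤ x i)
    (hlim : Tendsto (fun n => ∑ i ∈ Finset.range n, x i) atTop atTop) {t : ℝ} (ht : 0 ≤ t) :
    ∑ i ∈ Finset.range (renewalCount x t), x i ≤ t ∧
      t < ∑ i ∈ Finset.range (renewalCount x t + 1), x i := by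
  classical
  have hmono : Monotone fun n => ∑ i ∈ Finset.range n, x i :=
    monotone_nat_of_le_succ fun n => by rw [Finset.sum_range_succ]; linarith [hx n]
  have hex : ∃ m, t < ∑ i ∈ Finset.range (m + 1), x i :=
    ((tendsto_add_atTop_iff_nat 1).2 hlim |>.eventually_gt_atTop t).exists
  have hset : {i : ℕ | ∑ j ∈ Finset.range (i + 1), x j ≤ t} = Set.Iio (Nat.find hex) := by
    ext i
    simp only [Set.mem_ofPred_eq, Set.mem_Iio]
    rw [Nat.lt_find_iff]
    constructor
    · intro h m hm
      exact not_lt.2 ((hmono (Nat.succ_le_succ hm)).trans h)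
    · intro h
      exact not_lt.1 (h i le_rfl)
  have hcount : renewalCount x t = Nat.find hex := by
    rw [renewalCount, hset, ← Finset.coe_Iio, Set.ncard_coe_finset, Nat.card_Iio]
  rw [hcount]
  refine ⟨?_, Nat.find_spec hex⟩
  rcases Nat.eq_zero_or_pos (Nat.find hex) with h0 | h0
  · simp [h0, ht]
  · have := Nat.find_min hex (m := Nat.find hex - 1) (by omega)
    rw [show Nat.find hex - 1 + 1 = Nat.find hex by omega] at this
    exact not_lt.1 this

theorem renewalCount_mono {x : ℕ → ℝ} (hx : ∀ i, 0 ≤ x i)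
    (hlim : Tendsto (fun n => ∑ i ∈ Finset.range n, x i) atTop atTop) {s t : ℝ} (hs : 0 ≤ s)
    (hst : s ≤ t) : renewalCount x s ≤ renewalCount x t := by
  by_contra! h
  have h1 := (renewalCount_spec hx hlim hs).1
  have h2 := (renewalCount_spec hx hlim (hs.trans hst)).2
  have : ∑ i ∈ Finset.range (renewalCount x t + 1), x i
      ≤ ∑ i ∈ Finset.range (renewalCount x s), x i :=
    Finset.sum_le_sum_of_subset_of_nonneg (Finset.range_mono h) fun i _ _ => hx i
  linarith

theorem renewalCount_lt {x : ℕ → ℝ} (hx : ∀ i, 0 ≤ x i)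
    (hlim : Tendsto (fun n => ∑ i ∈ Finset.range n, x i) atTop atTop) {t : ℝ} (ht : 0 ≤ t)
    {J : ℕ} (hJ : t < ∑ i ∈ Finset.range J, x i) : renewalCount x t < J := by
  by_contra! h
  have h1 := (renewalCount_spec hx hlim ht).1
  have : ∑ i ∈ Finset.range J, x i ≤ ∑ i ∈ Finset.range (renewalCount x t), x i :=
    Finset.sum_le_sum_of_subset_of_nonneg (Finset.range_mono h) fun i _ _ => hx i
  linarith

/-! ### Busy times -/

/-- A right-continuous path is the pointwise limit of its values at the next point, strictly to the
right, of the grid of mesh `1 / (n + 1)`. The `max` discards negative times, where nothing is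
assumed. -/
theorem measurable_comp_max_of_rightCont {q : ℝ → ℕ}
    (hq : ∀ t, 0 ≤ t → ContinuousWithinAt q (Set.Ici t) t) :
    Measurable fun s => q (max s 0) := by
  have hlim : Tendsto (fun (n : ℕ) (s : ℝ) =>
      q (((⌊(n + 1 : ℝ) * max s 0⌋ + 1 : ℤ) : ℝ) / (n + 1 : ℝ))) atTop
      (𝓝 fun s => q (max s 0)) := by
    rw [tendsto_pi_nhds]
    intro s
    set t := max s 0
    have ht : 0 ≤ t := le_max_right _ _
    refine (hq t ht).tendsto.comp ?_
    refine tendsto_nhdsWithin_iff.2 ⟨?_, Eventually.of_forall fun n => ?_⟩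
    · have h1 : Tendsto (fun n : ℕ => t + 1 / ((n : ℝ) + 1)) atTop (𝓝 (t + 0)) :=
        tendsto_const_nhds.add tendsto_one_div_add_atTop_nhds_zero_nat
      rw [add_zero] at h1
      refine tendsto_of_tendsto_of_tendsto_of_le_of_le tendsto_const_nhds h1 (fun n => ?_)
        (fun n => ?_)
      · have hn : (0 : ℝ) < n + 1 := by positivity
        rw [le_div_iff₀ hn]
        push_cast
        linarith [Int.lt_floor_add_one ((n + 1 : ℝ) * t)]
      · have hn : (0 : ℝ) < n + 1 := by positivity
        rw [div_le_iff₀ hn, add_mul t, one_div_mul_cancel hn.ne']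
        push_cast
        linarith [Int.floor_le ((n + 1 : ℝ) * t)]
    · have hn : (0 : ℝ) < n + 1 := by positivity
      rw [Set.mem_Ici, le_div_iff₀ hn]
      push_cast
      linarith [Int.lt_floor_add_one ((n + 1 : ℝ) * t)]
  refine measurable_of_tendsto_metrizable (fun n => ?_) hlim
  have h1 : Measurable fun s : ℝ => ⌊(n + 1 : ℝ) * max s 0⌋ := by fun_prop
  exact (measurable_from_top (f := fun z : ℤ => q (((z + 1 : ℤ) : ℝ) / (n + 1 : ℝ)))).comp h1

theorem intervalIntegrable_busy {q : ℝ → ℕ}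
    (hq : ∀ t, 0 ≤ t → ContinuousWithinAt q (Set.Ici t) t) {s t : ℝ} (hs : 0 ≤ s) (ht : 0 ≤ t) :
    IntervalIntegrable (fun r => if 0 < q r then (1 : ℝ) else 0) volume s t := by
  have hm : Measurable fun r => if 0 < q (max r 0) then (1 : ℝ) else 0 :=
    (measurable_from_top (f := fun n : ℕ => if 0 < n then (1 : ℝ) else 0)).comp
      (measurable_comp_max_of_rightCont hq)
  have h1 : IntervalIntegrable (fun r => if 0 < q (max r 0) then (1 : ℝ) else 0) volume s t := by
    refine (intervalIntegrable_const (c := (1 : ℝ))).mono_fun hm.aestronglyMeasurable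
      (Eventually.of_forall fun r => ?_)
    dsimp only
    split_ifs <;> simp
  refine h1.congr ?_
  intro r hr
  have : 0 ≤ r := by
    rw [Set.mem_uIoc] at hr
    rcases hr with h | h <;> linarith
  dsimp only
  rw [max_eq_left this]

theorem busyTime_sub {q : ℝ → ℕ} (hq : ∀ t, 0 ≤ t → ContinuousWithinAt q (Set.Ici t) t) {s t : ℝ}
    (hs : 0 ≤ s) (hst : s ≤ t) :
    busyTime q t - busyTime q s = ∫ r in s..t, (if 0 < q r then (1 : ℝ) else 0) :=
  intervalIntegral.integral_interval_sub_left
    (intervalIntegrable_busy hq le_rfl (hs.trans hst)) (intervalIntegrable_busy hq le_rfl hs)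

theorem busyTime_mono {q : ℝ → ℕ} (hq : ∀ t, 0 ≤ t → ContinuousWithinAt q (Set.Ici t) t)
    {s t : ℝ} (hs : 0 ≤ s) (hst : s ≤ t) : busyTime q s ≤ busyTime q t := by
  rw [← sub_nonneg, busyTime_sub hq hs hst]
  exact intervalIntegral.integral_nonneg hst fun r _ => by split_ifs <;> norm_num

theorem busyTime_sub_le {q : ℝ → ℕ} (hq : ∀ t, 0 ≤ t → ContinuousWithinAt q (Set.Ici t) t)
    {s t : ℝ} (hs : 0 ≤ s) (hst : s ≤ t) : busyTime q t - busyTime q s ≤ t - s := by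
  rw [busyTime_sub hq hs hst]
  calc _ ≤ ∫ _ in s..t, (1 : ℝ) :=
        intervalIntegral.integral_mono_on hst (intervalIntegrable_busy hq hs (hs.trans hst))
          intervalIntegrable_const fun r _ => by split_ifs <;> norm_num
    _ = t - s := by simp

@[simp] theorem busyTime_zero (q : ℝ → ℕ) : busyTime q 0 = 0 := by simp [busyTime]

theorem busyTime_nonneg {q : ℝ → ℕ} (hq : ∀ t, 0 ≤ t → ContinuousWithinAt q (Set.Ici t) t)
    {t : ℝ} (ht : 0 ≤ t) : 0 ≤ busyTime q t := by
  simpa using busyTime_mono hq le_rfl ht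

theorem busyTime_le {q : ℝ → ℕ} (hq : ∀ t, 0 ≤ t → ContinuousWithinAt q (Set.Ici t) t)
    {t : ℝ} (ht : 0 ≤ t) : busyTime q t ≤ t := by
  simpa using busyTime_sub_le hq le_rfl ht

theorem busyTime_sub_eq {q : ℝ → ℕ} (hq : ∀ t, 0 ≤ t → ContinuousWithinAt q (Set.Ici t) t)
    {s t : ℝ} (hs : 0 ≤ s) (hst : s ≤ t) (hpos : ∀ r, s < r → r < t → 0 < q r) :
    busyTime q t - busyTime q s = t - s := by
  rw [busyTime_sub hq hs hst]
  calc _ = ∫ _ in s..t, (1 : ℝ) := by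
        refine intervalIntegral.integral_congr_ae ?_
        have : ∀ᵐ r : ℝ, r ≠ t := by simp [ae_iff]
        filter_upwards [this] with r hr hr'
        rw [Set.uIoc_of_le hst] at hr'
        rw [if_pos (hpos r hr'.1 (lt_of_le_of_ne hr'.2 hr))]
    _ = t - s := by simp

theorem continuousOn_busyTime {q : ℝ → ℕ}
    (hq : ∀ t, 0 ≤ t → ContinuousWithinAt q (Set.Ici t) t) :
    ContinuousOn (busyTime q) (Set.Ici 0) := by
  have h : LipschitzOnWith 1 (busyTime q) (Set.Ici 0) := by
    refine LipschitzOnWith.of_le_add fun s hs t ht => ?_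
    rw [Real.dist_eq]
    rcases le_total s t with hst | hst
    · linarith [busyTime_mono hq hs hst, abs_nonneg (s - t)]
    · linarith [busyTime_sub_le hq ht hst, le_abs_self (s - t)]
  exact h.continuousOn

/-! ### Increments of counting processes -/

/-- All sums of `g` over blocks of indices ending at `m` are bounded by an affine function of the
length of the block. -/
def BackwardBounded (g : ℕ → ℝ) (x e : ℝ) (m : ℕ) : Prop :=
  ∀ j ≤ m, ∑ i ∈ Finset.Ico j m, g i ≤ x + e * ((m : ℝ) - j)

/-- The spacings lying entirely between two consecutive counted epochs after `s` and up to `t` add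
up to less than `t - s`, while typicality makes `d` of them last at least `d * (a - e) - x`. The
first epoch after `s` is counted separately: this costs the summand `1` and keeps the residual
spacing `ξ 0` out of the estimate. -/
theorem renewalCount_sub_le {ξ : ℕ → ℝ} (hξ : ∀ i, 0 ≤ ξ i)
    (hlim : Tendsto (fun n => ∑ i ∈ Finset.range n, ξ i) atTop atTop) {a r x e s t : ℝ}
    (hr : 0 < r) (har : a * r = 1) (hx : 0 ≤ x) (he : 0 ≤ e) (hre : r * e ≤ 1 / 2)
    (hs : 0 ≤ s) (hst : s ≤ t)
    (hb : BackwardBounded (fun i => a - ξ (i + 1)) x e (renewalCount ξ t - 1)) :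
    (renewalCount ξ t : ℝ) - renewalCount ξ s ≤ 1 + 2 * r * x + (r + 2 * r ^ 2 * e) * (t - s) := by
  have hτ : 0 ≤ t - s := sub_nonneg.2 hst
  have hrhs : 0 ≤ 2 * r * x + (r + 2 * r ^ 2 * e) * (t - s) := by positivity
  rcases le_or_gt (renewalCount ξ t) (renewalCount ξ s) with h | h
  · have : (renewalCount ξ t : ℝ) ≤ renewalCount ξ s := by exact_mod_cast h
    linarith
  obtain ⟨d, hd⟩ := Nat.exists_eq_add_of_lt h
  set j := renewalCount ξ s
  have h1 := (renewalCount_spec hξ hlim (hs.trans hst)).1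
  have h2 := (renewalCount_spec hξ hlim hs).2
  have h3 := hb j (by omega)
  rw [show renewalCount ξ t - 1 = j + d by omega] at h3
  rw [hd] at h1 ⊢
  have h4 : ∑ i ∈ Finset.range (j + d + 1), ξ i
      = ∑ i ∈ Finset.range (j + 1), ξ i + ∑ i ∈ Finset.Ico j (j + d), ξ (i + 1) := by
    rw [Finset.sum_Ico_add' (fun i => ξ i) j (j + d) 1, Finset.sum_range_add_sum_Ico]
    omega
  rw [Finset.sum_sub_distrib, Finset.sum_const, Nat.card_Ico, nsmul_eq_mul] at h3
  have h5 : ((j + d - j : ℕ) : ℝ) = d := by simp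
  rw [h5] at h3
  push_cast at h3 ⊢
  have h6 : (d : ℝ) * (a - e) ≤ x + (t - s) := by linarith
  have h7 : (0 : ℝ) < a := by
    by_contra! h; nlinarith
  -- `2 * r` and `r + 2 * r ^ 2 * e` are upper bounds for `1 / (a - e)`, valid because `r * e ≤ 1 /
  -- 2`.
  have h8 : (1 : ℝ) ≤ (a - e) * (2 * r) := by linarith
  have h9 : (1 : ℝ) ≤ (a - e) * (r + 2 * r ^ 2 * e) := by
    have : (a - e) * (r + 2 * r ^ 2 * e)
      = a * r + 2 * (a * r) * (r * e) - (r * e) - 2 * (r * e) ^ 2 := by ring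
    rw [this, har]
    nlinarith [mul_nonneg hr.le he]
  have h10 : 0 < a - e := by nlinarith
  have h11 : (d : ℝ) * (a - e) ≤ (2 * r * x + (r + 2 * r ^ 2 * e) * (t - s)) * (a - e) := by
    linarith [mul_le_mul_of_nonneg_right h8 hx, mul_le_mul_of_nonneg_right h9 hτ]
  have := le_of_mul_le_mul_right h11 h10
  linarith

/-- The interval is covered by the spacings with indices from the count at `s` to the count at `t`,
both included. The residual spacing `η 0` is among them exactly when the count at `s` is zero,
whence the conditional term. The slope `r * (1 - r * e)` is a lower bound for `1 / (a + e)`. -/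
theorem le_renewalCount_sub {η : ℕ → ℝ} (hη : ∀ i, 0 ≤ η i)
    (hlim : Tendsto (fun n => ∑ i ∈ Finset.range n, η i) atTop atTop) {a r x e s t : ℝ}
    (hr : 0 < r) (har : a * r = 1) (hx : 0 ≤ x) (he : 0 ≤ e) (hre : r * e ≤ 1 / 2)
    (hs : 0 ≤ s) (hst : s ≤ t)
    (hb : BackwardBounded (fun i => η (i + 1) - a) x e (renewalCount η t)) :
    r * (1 - r * e) * (t - s) - r * x - 1 - (if renewalCount η s = 0 then r * η 0 else 0)
      ≤ (renewalCount η t : ℝ) - renewalCount η s := by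
  have hjm := renewalCount_mono hη hlim hs hst
  have h1 := (renewalCount_spec hη hlim (hs.trans hst)).2
  have h2 := (renewalCount_spec hη hlim hs).1
  set m := renewalCount η t
  set j := renewalCount η s
  have hjm' : (j : ℝ) ≤ m := by exact_mod_cast hjm
  have ha : 0 < a := pos_of_mul_pos_left (har ▸ one_pos) hr.le
  have hre0 : 0 ≤ r * e := by positivity
  have hc : 0 ≤ r * (1 - r * e) := mul_nonneg hr.le (by linarith)
  have hsum (i₀ : ℕ) (hi : i₀ ≤ m) : ∑ i ∈ Finset.Ico i₀ m, η (i + 1)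
      ≤ x + (a + e) * ((m : ℝ) - i₀) := by
    have h3 := hb i₀ hi
    rw [Finset.sum_sub_distrib, Finset.sum_const, Nat.card_Ico, nsmul_eq_mul,
      Nat.cast_sub hi] at h3
    linarith
  have hkey (w : ℝ) (hw : 0 ≤ w) (h : t - s ≤ w + x + (a + e) * ((m : ℝ) - j + 1)) :
      r * (1 - r * e) * (t - s) - r * x - 1 - r * w ≤ (m : ℝ) - j := by
    have h3 := mul_le_mul_of_nonneg_left h hc
    have h4 : r * (1 - r * e) * (a + e) ≤ 1 := by
      have : r * (1 - r * e) * (a + e) = (a * r) * (1 - r * e) + (r * e) * (1 - r * e) := by ring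
      rw [this, har]; linarith [sq_nonneg (r * e)]
    have h5 : r * (1 - r * e) * (w + x) ≤ r * (w + x) :=
      mul_le_mul_of_nonneg_right (mul_le_of_le_one_right hr.le (by linarith)) (by positivity)
    have h6 := mul_le_mul_of_nonneg_right h4 (show 0 ≤ (m : ℝ) - j + 1 by linarith)
    linarith
  rcases Nat.eq_zero_or_pos j with hj | hj
  · rw [if_pos hj]
    refine hkey _ (hη 0) ?_
    have h3 := hsum 0 (Nat.zero_le _)
    rw [Finset.sum_range_succ'] at h1
    rw [hj] at h2 ⊢
    rw [← Finset.range_eq_Ico] at h3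
    simp only [Finset.range_zero, Finset.sum_empty] at h2
    push_cast at h3 ⊢
    linarith
  · rw [if_neg hj.ne']
    have h3 := hsum (j - 1) (by omega)
    rw [Finset.sum_Ico_add' (fun i => η i) (j - 1) m 1, Nat.sub_add_cancel hj,
      Nat.cast_sub hj] at h3
    have h4 := Finset.sum_range_add_sum_Ico η (show j ≤ m + 1 by omega)
    have := hkey 0 le_rfl (by push_cast at h3; linarith)
    linarith

theorem routedCount_eq_sum {K : ℕ} (z : ℕ → Fin (K + 1)) (l : Fin K) (m : ℕ) :
    (routedCount z l m : ℝ) = ∑ i ∈ Finset.range m, if z i = l.succ then (1 : ℝ) else 0 := by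
  simp [routedCount]

theorem routedCount_mono {K : ℕ} (z : ℕ → Fin (K + 1)) (l : Fin K) : Monotone (routedCount z l) :=
  fun _ _ h => Finset.card_le_card (Finset.filter_subset_filter _ (Finset.range_mono h))

theorem routedCount_sub_le {K : ℕ} {z : ℕ → Fin (K + 1)} {l : Fin K} {p x e : ℝ} {j m : ℕ}
    (hjm : j ≤ m)
    (hb : BackwardBounded (fun i => (if z i = l.succ then (1 : ℝ) else 0) - p) x e m) :
    (routedCount z l m : ℝ) - routedCount z l j ≤ x + (p + e) * ((m : ℝ) - j) := by
  have h := hb j hjm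
  rw [Finset.sum_sub_distrib, Finset.sum_const, Nat.card_Ico, nsmul_eq_mul, Nat.cast_sub hjm,
    Finset.sum_Ico_eq_sub _ hjm, ← routedCount_eq_sum, ← routedCount_eq_sum] at h
  linarith

/-! ### Sample paths -/

/-- A sample path of a generalised Jackson network. -/
structure IsTrajectory {K : ℕ} (ξ η : Fin K → ℕ → ℝ) (ζ : Fin K → ℕ → Fin (K + 1))
    (Q : Fin K → ℝ → ℕ) : Prop where
  ξ_nonneg : ∀ k i, 0 ≤ ξ k i
  η_nonneg : ∀ k i, 0 ≤ η k i
  tendsto_ξ : ∀ k, Tendsto (fun n => ∑ i ∈ Finset.range n, ξ k i) atTop atTop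
  tendsto_η : ∀ k, Tendsto (fun n => ∑ i ∈ Finset.range n, η k i) atTop atTop
  rightCont : ∀ k t, 0 ≤ t → ContinuousWithinAt (Q k) (Set.Ici t) t
  dynamics : ∀ k t, 0 ≤ t →
    (Q k t : ℤ) = Q k 0 + renewalCount (ξ k) t
      + ∑ l, (routedCount (ζ l) k (departures (η l) (Q l) t) : ℤ) - departures (η k) (Q k) t

namespace IsTrajectory

variable {K : ℕ} {ξ η : Fin K → ℕ → ℝ} {ζ : Fin K → ℕ → Fin (K + 1)} {Q : Fin K → ℝ → ℕ}

theorem dynamics_real (h : IsTrajectory ξ η ζ Q) (k : Fin K) {t : ℝ} (ht : 0 ≤ t) :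
    (Q k t : ℝ) = Q k 0 + renewalCount (ξ k) t
      + ∑ l, (routedCount (ζ l) k (departures (η l) (Q l) t) : ℝ)
      - departures (η k) (Q k) t := by
  have := congrArg (fun z : ℤ => (z : ℝ)) (h.dynamics k t ht)
  push_cast at this
  exact this

theorem departures_mono (h : IsTrajectory ξ η ζ Q) (k : Fin K) {s t : ℝ} (hs : 0 ≤ s)
    (hst : s ≤ t) : departures (η k) (Q k) s ≤ departures (η k) (Q k) t :=
  renewalCount_mono (h.η_nonneg k) (h.tendsto_η k) (busyTime_nonneg (h.rightCont k) hs)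
    (busyTime_mono (h.rightCont k) hs hst)

theorem inflow_mono (h : IsTrajectory ξ η ζ Q) (k : Fin K) {s t : ℝ} (hs : 0 ≤ s)
    (hst : s ≤ t) : (∑ l, (routedCount (ζ l) k (departures (η l) (Q l) s) : ℤ))
      ≤ ∑ l, (routedCount (ζ l) k (departures (η l) (Q l) t) : ℤ) :=
  Finset.sum_le_sum fun l _ => by
    exact_mod_cast routedCount_mono _ _ (h.departures_mono l hs hst)

theorem arrivals_mono (h : IsTrajectory ξ η ζ Q) (k : Fin K) {s t : ℝ} (hs : 0 ≤ s)
    (hst : s ≤ t) : renewalCount (ξ k) s ≤ renewalCount (ξ k) t :=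
  renewalCount_mono (h.ξ_nonneg k) (h.tendsto_ξ k) hs hst

/-- While no customer departs, the queue does not decrease. -/
theorem queue_le_of_departures_eq (h : IsTrajectory ξ η ζ Q) (k : Fin K) {s t : ℝ} (hs : 0 ≤ s)
    (hst : s ≤ t) (hD : departures (η k) (Q k) s = departures (η k) (Q k) t) :
    Q k s ≤ Q k t := by
  have h1 := h.dynamics k s hs
  have h2 := h.dynamics k t (hs.trans hst)
  have h3 := h.inflow_mono k hs hst
  have h4 : (renewalCount (ξ k) s : ℤ) ≤ renewalCount (ξ k) t := by
    exact_mod_cast h.arrivals_mono k hs hst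
  rw [hD] at h1
  omega

/-- Two times at which the queue is empty and between which no customer departs lie in the same
exogenous interarrival interval. -/
theorem arrivals_eq_of_empty (h : IsTrajectory ξ η ζ Q) (k : Fin K) {s t : ℝ} (hs : 0 ≤ s)
    (hst : s ≤ t) (hD : departures (η k) (Q k) s = departures (η k) (Q k) t)
    (hQs : Q k s = 0) (hQt : Q k t = 0) :
    renewalCount (ξ k) s = renewalCount (ξ k) t := by
  have h1 := h.dynamics k s hs
  have h2 := h.dynamics k t (hs.trans hst)
  have h3 := h.inflow_mono k hs hst
  have h4 := h.arrivals_mono k hs hst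
  rw [hD, hQs] at h1
  rw [hQt] at h2
  omega

/-- A queue that is empty before its first departure cannot have received a customer. This limits
how long the residual service time can influence a station. -/
theorem lt_of_empty_of_departures_eq_zero (h : IsTrajectory ξ η ζ Q) (k : Fin K) {t : ℝ}
    (ht : 0 ≤ t) (hD : departures (η k) (Q k) t = 0) (hQ : Q k t = 0) : t < ξ k 0 := by
  have h1 := h.dynamics k t ht
  have h3 : (0 : ℤ) ≤ ∑ l, (routedCount (ζ l) k (departures (η l) (Q l) t) : ℤ) :=
    Finset.sum_nonneg fun l _ => by positivity
  rw [hD, hQ] at h1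
  have h2 : renewalCount (ξ k) t = 0 := by push_cast at h1; omega
  have := (renewalCount_spec (h.ξ_nonneg k) (h.tendsto_ξ k) ht).2
  rw [h2] at this
  simpa using this

/-- All sequences driving the network have controlled backward block sums at time `t`. -/
structure Regular (ξ η : Fin K → ℕ → ℝ) (ζ : Fin K → ℕ → Fin (K + 1)) (Q : Fin K → ℝ → ℕ)
    (P : Matrix (Fin K) (Fin K) ℝ) (a c : Fin K → ℝ) (x e t : ℝ) : Prop where
  arr : ∀ k, BackwardBounded (fun i => a k - ξ k (i + 1)) x e (renewalCount (ξ k) t - 1)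
  svc_lower : ∀ k, BackwardBounded (fun i => c k - η k (i + 1)) x e
    (departures (η k) (Q k) t - 1)
  svc_upper : ∀ k, BackwardBounded (fun i => η k (i + 1) - c k) x e (departures (η k) (Q k) t)
  route : ∀ l k, BackwardBounded
    (fun i => (if ζ l i = k.succ then (1 : ℝ) else 0) - P l k) x e (departures (η l) (Q l) t)

/-- Fluid bound for the increments of the queue length over an interval ending at a regular
time. -/
theorem queue_increment_le (h : IsTrajectory ξ η ζ Q) {P : Matrix (Fin K) (Fin K) ℝ}
    (hP0 : ∀ i j, 0 ≤ P i j) (hP1 : ∀ i j, P i j ≤ 1) {a c lam mu : Fin K → ℝ} {L x e : ℝ}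
    (hlam : ∀ k, 0 < lam k) (hmu : ∀ k, 0 < mu k) (ha : ∀ k, a k * lam k = 1)
    (hc : ∀ k, c k * mu k = 1) (hL : 1 ≤ L) (hlamL : ∀ k, lam k ≤ L) (hmuL : ∀ k, mu k ≤ L)
    (hx : 1 ≤ x) (he : 0 ≤ e) (hLe : L * e ≤ 1 / 2) {s t : ℝ} (hs : 0 ≤ s) (hst : s ≤ t)
    (hreg : Regular ξ η ζ Q P a c x e t) (k : Fin K) :
    (Q k t : ℝ) ≤ Q k s + lam k * (t - s)
      + ∑ l, P l k * (mu l * (busyTime (Q l) t - busyTime (Q l) s))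
      - mu k * (busyTime (Q k) t - busyTime (Q k) s)
      + 6 * (K + 1) * L ^ 2 * x + 6 * (K + 1) * L ^ 2 * e * (t - s)
      + (if departures (η k) (Q k) s = 0 then L * η k 0 else 0) := by
  have hτ : 0 ≤ t - s := sub_nonneg.2 hst
  have ht : 0 ≤ t := hs.trans hst
  have hx0 : 0 ≤ x := by linarith
  have hre (r : ℝ) (hr : r ≤ L) : r * e ≤ 1 / 2 :=
    (mul_le_mul_of_nonneg_right hr he).trans hLe
  have hL0 : 0 ≤ L := by linarith
  have hLL : L ≤ L ^ 2 := by nlinarith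
  have heτ : 0 ≤ e * (t - s) := by positivity
  have hupper (r y b : ℝ) (hr : 0 < r) (hrL : r ≤ L) (hb : 0 ≤ b) (hbτ : b ≤ t - s)
      (hy : y ≤ 1 + 2 * r * x + (r + 2 * r ^ 2 * e) * b) :
      y ≤ r * b + 3 * L * x + 2 * L ^ 2 * (e * (t - s)) := by
    have h1 : r * x ≤ L * x := mul_le_mul_of_nonneg_right hrL hx0
    have h2 : r ^ 2 * (e * b) ≤ L ^ 2 * (e * (t - s)) := by gcongr
    nlinarith
  have hA : (renewalCount (ξ k) t : ℝ) - renewalCount (ξ k) s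
      ≤ lam k * (t - s) + 3 * L * x + 2 * L ^ 2 * (e * (t - s)) :=
    hupper _ _ _ (hlam k) (hlamL k) hτ le_rfl
      (renewalCount_sub_le (h.ξ_nonneg k) (h.tendsto_ξ k) (hlam k) (ha k) hx0 he
        (hre _ (hlamL k)) hs hst (hreg.arr k))
  have hB0 (l : Fin K) : 0 ≤ busyTime (Q l) t - busyTime (Q l) s :=
    sub_nonneg.2 (busyTime_mono (h.rightCont l) hs hst)
  have hB1 (l : Fin K) : busyTime (Q l) t - busyTime (Q l) s ≤ t - s :=
    busyTime_sub_le (h.rightCont l) hs hst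
  have hD (l : Fin K) : (departures (η l) (Q l) t : ℝ) - departures (η l) (Q l) s
      ≤ mu l * (busyTime (Q l) t - busyTime (Q l) s) + 3 * L * x + 2 * L ^ 2 * (e * (t - s)) :=
    hupper _ _ _ (hmu l) (hmuL l) (hB0 l) (hB1 l)
      (renewalCount_sub_le (h.η_nonneg l) (h.tendsto_η l) (hmu l) (hc l) hx0 he
        (hre _ (hmuL l)) (busyTime_nonneg (h.rightCont l) hs)
        (busyTime_mono (h.rightCont l) hs hst) (hreg.svc_lower l))
  have hDlow := le_renewalCount_sub (h.η_nonneg k) (h.tendsto_η k) (hmu k) (hc k) hx0 he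
    (hre _ (hmuL k)) (busyTime_nonneg (h.rightCont k) hs)
    (busyTime_mono (h.rightCont k) hs hst) (hreg.svc_upper k)
  -- Only the lower bound on departures can involve the residual service time, and only if the first
  -- service at station `k` is not yet completed at `s`.
  have hDk : mu k * (busyTime (Q k) t - busyTime (Q k) s) - L ^ 2 * (e * (t - s)) - 2 * L * x
      - (if departures (η k) (Q k) s = 0 then L * η k 0 else 0)
      ≤ (departures (η k) (Q k) t : ℝ) - departures (η k) (Q k) s := by
    refine le_trans ?_ hDlow
    have h1 : mu k ^ 2 * (e * (busyTime (Q k) t - busyTime (Q k) s)) ≤ L ^ 2 * (e * (t - s)) := by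
      have := (hmu k).le
      have := hmuL k
      have := hB1 k
      have := hB0 k
      gcongr
    have h2 : mu k * x ≤ L * x := mul_le_mul_of_nonneg_right (hmuL k) hx0
    have h3 : (if renewalCount (η k) (busyTime (Q k) s) = 0 then mu k * η k 0 else 0)
        ≤ (if departures (η k) (Q k) s = 0 then L * η k 0 else 0) := by
      unfold departures
      split_ifs
      · exact mul_le_mul_of_nonneg_right (hmuL k) (h.η_nonneg k 0)
      · exact le_rfl
    nlinarith
  have hR (l : Fin K) : (routedCount (ζ l) k (departures (η l) (Q l) t) : ℝ)
      - routedCount (ζ l) k (departures (η l) (Q l) s)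
      ≤ P l k * (mu l * (busyTime (Q l) t - busyTime (Q l) s))
        + 6 * L * x + 4 * L ^ 2 * (e * (t - s)) := by
    have h1 := routedCount_sub_le (h.departures_mono l hs hst) (hreg.route l k)
    have h2 := mul_le_mul_of_nonneg_left (hD l) (add_nonneg (hP0 l k) he)
    have h3 : P l k * (3 * L * x + 2 * L ^ 2 * (e * (t - s)))
        ≤ 1 * (3 * L * x + 2 * L ^ 2 * (e * (t - s))) :=
      mul_le_mul_of_nonneg_right (hP1 l k) (by positivity)
    have h4 : mu l * (e * (busyTime (Q l) t - busyTime (Q l) s)) ≤ L * (e * (t - s)) := by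
      have := (hmu l).le
      have := hmuL l
      have := hB1 l
      have := hB0 l
      gcongr
    have h5 : (L * e) * (3 * x + 2 * L * (e * (t - s)))
        ≤ 1 / 2 * (3 * x + 2 * L * (e * (t - s))) :=
      mul_le_mul_of_nonneg_right hLe (by positivity)
    have h6 : L * (e * (t - s)) ≤ L ^ 2 * (e * (t - s)) :=
      mul_le_mul_of_nonneg_right hLL heτ
    have h7 : x ≤ L * x := le_mul_of_one_le_left hx0 hL
    linarith
  have hRsum : ∑ l, (routedCount (ζ l) k (departures (η l) (Q l) t) : ℝ)
      - ∑ l, (routedCount (ζ l) k (departures (η l) (Q l) s) : ℝ)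
      ≤ ∑ l, P l k * (mu l * (busyTime (Q l) t - busyTime (Q l) s))
        + K * (6 * L * x + 4 * L ^ 2 * (e * (t - s))) := by
    rw [← Finset.sum_sub_distrib]
    refine (Finset.sum_le_sum fun l _ => (hR l).trans_eq (add_assoc _ _ _)).trans_eq ?_
    rw [Finset.sum_add_distrib, Finset.sum_const, Finset.card_univ, Fintype.card_fin, nsmul_eq_mul]
  rw [h.dynamics_real k ht, h.dynamics_real k hs]
  have h1 : L * x ≤ L ^ 2 * x := mul_le_mul_of_nonneg_right hLL hx0
  have hK : (0 : ℝ) ≤ K := Nat.cast_nonneg K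
  have h2 : (K : ℝ) * (L * x) ≤ K * (L ^ 2 * x) := mul_le_mul_of_nonneg_left h1 hK
  have h3 : 0 ≤ (K : ℝ) * (L ^ 2 * (e * (t - s))) := by positivity
  have h4 : 0 ≤ L ^ 2 * (e * (t - s)) := by positivity
  have h5 : 0 ≤ L ^ 2 * x := by positivity
  linarith

/-- Queue lengths at regular times, long after the initial data have been forgotten. -/
theorem queue_le_of_regular (h : IsTrajectory ξ η ζ Q) {P : Matrix (Fin K) (Fin K) ℝ}
    (hP0 : ∀ i j, 0 ≤ P i j) (hP1 : ∀ i j, P i j ≤ 1)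
    (hP : spectralRadius ℂ (P.map (fun x : ℝ => (x : ℂ))) < 1)
    {a c lam mu nu w : Fin K → ℝ} {L x e κ M : ℝ}
    (hlam : ∀ k, 0 < lam k) (hmu : ∀ k, 0 < mu k) (ha : ∀ k, a k * lam k = 1)
    (hc : ∀ k, c k * mu k = 1) (hL : 1 ≤ L) (hlamL : ∀ k, lam k ≤ L) (hmuL : ∀ k, mu k ≤ L)
    (hnu : ∀ k, nu k < mu k) (hκ : 0 < κ)
    (hnulam : ∀ k, nu k - ∑ l, P l k * nu l = lam k + κ)
    (hw : ∀ k, w k - ∑ l, P l k * w l = 1)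
    (hx : 1 ≤ x) (he : 0 ≤ e) (hLe : L * e ≤ 1 / 2) (heκ : 6 * (K + 1) * L ^ 2 * e ≤ κ / 2)
    (hM : 0 ≤ M) (hQM : ∀ k, (Q k 0 : ℝ) ≤ M) (hξM : ∀ k, ξ k 0 ≤ M) (hηM : ∀ k, η k 0 ≤ M)
    {t : ℝ} (htM : M + 2 * (1 + L) * M / κ ≤ t) (hreg : Regular ξ η ζ Q P a c x e t)
    (k : Fin K) : (Q k t : ℝ) ≤ (6 * (K + 1) * L ^ 2 + 1) * x * w k := by
  have hL0 : 0 < L := by linarith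
  have ht : 0 ≤ t := le_trans (by positivity) htM
  set C := 6 * ((K : ℝ) + 1) * L ^ 2 with hC
  -- `nu k * s - mu k * busyTime (Q k) s` is the lag of the potential output behind an output at the
  -- intermediate rate `nu k`; `r k` is a time of maximal lag, chosen for each station separately.
  have hexists (k : Fin K) : ∃ r ∈ Set.Icc 0 t, ∀ s ∈ Set.Icc 0 t,
      nu k * s - mu k * busyTime (Q k) s ≤ nu k * r - mu k * busyTime (Q k) r := by
    have hcont : ContinuousOn (fun s => nu k * s - mu k * busyTime (Q k) s) (Set.Icc 0 t) :=
      (continuousOn_const.mul continuousOn_id).sub (continuousOn_const.mul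
        ((continuousOn_busyTime (h.rightCont k)).mono Set.Icc_subset_Ici_self))
    obtain ⟨r, hr, hmax⟩ := isCompact_Icc.exists_isMaxOn ⟨0, Set.left_mem_Icc.2 ht⟩ hcont
    exact ⟨r, hr, fun s hs => hmax hs⟩
  choose r hr hmax using hexists
  set Y : Fin K → ℝ → ℝ := fun k s => nu k * s - mu k * busyTime (Q k) s with hY
  set V : Fin K → ℝ := fun k => Y k (r k) - Y k t with hV
  have hV0 (k : Fin K) : 0 ≤ V k := sub_nonneg.2 (hmax k t (Set.right_mem_Icc.2 ht))
  -- the bound for the queue lengths corrected by the work done in advance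
  have hstep (k : Fin K) (v : ℝ) (hv : v ∈ Set.Icc 0 t) :
      (Q k t : ℝ) + V k - ∑ l, P l k * V l ≤ Q k v + C * x - κ / 2 * (t - v)
        + (Y k (r k) - Y k v) + (if departures (η k) (Q k) v = 0 then L * η k 0 else 0) := by
    have h1 := h.queue_increment_le hP0 hP1 hlam hmu ha hc hL hlamL hmuL hx he hLe hv.1 hv.2 hreg k
    -- Since `r l` maximises the lag, station `l` outputs after any time `v` at most `nu l * (t - v)
    -- + V l`. Moving the `V l` to the left leaves an inflow at rates `nu`, whatever `v` is.
    have h2 : ∑ l, P l k * (mu l * (busyTime (Q l) t - busyTime (Q l) v)) - ∑ l, P l k * V l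
        ≤ (∑ l, P l k * nu l) * (t - v) := by
      rw [← Finset.sum_sub_distrib, Finset.sum_mul]
      refine Finset.sum_le_sum fun l _ => ?_
      rw [← mul_sub, mul_assoc]
      refine mul_le_mul_of_nonneg_left ?_ (hP0 l k)
      have := hmax l v hv
      simp only [hV, hY]
      linarith
    have h3 : C * e * (t - v) ≤ κ / 2 * (t - v) :=
      mul_le_mul_of_nonneg_right heκ (sub_nonneg.2 hv.2)
    have h4 : ∑ l, P l k * nu l = nu k - lam k - κ := by linarith [hnulam k]
    rw [h4] at h2
    simp only [hV, hY] at h2 ⊢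
    linarith
  have hcorr (k : Fin K) : (Q k t : ℝ) + V k - ∑ l, P l k * V l ≤ (C + 1) * x := by
    have hκM : κ * (2 * (1 + L) * M / κ) = 2 * (1 + L) * M := by field_simp
    have hηterm (v : ℝ) : (if departures (η k) (Q k) v = 0 then L * η k 0 else 0) ≤ L * M := by
      split_ifs
      · exact mul_le_mul_of_nonneg_left (hηM k) hL0.le
      · positivity
    -- With maximal lag at time zero, the initial queue and the residual service contribute at most
    -- `(1 + L) * M`, which the drift `κ / 2 * t` absorbs by the choice of the lower bound on `t`.
    rcases eq_or_lt_of_le (hr k).1 with hr0 | hr0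
    · have h1 := hstep k 0 (Set.left_mem_Icc.2 ht)
      rw [← hr0] at h1
      have h2 := hηterm 0
      have h3 := hQM k
      have h4 : κ * (M + 2 * (1 + L) * M / κ) ≤ κ * t := mul_le_mul_of_nonneg_left htM hκ.le
      have h5 : 0 ≤ κ * M := by positivity
      linarith
    -- Otherwise the queue is empty shortly before `r k`: a station that stays busy works at rate
    -- `mu k > nu k`, so its lag decreases strictly and cannot be maximal at the end. The window `1
    -- / L` keeps the change of lag between `v` and `r k` below `1`.
    · obtain ⟨v, hv0, hvr, hvL, hQv⟩ : ∃ v, 0 ≤ v ∧ v ≤ r k ∧ r k - v ≤ 1 / L ∧ Q k v = 0 := by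
        by_contra! hcon
        set v := max 0 (r k - 1 / L) with hvdef
        have hvr : v < r k := max_lt hr0 (sub_lt_self _ (by positivity))
        have hv0 : 0 ≤ v := le_max_left _ _
        have h1 := busyTime_sub_eq (h.rightCont k) hv0 hvr.le fun z hz1 hz2 =>
          Nat.pos_of_ne_zero (hcon z (hv0.trans hz1.le) hz2.le
            (by linarith [le_max_right 0 (r k - 1 / L)]))
        have h2 := hmax k v ⟨hv0, hvr.le.trans (hr k).2⟩
        have h3 : mu k * (busyTime (Q k) (r k) - busyTime (Q k) v) = mu k * (r k - v) := by rw [h1]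
        have h4 := mul_lt_mul_of_pos_right (hnu k) (sub_pos.2 hvr)
        linarith
      have hvt : v ≤ t := hvr.trans (hr k).2
      have h1 := hstep k v ⟨hv0, hvt⟩
      rw [hQv] at h1
      have h2 : Y k (r k) - Y k v ≤ 1 := by
        have h3 := busyTime_mono (h.rightCont k) hv0 hvr
        have h4 : nu k * (r k - v) ≤ L * (1 / L) :=
          mul_le_mul ((hnu k).le.trans (hmuL k)) hvL (sub_nonneg.2 hvr) hL0.le
        rw [mul_one_div_cancel hL0.ne'] at h4
        simp only [hY]
        nlinarith [hmu k]
      -- If the residual service is still pending at `v`, emptiness forces `v < ξ k 0 ≤ M`, so `t -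
      -- v` is long enough for the drift to pay for it.
      have h3 : (if departures (η k) (Q k) v = 0 then L * η k 0 else 0) ≤ κ / 2 * (t - v) := by
        split_ifs with hD
        · have h4 := (h.lt_of_empty_of_departures_eq_zero k hv0 hD hQv).trans_le (hξM k)
          have h5 : κ * (2 * (1 + L) * M / κ) ≤ κ * (t - v) :=
            mul_le_mul_of_nonneg_left (by linarith) hκ.le
          have h6 := mul_le_mul_of_nonneg_left (hηM k) hL0.le
          linarith
        · exact mul_nonneg (by positivity) (sub_nonneg.2 hvt)
      push_cast at h1
      linarith
  -- By `hcorr`, `z - Pᵀ z ≥ Q(t) ≥ 0` entrywise. Hence `Q(t) ≤ z - Pᵀ z ≤ z`, and `z` is at most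
  -- `(C + 1) * x * w` because `V ≥ 0`.
  have hz := sub_sum_le_of_nonneg hP0 hP (z := fun k => (C + 1) * x * w k - V k)
  have heq (k : Fin K) : (C + 1) * x * w k - V k - ∑ l, P l k * ((C + 1) * x * w l - V l)
      = (C + 1) * x - (V k - ∑ l, P l k * V l) := by
    have h1 : ∑ l, P l k * ((C + 1) * x * w l - V l)
        = (C + 1) * x * ∑ l, P l k * w l - ∑ l, P l k * V l := by
      rw [Finset.mul_sum, ← Finset.sum_sub_distrib]
      exact Finset.sum_congr rfl fun l _ => by ring
    rw [h1]
    linear_combination (C + 1) * x * hw k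
  have hQ0 (k : Fin K) : (0 : ℝ) ≤ Q k t := Nat.cast_nonneg _
  have hfin := hz (fun k => by rw [heq]; linarith [hcorr k, hQ0 k]) k
  rw [heq] at hfin
  linarith [hcorr k, hV0 k]

end IsTrajectory

/-! ### Counting integer times -/

theorem card_le_of_sub_le {F : Finset ℕ} {L : ℝ} (hL : 0 ≤ L)
    (h : ∀ s ∈ F, ∀ t ∈ F, s ≤ t → (t : ℝ) - s ≤ L) : (F.card : ℝ) ≤ L + 1 := by
  rcases F.eq_empty_or_nonempty with rfl | hF
  · simp; linarith
  have h1 : F ⊆ Finset.Icc (F.min' hF) (F.max' hF) := fun s hs =>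
    Finset.mem_Icc.2 ⟨F.min'_le s hs, F.le_max' s hs⟩
  have h2 := Finset.card_le_card h1
  rw [Nat.card_Icc] at h2
  have h3 := F.min'_le_max' hF
  have h4 := h _ (F.min'_mem hF) _ (F.max'_mem hF) h3
  have h5 : (F.card : ℝ) + F.min' hF ≤ F.max' hF + 1 := by
    exact_mod_cast (by omega : F.card + F.min' hF ≤ F.max' hF + 1)
  linarith

theorem card_le_sum_of_index {F B : Finset ℕ} {c : ℕ → ℕ} {ℓ : ℕ → ℝ} (hℓ : ∀ j, 0 ≤ ℓ j)
    (hB : ∀ s ∈ F, c s ∈ B)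
    (h : ∀ s ∈ F, ∀ t ∈ F, s ≤ t → c s = c t → (t : ℝ) - s ≤ ℓ (c s)) :
    (F.card : ℝ) ≤ ∑ j ∈ B, (ℓ j + 1) := by
  rw [Finset.card_eq_sum_card_fiberwise hB]
  push_cast
  refine Finset.sum_le_sum fun j _ => card_le_of_sub_le (hℓ j) fun s hs t ht hst => ?_
  rw [Finset.mem_filter] at hs ht
  rw [← hs.2]
  exact h s hs.1 t ht.1 hst (hs.2.trans ht.2.symm)

/-- Lengths up to `y` are charged to the number of indices in `B`. Longer ones are charged, as in
Chebyshev's inequality, to a quadratic sum over all indices, which makes any dependence between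
lengths and membership in `B` irrelevant. -/
theorem sum_length_le {B : Finset ℕ} {J : ℕ} (hBJ : ∀ j ∈ B, j < J) {ℓ : ℕ → ℝ}
    (hℓ : ∀ j, 0 ≤ ℓ j) {y : ℝ} (hy : 0 < y) :
    ∑ j ∈ B, (ℓ j + 1) ≤ B.card * (y + 1) + ∑ j ∈ Finset.range J, (ℓ j + 1) * ℓ j / y := by
  have h1 : ∑ j ∈ B, (ℓ j + 1) ≤ ∑ j ∈ B, ((y + 1) + (ℓ j + 1) * ℓ j / y) := by
    refine Finset.sum_le_sum fun j _ => ?_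
    have h0 := hℓ j
    rcases le_or_gt (ℓ j) y with h | h
    · have : 0 ≤ (ℓ j + 1) * ℓ j / y := by positivity
      linarith
    · have : ℓ j + 1 ≤ (ℓ j + 1) * ℓ j / y := by
        rw [le_div_iff₀ hy]
        exact mul_le_mul_of_nonneg_left h.le (by linarith)
      linarith
  have h2 : ∑ j ∈ B, ((y + 1) + (ℓ j + 1) * ℓ j / y)
      = B.card * (y + 1) + ∑ j ∈ B, (ℓ j + 1) * ℓ j / y := by
    rw [Finset.sum_add_distrib, Finset.sum_const, nsmul_eq_mul]
  refine (h1.trans_eq h2).trans (add_le_add_right ?_ _)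
  refine Finset.sum_le_sum_of_subset_of_nonneg (fun j hj => Finset.mem_range.2 (hBJ j hj))
    fun j _ _ => ?_
  have := hℓ j
  positivity

theorem sum_long_length_le {J : ℕ} {ℓ : ℕ → ℝ} (hℓ : ∀ j, 0 ≤ ℓ j) {y : ℝ} (hy : 0 < y) :
    ∑ j ∈ (Finset.range J).filter (fun j => y < ℓ j), (ℓ j + 1)
      ≤ ∑ j ∈ Finset.range J, (ℓ j + 1) * ℓ j / y := by
  rw [Finset.sum_filter]
  refine Finset.sum_le_sum fun j _ => ?_
  have h0 := hℓ j
  split_ifs with h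
  · rw [le_div_iff₀ hy]
    exact mul_le_mul_of_nonneg_left h.le (by linarith)
  · positivity

/-! ### Times spent at atypical indices -/

namespace IsTrajectory

variable {K : ℕ} {ξ η : Fin K → ℕ → ℝ} {ζ : Fin K → ℕ → Fin (K + 1)} {Q : Fin K → ℝ → ℕ}

theorem sub_le_of_arrivals_eq (h : IsTrajectory ξ η ζ Q) (k : Fin K) {s t : ℝ} (hs : 0 ≤ s)
    (ht : 0 ≤ t) (heq : renewalCount (ξ k) s = renewalCount (ξ k) t) :
    t - s ≤ ξ k (renewalCount (ξ k) s) := by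
  have h1 := (renewalCount_spec (h.ξ_nonneg k) (h.tendsto_ξ k) hs).1
  have h2 := (renewalCount_spec (h.ξ_nonneg k) (h.tendsto_ξ k) ht).2
  rw [← heq, Finset.sum_range_succ] at h2
  linarith

/-- The queue cannot become empty before the next departure, so the busy clock runs at unit speed
throughout and the elapsed time fits into the current service. -/
theorem sub_le_of_departures_eq (h : IsTrajectory ξ η ζ Q) (k : Fin K) {s t : ℝ} (hs : 0 ≤ s)
    (hst : s ≤ t) (heq : departures (η k) (Q k) s = departures (η k) (Q k) t)
    (hQ : 0 < Q k s) : t - s ≤ η k (departures (η k) (Q k) s) := by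
  have h1 := (renewalCount_spec (h.η_nonneg k) (h.tendsto_η k)
    (busyTime_nonneg (h.rightCont k) hs)).1
  have h2 := (renewalCount_spec (h.η_nonneg k) (h.tendsto_η k)
    (busyTime_nonneg (h.rightCont k) (hs.trans hst))).2
  have h3 := busyTime_sub_eq (h.rightCont k) hs hst fun r hsr hrt =>
    hQ.trans_le (h.queue_le_of_departures_eq k hs hsr.le
      (le_antisymm (h.departures_mono k hs hsr.le)
        ((h.departures_mono k (hs.trans hsr.le) hrt.le).trans_eq heq.symm)))
  unfold departures at heq ⊢
  rw [← heq, Finset.sum_range_succ] at h2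
  linarith

/-- Integer times at which the index of the current interarrival time lies in a given set. -/
theorem card_arrivals_mem_le (h : IsTrajectory ξ η ζ Q) (k : Fin K) {N J : ℕ} {B : Finset ℕ}
    (hB : ∀ j ∈ B, j < J) {y : ℝ} (hy : 0 < y) :
    (((Finset.Icc 1 N).filter fun s : ℕ => renewalCount (ξ k) s ∈ B).card : ℝ)
      ≤ B.card * (y + 1) + ∑ j ∈ Finset.range J, (ξ k j + 1) * ξ k j / y := by
  refine le_trans ?_ (sum_length_le hB (h.ξ_nonneg k) hy)
  refine card_le_sum_of_index (c := fun s => renewalCount (ξ k) s) (h.ξ_nonneg k)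
    (fun s hs => (Finset.mem_filter.1 hs).2) fun s _ t _ _ heq =>
    h.sub_le_of_arrivals_eq k (Nat.cast_nonneg _) (Nat.cast_nonneg _) heq

/-- Integer times at which the index of the current service time lies in a given set. -/
theorem card_departures_mem_le (h : IsTrajectory ξ η ζ Q) (k : Fin K) {N J : ℕ} {B : Finset ℕ}
    (hB : ∀ j ∈ B, j < J) (hJ : (N : ℝ) < ∑ i ∈ Finset.range J, ξ k i) {y : ℝ} (hy : 0 < y) :
    (((Finset.Icc 1 N).filter fun s : ℕ => departures (η k) (Q k) s ∈ B).card : ℝ)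
      ≤ 2 * (B.card * (y + 1)) + ∑ j ∈ Finset.range J, (ξ k j + 1) * ξ k j / y
        + ∑ j ∈ Finset.range J, (η k j + 1) * η k j / y := by
  set F := (Finset.Icc 1 N).filter fun s : ℕ => departures (η k) (Q k) s ∈ B with hF
  have hmem {s : ℕ} (hs : s ∈ F) : departures (η k) (Q k) s ∈ B := (Finset.mem_filter.1 hs).2
  have hsN {s : ℕ} (hs : s ∈ F) : s ≤ N := (Finset.mem_Icc.1 (Finset.mem_filter.1 hs).1).2
  have hbusy : ((F.filter fun s : ℕ => 0 < Q k s).card : ℝ)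
      ≤ B.card * (y + 1) + ∑ j ∈ Finset.range J, (η k j + 1) * η k j / y := by
    refine le_trans ?_ (sum_length_le hB (h.η_nonneg k) hy)
    refine card_le_sum_of_index (c := fun s => departures (η k) (Q k) s) (h.η_nonneg k)
      (fun s hs => hmem (Finset.mem_filter.1 hs).1) fun s hs t _ hst heq =>
      h.sub_le_of_departures_eq k (Nat.cast_nonneg _) (Nat.cast_le.2 hst) heq
        (Finset.mem_filter.1 hs).2
  set I := F.filter fun s : ℕ => ¬ 0 < Q k s with hI
  have hempty {s : ℕ} (hs : s ∈ I) : Q k s = 0 := Nat.eq_zero_of_not_pos (Finset.mem_filter.1 hs).2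
  -- While the station is empty the service clock stands still, so the service time gives no bound.
  -- But empty times with a common departure index lie in one interarrival interval, so those in
  -- short intervals number at most `y + 1` per index.
  have hshort : ((I.filter fun s : ℕ => ξ k (renewalCount (ξ k) s) ≤ y).card : ℝ)
      ≤ B.card * (y + 1) := by
    refine (card_le_sum_of_index (c := fun s => departures (η k) (Q k) s) (ℓ := fun _ => y)
      (fun _ => hy.le) (fun s hs => hmem (Finset.mem_filter.1 (Finset.mem_filter.1 hs).1).1)
      fun s hs t ht hst heq => ?_).trans_eq ?_
    · rw [Finset.mem_filter] at hs ht
      exact (h.sub_le_of_arrivals_eq k (Nat.cast_nonneg _) (Nat.cast_nonneg _)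
        (h.arrivals_eq_of_empty k (Nat.cast_nonneg _) (Nat.cast_le.2 hst) heq
          (hempty hs.1) (hempty ht.1))).trans hs.2
    · rw [Finset.sum_const, nsmul_eq_mul]
  -- Here the departure index is ignored: all times in long interarrival intervals are counted.
  have hlong : ((I.filter fun s : ℕ => ¬ ξ k (renewalCount (ξ k) s) ≤ y).card : ℝ)
      ≤ ∑ j ∈ Finset.range J, (ξ k j + 1) * ξ k j / y := by
    refine le_trans ?_ (sum_long_length_le (h.ξ_nonneg k) hy)
    refine card_le_sum_of_index (c := fun s => renewalCount (ξ k) s) (h.ξ_nonneg k)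
      (fun s hs => ?_) fun s _ t _ _ heq =>
      h.sub_le_of_arrivals_eq k (Nat.cast_nonneg _) (Nat.cast_nonneg _) heq
    rw [Finset.mem_filter] at hs
    rw [Finset.mem_filter, Finset.mem_range]
    refine ⟨renewalCount_lt (h.ξ_nonneg k) (h.tendsto_ξ k) (Nat.cast_nonneg _)
      (lt_of_le_of_lt ?_ hJ), not_le.1 hs.2⟩
    exact_mod_cast hsN (Finset.mem_filter.1 hs.1).1
  have h1 := Finset.card_filter_add_card_filter_not (s := F) (fun s : ℕ => 0 < Q k s)
  have h2 := Finset.card_filter_add_card_filter_not (s := I)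
    (fun s : ℕ => ξ k (renewalCount (ξ k) s) ≤ y)
  rw [← hI, ← h2] at h1
  rw [← h1]
  push_cast
  linarith

open Classical in
/-- Indices of interarrival times preceded by an atypical block. -/
noncomputable def badArrivals (ξ : Fin K → ℕ → ℝ) (a : Fin K → ℝ) (x e : ℝ) (J : ℕ) (k : Fin K) :
    Finset ℕ :=
  (Finset.range J).filter fun j => ¬ BackwardBounded (fun i => a k - ξ k (i + 1)) x e (j - 1)

open Classical in
/-- Indices of services preceded by an atypical block. -/
noncomputable def badServices (η : Fin K → ℕ → ℝ) (ζ : Fin K → ℕ → Fin (K + 1))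
    (P : Matrix (Fin K) (Fin K) ℝ) (c : Fin K → ℝ) (x e : ℝ) (J : ℕ) (k : Fin K) : Finset ℕ :=
  (Finset.range J).filter fun j => ¬ BackwardBounded (fun i => c k - η k (i + 1)) x e (j - 1) ∨
    ¬ BackwardBounded (fun i => η k (i + 1) - c k) x e j ∨
    ∃ l, ¬ BackwardBounded (fun i => (if ζ k i = l.succ then (1 : ℝ) else 0) - P k l) x e j

/-- Counting the integer times at which a queue is long. -/
theorem card_long_queue_le (h : IsTrajectory ξ η ζ Q) {P : Matrix (Fin K) (Fin K) ℝ}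
    {a c : Fin K → ℝ} {x e y z t₀ : ℝ} (hy : 0 < y) (ht₀ : 0 ≤ t₀) {k : Fin K}
    (hreg : ∀ t, t₀ ≤ t → Regular ξ η ζ Q P a c x e t → (Q k t : ℝ) ≤ z) {N J : ℕ}
    (hξJ : ∀ k, (N : ℝ) < ∑ i ∈ Finset.range J, ξ k i)
    (hηJ : ∀ k, (N : ℝ) < ∑ i ∈ Finset.range J, η k i) :
    (((Finset.Icc 1 N).filter fun s : ℕ => z < (Q k s : ℝ)).card : ℝ) ≤ t₀ + 1
      + ∑ l, ((badArrivals ξ a x e J l).card * (y + 1)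
        + 2 * ((badServices η ζ P c x e J l).card * (y + 1))
        + 2 * ∑ j ∈ Finset.range J, (ξ l j + 1) * ξ l j / y
        + ∑ j ∈ Finset.range J, (η l j + 1) * η l j / y) := by
  classical
  have hsub : ((Finset.Icc 1 N).filter fun s : ℕ => z < (Q k s : ℝ)) ⊆
      ((Finset.Icc 1 N).filter fun s : ℕ => (s : ℝ) < t₀) ∪
      Finset.univ.biUnion (fun l =>
        ((Finset.Icc 1 N).filter fun s : ℕ => renewalCount (ξ l) s ∈ badArrivals ξ a x e J l) ∪
        ((Finset.Icc 1 N).filter fun s : ℕ =>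
          departures (η l) (Q l) s ∈ badServices η ζ P c x e J l)) := by
    intro s hs
    rw [Finset.mem_filter] at hs
    by_contra hcon
    simp only [Finset.mem_union, Finset.mem_biUnion, Finset.mem_filter, hs.1, true_and,
      Finset.mem_univ, not_or, not_lt, not_exists] at hcon
    obtain ⟨h1, h2⟩ := hcon
    have hsN : (s : ℝ) ≤ N := by exact_mod_cast (Finset.mem_Icc.1 hs.1).2
    have hs0 : (0 : ℝ) ≤ s := Nat.cast_nonneg s
    have hA (l : Fin K) : renewalCount (ξ l) s < J :=
      renewalCount_lt (h.ξ_nonneg l) (h.tendsto_ξ l) hs0 (hsN.trans_lt (hξJ l))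
    have hD (l : Fin K) : departures (η l) (Q l) s < J :=
      renewalCount_lt (h.η_nonneg l) (h.tendsto_η l) (busyTime_nonneg (h.rightCont l) hs0)
        (((busyTime_le (h.rightCont l) hs0).trans hsN).trans_lt (hηJ l))
    have h3 (l : Fin K) := (h2 l).1
    have h4 (l : Fin K) := (h2 l).2
    simp only [badArrivals, badServices, Finset.mem_filter, Finset.mem_range, hA, hD, true_and,
      not_not, not_or, not_exists] at h3 h4
    exact absurd hs.2 (not_lt.2 (hreg s h1
      ⟨h3, fun l => (h4 l).1, fun l => (h4 l).2.1, fun l => (h4 l).2.2⟩))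
  have h1 := Finset.card_le_card hsub
  have h2 := h1.trans ((Finset.card_union_le _ _).trans
    (add_le_add_right (Finset.card_biUnion_le.trans
      (Finset.sum_le_sum fun l _ => Finset.card_union_le _ _)) _))
  have h3 : (((Finset.Icc 1 N).filter fun s : ℕ => (s : ℝ) < t₀).card : ℝ) ≤ t₀ + 1 :=
    card_le_of_sub_le ht₀ fun s _ t ht _ => by
      have h4 := (Finset.mem_filter.1 ht).2
      have h5 : (0 : ℝ) ≤ s := Nat.cast_nonneg s
      linarith
  have h4 : (((Finset.Icc 1 N).filter fun s : ℕ => z < (Q k s : ℝ)).card : ℝ) ≤ _ :=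
    Nat.cast_le.2 h2
  push_cast at h4
  refine h4.trans (add_le_add h3 (Finset.sum_le_sum fun l _ => ?_))
  have h5 := h.card_arrivals_mem_le l (N := N) (J := J) (B := badArrivals ξ a x e J l)
    (fun j hj => Finset.mem_range.1 (Finset.mem_filter.1 hj).1) hy
  have h6 := h.card_departures_mem_le l (N := N) (J := J) (B := badServices η ζ P c x e J l)
    (fun j hj => Finset.mem_range.1 (Finset.mem_filter.1 hj).1) (hξJ l) hy
  linarith

end IsTrajectory

/-! ### The Lindley recursion -/

/-- The Lindley recursion `w (m + 1) = max 0 (w m + g m)` started from zero. -/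
noncomputable def lindley (g : ℕ → ℝ) : ℕ → ℝ
  | 0 => 0
  | m + 1 => max 0 (lindley g m + g m)

theorem lindley_nonneg (g : ℕ → ℝ) (m : ℕ) : 0 ≤ lindley g m := by
  cases m with
  | zero => exact le_rfl
  | succ m => exact le_max_left _ _

theorem lindley_congr {g h : ℕ → ℝ} {m : ℕ} (hgh : ∀ i < m, g i = h i) :
    lindley g m = lindley h m := by
  induction m with
  | zero => rfl
  | succ m ih =>
    rw [lindley, lindley, ih fun i hi => hgh i (hi.trans m.lt_succ_self), hgh m m.lt_succ_self]

/-- The Lindley recursion dominates all block sums ending at `m`, including the empty one, and so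
replaces a condition on all blocks by one on a Markov chain. -/
theorem sum_Ico_le_lindley (g : ℕ → ℝ) {j m : ℕ} (hjm : j ≤ m) :
    ∑ i ∈ Finset.Ico j m, g i ≤ lindley g m := by
  induction m, hjm using Nat.le_induction with
  | base => simpa using lindley_nonneg g j
  | succ m hjm ih =>
    rw [Finset.sum_Ico_succ_top hjm]
    exact (add_le_add_left ih _).trans (le_max_right _ _)

/-- The slope `e` is shared equally between the two parts. The part `v`, the excess over a
truncation level, is allowed no constant at all. -/
theorem backwardBounded_of_lindley_le {g u v : ℕ → ℝ} {x e : ℝ} {m : ℕ}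
    (hg : ∀ i, g i = u i + v i) (hu : lindley (fun i => u i - e / 2) m ≤ x)
    (hv : lindley (fun i => v i - e / 2) m ≤ 0) : BackwardBounded g x e m := by
  intro j hjm
  have h1 := (sum_Ico_le_lindley (fun i => u i - e / 2) hjm).trans hu
  have h2 := (sum_Ico_le_lindley (fun i => v i - e / 2) hjm).trans hv
  simp only [Finset.sum_sub_distrib, Finset.sum_const, Nat.card_Ico, nsmul_eq_mul,
    Nat.cast_sub hjm] at h1 h2
  simp only [hg, Finset.sum_add_distrib]
  linarith

/-- Each step that ends at a positive value consumes `δ`, and all that is consumed has been supplied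
by the `v i`. -/
theorem sum_lindley_pos_le {v : ℕ → ℝ} (hv : ∀ i, 0 ≤ v i) (δ : ℝ) (J : ℕ) :
    δ * ∑ m ∈ Finset.range (J + 1), (if 0 < lindley (fun i => v i - δ) m then (1 : ℝ) else 0)
      + lindley (fun i => v i - δ) J ≤ ∑ i ∈ Finset.range J, v i := by
  induction J with
  | zero => rw [zero_add, Finset.sum_range_one]; simp [lindley]
  | succ J ih =>
    rw [Finset.sum_range_succ, Finset.sum_range_succ v]
    have h0 := lindley_nonneg (fun i => v i - δ) J
    have hvJ := hv J
    have h1 : lindley (fun i => v i - δ) (J + 1) = max 0 (lindley (fun i => v i - δ) J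
        + (v J - δ)) := rfl
    rcases le_or_gt (lindley (fun i => v i - δ) (J + 1)) 0 with h | h
    · rw [if_neg (not_lt.2 h)]; linarith
    · rw [if_pos h]
      have h2 : lindley (fun i => v i - δ) (J + 1) = lindley (fun i => v i - δ) J + (v J - δ) := by
        rw [h1] at h ⊢
        exact max_eq_right (by by_contra! hc; rw [max_eq_left hc.le] at h; exact lt_irrefl _ h)
      linarith

theorem exp_le_one_add_add_sq_mul (z : ℝ) :
    Real.exp z ≤ 1 + z + z ^ 2 * Real.exp (max z 0) := by
  have h1 : Real.exp z ≤ 1 + z * Real.exp z := by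
    have h2 := mul_le_mul_of_nonneg_right (Real.add_one_le_exp (-z)) (Real.exp_pos z).le
    rw [← Real.exp_add, neg_add_cancel, Real.exp_zero] at h2
    linarith
  rcases le_total z 0 with h | h
  · rw [max_eq_right h, Real.exp_zero]
    nlinarith [Real.add_one_le_exp z]
  · rw [max_eq_left h]
    nlinarith

/-! ### Exponential moments of the Lindley recursion -/

section Probability

variable {Ω : Type*} [MeasurableSpace Ω] {μ : Measure Ω}

theorem measurable_lindley {Z : ℕ → Ω → ℝ} (hZ : ∀ i, Measurable (Z i)) (m : ℕ) :
    Measurable fun ω => lindley (fun i => Z i ω) m := by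
  induction m with
  | zero => exact measurable_const
  | succ m ih => exact measurable_const.max (ih.add (hZ m))

/-- The state at step `m` is a function of the inputs with indices below `m` only. -/
theorem indepFun_lindley {Z : ℕ → Ω → ℝ} (hZ : ∀ i, Measurable (Z i)) (hind : iIndepFun Z μ)
    (m : ℕ) : IndepFun (fun ω => lindley (fun i => Z i ω) m) (Z m) μ := by
  have h := hind.indepFun_finset (Finset.range m) {m} (by simp) hZ
  let ext : ((i : Finset.range m) → ℝ) → ℕ → ℝ := fun v i =>
    if hi : i ∈ Finset.range m then v ⟨i, hi⟩ else 0
  have hext (i : ℕ) : Measurable fun v => ext v i := by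
    by_cases hi : i ∈ Finset.range m
    · simp only [ext, hi, dite_true]
      exact measurable_pi_apply _
    · simp only [ext, hi, dite_false]
      exact measurable_const
  have hψ : Measurable fun v : (({m} : Finset ℕ) → ℝ) => v ⟨m, Finset.mem_singleton_self m⟩ :=
    measurable_pi_apply _
  have h2 := h.comp (measurable_lindley hext m) hψ
  convert h2 using 1
  · funext ω
    refine lindley_congr fun i hi => ?_
    simp [ext, hi]
  · rfl

variable [IsProbabilityMeasure μ]

theorem integrable_lindley {Z : ℕ → Ω → ℝ} (hint : ∀ i, Integrable (Z i) μ) (m : ℕ) :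
    Integrable (fun ω => lindley (fun i => Z i ω) m) μ := by
  induction m with
  | zero => exact integrable_const _
  | succ m ih => exact (integrable_const (0 : ℝ)).sup (ih.add (hint m))

theorem integrable_exp_lindley {Z : ℕ → Ω → ℝ} (hZ : ∀ i, Measurable (Z i))
    (hind : iIndepFun Z μ) {θ : ℝ} (hexp : ∀ i, Integrable (fun ω => Real.exp (θ * Z i ω)) μ)
    (m : ℕ) : Integrable (fun ω => Real.exp (θ * lindley (fun i => Z i ω) m)) μ := by
  induction m with
  | zero => simp [lindley]
  | succ m ih =>
    have h1 : IndepFun (fun ω => Real.exp (θ * lindley (fun i => Z i ω) m))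
        (fun ω => Real.exp (θ * Z m ω)) μ :=
      (indepFun_lindley hZ hind m).comp (φ := fun z => Real.exp (θ * z))
        (ψ := fun z => Real.exp (θ * z)) (by fun_prop) (by fun_prop)
    have h2 := (integrable_const (1 : ℝ)).add (h1.integrable_mul ih (hexp m))
    have hm := measurable_lindley hZ (m + 1)
    refine h2.mono' (hm.const_mul θ).exp.aestronglyMeasurable (Eventually.of_forall fun ω => ?_)
    rw [Real.norm_eq_abs, abs_of_pos (Real.exp_pos _)]
    simp only [Pi.add_apply, Pi.mul_apply, lindley, ← Real.exp_add, ← mul_add]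
    rcases le_total 0 (lindley (fun i => Z i ω) m + Z m ω) with h | h
    · rw [max_eq_right h]; linarith
    · rw [max_eq_left h, mul_zero, Real.exp_zero]; linarith [Real.exp_pos
        (θ * (lindley (fun i => Z i ω) m + Z m ω))]

theorem exp_sub_max_le {θ : ℝ} (z : ℝ) :
    Real.exp (θ * max 0 z) - θ * max 0 z ≤ Real.exp (θ * z) - θ * z := by
  rcases le_total 0 z with h | h
  · rw [max_eq_right h]
  · rw [max_eq_left h, mul_zero, Real.exp_zero]
    linarith [Real.add_one_le_exp (θ * z)]

/-- The test function `exp (θ w) - θ w` is minimal at `w = 0`, so reflection at zero does not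
increase it; its expected change over one step then telescopes. Subtracting the linear term is
essential: bounding the reflection by `1` per step would give averages of order `1 / (θ e)` for
increments of drift of order `-e`, while here the cost per step is `-θ E Z`, of the same order as `1
- E exp (θ Z)`. -/
theorem sum_integral_exp_lindley_le {Z : ℕ → Ω → ℝ} (hZ : ∀ i, Measurable (Z i))
    (hind : iIndepFun Z μ) (hid : ∀ i, IdentDistrib (Z i) (Z 0) μ μ) (hint : Integrable (Z 0) μ)
    {θ : ℝ} (hexp : Integrable (fun ω => Real.exp (θ * Z 0 ω)) μ) (J : ℕ) :
    (1 - ∫ ω, Real.exp (θ * Z 0 ω) ∂μ)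
        * ∑ m ∈ Finset.range J, ∫ ω, Real.exp (θ * lindley (fun i => Z i ω) m) ∂μ
      ≤ 1 - J * (θ * ∫ ω, Z 0 ω ∂μ) := by
  have hmexp : Measurable fun z : ℝ => Real.exp (θ * z) := by fun_prop
  have hintZ (i : ℕ) : Integrable (Z i) μ := (hid i).integrable_iff.2 hint
  have hexpZ (i : ℕ) : Integrable (fun ω => Real.exp (θ * Z i ω)) μ :=
    ((hid i).comp hmexp).integrable_iff.2 hexp
  have hW := integrable_lindley hintZ
  have hWe := integrable_exp_lindley hZ hind hexpZ
  have key : (∫ ω, (Real.exp (θ * lindley (fun i => Z i ω) J)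
        - θ * lindley (fun i => Z i ω) J) ∂μ)
      + (1 - ∫ ω, Real.exp (θ * Z 0 ω) ∂μ)
        * ∑ m ∈ Finset.range J, ∫ ω, Real.exp (θ * lindley (fun i => Z i ω) m) ∂μ
      ≤ 1 - J * (θ * ∫ ω, Z 0 ω ∂μ) := by
    induction J with
    | zero => simp [lindley]
    | succ J ih =>
      have h1 : IndepFun (fun ω => Real.exp (θ * lindley (fun i => Z i ω) J))
          (fun ω => Real.exp (θ * Z J ω)) μ :=
        (indepFun_lindley hZ hind J).comp (φ := fun z => Real.exp (θ * z))
          (ψ := fun z => Real.exp (θ * z)) hmexp hmexp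
      have h2 := h1.integral_mul_eq_mul_integral (hWe J).1 (hexpZ J).1
      have h3 : ∫ ω, Real.exp (θ * Z J ω) ∂μ = ∫ ω, Real.exp (θ * Z 0 ω) ∂μ :=
        ((hid J).comp hmexp).integral_eq
      have h4 := (hid J).integral_eq
      have hprod := h1.integrable_mul (hWe J) (hexpZ J)
      have h5 : ∫ ω, (Real.exp (θ * lindley (fun i => Z i ω) (J + 1))
            - θ * lindley (fun i => Z i ω) (J + 1)) ∂μ
          ≤ ∫ ω, ((fun ω => Real.exp (θ * lindley (fun i => Z i ω) J))
              * (fun ω => Real.exp (θ * Z J ω))) ω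
            - (θ * lindley (fun i => Z i ω) J + θ * Z J ω) ∂μ := by
        refine integral_mono ((hWe (J + 1)).sub ((hW (J + 1)).const_mul θ))
          (hprod.sub (((hW J).const_mul θ).add ((hintZ J).const_mul θ))) fun ω => ?_
        have := exp_sub_max_le (θ := θ) (lindley (fun i => Z i ω) J + Z J ω)
        simpa only [lindley, Pi.mul_apply, ← Real.exp_add, ← mul_add] using this
      have h6 := integral_sub hprod (((hW J).const_mul θ).add ((hintZ J).const_mul θ))
      have h7 := integral_add ((hW J).const_mul θ) ((hintZ J).const_mul θ)
      simp only [Pi.add_apply] at h6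
      rw [h6, h7, h2, h3, integral_const_mul, integral_const_mul, h4] at h5
      rw [integral_sub (hWe J) ((hW J).const_mul θ), integral_const_mul] at ih
      rw [Finset.sum_range_succ]
      push_cast
      linarith
  have hpos : 0 ≤ ∫ ω, (Real.exp (θ * lindley (fun i => Z i ω) J)
      - θ * lindley (fun i => Z i ω) J) ∂μ :=
    integral_nonneg fun ω => by
      have := Real.add_one_le_exp (θ * lindley (fun i => Z i ω) J)
      simp only [Pi.zero_apply]
      linarith
  linarith

theorem exp_neg_le_one_sub_half {z : ℝ} (h0 : 0 ≤ z) (h1 : z ≤ 1) :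
    Real.exp (-z) ≤ 1 - z / 2 := by
  have h2 := Real.add_one_le_exp z
  rw [Real.exp_neg, inv_le_comm₀ (Real.exp_pos z) (by linarith)]
  refine le_trans ?_ h2
  rw [inv_le_iff_one_le_mul₀ (by linarith)]
  nlinarith

/-- The frequency of atypical indices for a sequence of centred i.i.d. random variables. -/
theorem sum_not_backwardBounded_le {Y : ℕ → Ω → ℝ} (hY : ∀ i, Measurable (Y i))
    (hind : iIndepFun Y μ) (hid : ∀ i, IdentDistrib (Y i) (Y 0) μ μ) (hint : Integrable (Y 0) μ)
    (hint2 : Integrable (fun ω => Y 0 ω ^ 2) μ) (hmean : ∫ ω, Y 0 ω ∂μ = 0)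
    {x e θ y C : ℝ} (hx : 0 ≤ x) (he : 0 < e) (hθ : 0 < θ) (hy : 0 ≤ y)
    (hC : ∫ ω, (if Y 0 ω ≤ y then Y 0 ω ^ 2 * Real.exp (θ * max (Y 0 ω) 0) else 0) ∂μ ≤ C)
    (hθC : θ * C ≤ e / 4) (hθe : θ * e ≤ 4) (J : ℕ) :
    ∑ m ∈ Finset.range J, μ.real {ω | ¬ BackwardBounded (fun i => Y i ω) x e m}
      ≤ J * (4 * Real.exp (-(θ * x)) + 10 / e * ∫ ω, (if Y 0 ω ≤ y then 0 else Y 0 ω) ∂μ)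
        + 8 / (θ * e) := by
  -- Truncation from above only: `u` keeps the negative values and has exponential moments, and `v`
  -- is nonnegative because `y ≥ 0`.
  set u : ℝ → ℝ := fun z => if z ≤ y then z else 0 with hu
  set v : ℝ → ℝ := fun z => if z ≤ y then 0 else z with hv
  have hum : Measurable u := Measurable.ite measurableSet_Iic measurable_id measurable_const
  have hvm : Measurable v := Measurable.ite measurableSet_Iic measurable_const measurable_id
  have hv0 (z : ℝ) : 0 ≤ v z := by
    simp only [hv]; split_ifs with h
    · exact le_rfl
    · linarith
  have huv (z : ℝ) : z = u z + v z := by simp only [hu, hv]; split_ifs <;> simp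
  have huabs (z : ℝ) : |u z| ≤ |z| := by simp only [hu]; split_ifs <;> simp
  have hvabs (z : ℝ) : |v z| ≤ |z| := by simp only [hv]; split_ifs <;> simp
  have hUint : Integrable (fun ω => u (Y 0 ω)) μ :=
    hint.mono (hum.comp (hY 0)).aestronglyMeasurable (Eventually.of_forall fun ω => huabs _)
  have hVint : Integrable (fun ω => v (Y 0 ω)) μ :=
    hint.mono (hvm.comp (hY 0)).aestronglyMeasurable (Eventually.of_forall fun ω => hvabs _)
  set EV := ∫ ω, v (Y 0 ω) ∂μ with hEV
  have hEV0 : 0 ≤ EV := integral_nonneg fun ω => hv0 _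
  have hEU : ∫ ω, u (Y 0 ω) ∂μ = -EV := by
    have h1 : ∫ ω, Y 0 ω ∂μ = ∫ ω, (u (Y 0 ω) + v (Y 0 ω)) ∂μ :=
      integral_congr_ae (Eventually.of_forall fun ω => huv _)
    rw [integral_add hUint hVint, hmean] at h1
    linarith
  -- the truncated part
  set Z : ℕ → Ω → ℝ := fun i ω => u (Y i ω) - e / 2 with hZ
  have hum2 : Measurable fun z => u z - e / 2 := hum.sub_const _
  have hZm (i : ℕ) : Measurable (Z i) := hum2.comp (hY i)
  have hZind : iIndepFun Z μ := hind.comp (fun _ z => u z - e / 2) fun _ => hum2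
  have hZid (i : ℕ) : IdentDistrib (Z i) (Z 0) μ μ := (hid i).comp hum2
  have hZint : Integrable (Z 0) μ := hUint.sub (integrable_const _)
  have hθe0 : 0 < θ * e := mul_pos hθ he
  have hexpU : Integrable (fun ω => Real.exp (θ * u (Y 0 ω))) μ := by
    refine (integrable_const (Real.exp (θ * y))).mono'
      (Real.measurable_exp.comp ((hum.comp (hY 0)).const_mul θ)).aestronglyMeasurable
      (Eventually.of_forall fun ω => ?_)
    rw [Real.norm_eq_abs, abs_of_pos (Real.exp_pos _)]
    refine Real.exp_le_exp.2 (mul_le_mul_of_nonneg_left ?_ hθ.le)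
    simp only [hu]; split_ifs with h
    · exact h
    · exact hy
  have hexpZ : Integrable (fun ω => Real.exp (θ * Z 0 ω)) μ := by
    simp only [hZ, mul_sub, Real.exp_sub]
    exact hexpU.div_const _
  have hsqint : Integrable (fun ω => if Y 0 ω ≤ y then
      Y 0 ω ^ 2 * Real.exp (θ * max (Y 0 ω) 0) else 0) μ := by
    have hm : Measurable fun z : ℝ => if z ≤ y then z ^ 2 * Real.exp (θ * max z 0) else 0 :=
      Measurable.ite measurableSet_Iic (by fun_prop) measurable_const
    refine (hint2.mul_const (Real.exp (θ * y))).mono' (hm.comp (hY 0)).aestronglyMeasurable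
      (Eventually.of_forall fun ω => ?_)
    split_ifs with h
    · rw [Real.norm_eq_abs, abs_of_nonneg (by positivity)]
      gcongr
      exact max_le h hy
    · simp only [norm_zero]; positivity
  -- The shift gives the factor `exp (-θ e / 2)`, and the second-order term is at most `θ ^ 2 * C ≤
  -- θ e / 4`, so the product is at most `exp (-θ e / 4)`.
  have hφ : ∫ ω, Real.exp (θ * Z 0 ω) ∂μ ≤ 1 - θ * e / 8 := by
    have h1 : ∫ ω, Real.exp (θ * u (Y 0 ω)) ∂μ ≤ 1 + θ ^ 2 * C := by
      calc _ ≤ ∫ ω, ((1 + θ * u (Y 0 ω)) + θ ^ 2 * (if Y 0 ω ≤ y then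
              Y 0 ω ^ 2 * Real.exp (θ * max (Y 0 ω) 0) else 0)) ∂μ := by
            refine integral_mono hexpU (((integrable_const _).add (hUint.const_mul θ)).add
              (hsqint.const_mul _)) fun ω => ?_
            have h2 := exp_le_one_add_add_sq_mul (θ * u (Y 0 ω))
            simp only [hu] at h2 ⊢
            split_ifs at h2 ⊢ with h
            · rw [show max (θ * Y 0 ω) 0 = θ * max (Y 0 ω) 0 by
                rw [mul_max_of_nonneg _ _ hθ.le, mul_zero]] at h2
              linarith
            · simp
        _ = (1 - θ * EV) + θ ^ 2 * ∫ ω, (if Y 0 ω ≤ y then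
              Y 0 ω ^ 2 * Real.exp (θ * max (Y 0 ω) 0) else 0) ∂μ := by
            have h2 := integral_add ((integrable_const (1 : ℝ)).add (hUint.const_mul θ))
              (hsqint.const_mul (θ ^ 2))
            have h3 := integral_add (integrable_const (1 : ℝ)) (hUint.const_mul θ)
            simp only [Pi.add_apply] at h2
            rw [h2, h3, integral_const_mul, integral_const_mul, hEU]
            simp
            ring
        _ ≤ 1 + θ ^ 2 * C := by
            have h2 := mul_le_mul_of_nonneg_left hC (sq_nonneg θ)
            have h3 := mul_nonneg hθ.le hEV0
            linarith
    have h2 : ∫ ω, Real.exp (θ * Z 0 ω) ∂μ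
        = Real.exp (-(θ * e / 2)) * ∫ ω, Real.exp (θ * u (Y 0 ω)) ∂μ := by
      rw [← integral_const_mul]
      refine integral_congr_ae (Eventually.of_forall fun ω => ?_)
      simp only [hZ, ← Real.exp_add]
      ring_nf
    rw [h2]
    calc _ ≤ Real.exp (-(θ * e / 2)) * Real.exp (θ * e / 4) := by
          refine mul_le_mul_of_nonneg_left (h1.trans ?_) (Real.exp_pos _).le
          have h3 := Real.add_one_le_exp (θ * e / 4)
          have h4 := mul_le_mul_of_nonneg_left hθC hθ.le
          nlinarith
      _ = Real.exp (-(θ * e / 4)) := by rw [← Real.exp_add]; ring_nf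
      _ ≤ 1 - θ * e / 4 / 2 := exp_neg_le_one_sub_half (by positivity) (by linarith)
      _ = _ := by ring
  have hZsum := sum_integral_exp_lindley_le hZm hZind hZid hZint hexpZ J
  have hEZ : ∫ ω, Z 0 ω ∂μ = -EV - e / 2 := by
    simp only [hZ]
    rw [integral_sub hUint (integrable_const _), hEU]
    simp
  have hexpW := integrable_exp_lindley hZm hZind (θ := θ) fun i =>
    ((hZid i).comp (u := fun z => Real.exp (θ * z)) (by fun_prop)).integrable_iff.2 hexpZ
  set S := ∑ m ∈ Finset.range J, ∫ ω, Real.exp (θ * lindley (fun i => Z i ω) m) ∂μ with hS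
  have hS0 : 0 ≤ S := Finset.sum_nonneg fun m _ => integral_nonneg fun ω => (Real.exp_pos _).le
  -- The mean of `Z 0` is `-(EV + e / 2)`. After division by `θ e / 8` the linear growth rate in `J`
  -- no longer depends on `θ`.
  have hSle : S ≤ 8 / (θ * e) + J * (4 + 8 / e * EV) := by
    have h1 : θ * e / 8 * S ≤ 1 + J * (θ * (EV + e / 2)) := by
      rw [hEZ] at hZsum
      have := mul_le_mul_of_nonneg_right (show θ * e / 8 ≤ 1 - ∫ ω, Real.exp (θ * Z 0 ω) ∂μ by
        linarith) hS0
      linarith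
    have h2 : θ * e / 8 * (8 / (θ * e) + J * (4 + 8 / e * EV)) = 1 + J * (θ * (EV + e / 2)) := by
      field_simp
      ring
    exact le_of_mul_le_mul_left (h1.trans_eq h2.symm) (by positivity)
  have hmarkov (m : ℕ) : μ.real {ω | x < lindley (fun i => Z i ω) m}
      ≤ Real.exp (-(θ * x)) * ∫ ω, Real.exp (θ * lindley (fun i => Z i ω) m) ∂μ := by
    have h1 := mul_meas_ge_le_integral_of_nonneg
      (Eventually.of_forall fun ω => (Real.exp_pos _).le) (hexpW m) (Real.exp (θ * x))
    rw [Real.exp_neg, inv_mul_eq_div, le_div_iff₀' (Real.exp_pos _)]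
    refine le_trans (mul_le_mul_of_nonneg_left (measureReal_mono fun ω hω => ?_)
      (Real.exp_pos _).le) h1
    exact Real.exp_le_exp.2 (mul_le_mul_of_nonneg_left (le_of_lt hω) hθ.le)
  -- the large values
  have hVm (i : ℕ) : Measurable fun ω => v (Y i ω) - e / 2 := (hvm.comp (hY i)).sub_const _
  have hVset (m : ℕ) : MeasurableSet {ω | 0 < lindley (fun i => v (Y i ω) - e / 2) m} :=
    measurableSet_lt measurable_const (measurable_lindley hVm m)
  have hVsum : ∑ m ∈ Finset.range J, μ.real {ω | 0 < lindley (fun i => v (Y i ω) - e / 2) m}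
      ≤ 2 / e * (J * EV) := by
    have h1 : ∑ m ∈ Finset.range J, μ.real {ω | 0 < lindley (fun i => v (Y i ω) - e / 2) m}
        = ∫ ω, ∑ m ∈ Finset.range J,
          ({ω | 0 < lindley (fun i => v (Y i ω) - e / 2) m}.indicator (fun _ => (1 : ℝ)) ω) ∂μ := by
      rw [integral_finsetSum _ fun m _ => (integrable_const (1 : ℝ)).indicator (hVset m)]
      refine Finset.sum_congr rfl fun m _ => ?_
      rw [integral_indicator_const _ (hVset m), smul_eq_mul, mul_one]
    have hVi (i : ℕ) : Integrable (fun ω => v (Y i ω)) μ :=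
      ((hid i).comp hvm).integrable_iff.2 hVint
    have h2 : ∫ ω, ∑ m ∈ Finset.range J,
          ({ω | 0 < lindley (fun i => v (Y i ω) - e / 2) m}.indicator (fun _ => (1 : ℝ)) ω) ∂μ
        ≤ ∫ ω, 2 / e * ∑ i ∈ Finset.range J, v (Y i ω) ∂μ := by
      refine integral_mono (integrable_finsetSum _ fun m _ =>
        (integrable_const (1 : ℝ)).indicator (hVset m))
        ((integrable_finsetSum _ fun i _ => hVi i).const_mul _) fun ω => ?_
      have h3 := sum_lindley_pos_le (fun i => hv0 (Y i ω)) (e / 2) J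
      rw [Finset.sum_range_succ] at h3
      have h4 : (0 : ℝ) ≤ if 0 < lindley (fun i => v (Y i ω) - e / 2) J then (1 : ℝ) else 0 := by
        split_ifs <;> norm_num
      have h5 := lindley_nonneg (fun i => v (Y i ω) - e / 2) J
      simp only [Set.indicator_apply, Set.mem_ofPred_eq]
      rw [div_mul_eq_mul_div, le_div_iff₀ he]
      nlinarith
    rw [integral_const_mul, integral_finsetSum _ fun i _ => hVi i] at h2
    have h3 : ∑ i ∈ Finset.range J, ∫ ω, v (Y i ω) ∂μ = J * EV := by
      have h4 (i : ℕ) : ∫ ω, v (Y i ω) ∂μ = EV := ((hid i).comp hvm).integral_eq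
      simp [h4]
    rw [h1, ← h3]
    exact h2
  have hsplit (m : ℕ) : μ.real {ω | ¬ BackwardBounded (fun i => Y i ω) x e m}
      ≤ Real.exp (-(θ * x)) * ∫ ω, Real.exp (θ * lindley (fun i => Z i ω) m) ∂μ
        + μ.real {ω | 0 < lindley (fun i => v (Y i ω) - e / 2) m} := by
    refine le_trans ((measureReal_mono fun ω hω => ?_).trans (measureReal_union_le
      {ω | x < lindley (fun i => Z i ω) m} {ω | 0 < lindley (fun i => v (Y i ω) - e / 2) m}))
      (add_le_add_left (hmarkov m) _)
    by_contra hcon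
    rw [Set.mem_union, not_or] at hcon
    exact hω (backwardBounded_of_lindley_le (fun i => huv (Y i ω)) (not_lt.1 hcon.1)
      (not_lt.1 hcon.2))
  have hexp1 : Real.exp (-(θ * x)) ≤ 1 := Real.exp_le_one_iff.2 (by
    have := mul_nonneg hθ.le hx
    linarith)
  have hexp0 := (Real.exp_pos (-(θ * x))).le
  calc _ ≤ ∑ m ∈ Finset.range J, (Real.exp (-(θ * x))
          * ∫ ω, Real.exp (θ * lindley (fun i => Z i ω) m) ∂μ
        + μ.real {ω | 0 < lindley (fun i => v (Y i ω) - e / 2) m}) :=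
        Finset.sum_le_sum fun m _ => hsplit m
    _ ≤ Real.exp (-(θ * x)) * S + 2 / e * (J * EV) := by
        rw [Finset.sum_add_distrib, ← Finset.mul_sum]
        exact add_le_add_right hVsum _
    _ ≤ Real.exp (-(θ * x)) * (8 / (θ * e) + J * (4 + 8 / e * EV)) + 2 / e * (J * EV) :=
        add_le_add_left (mul_le_mul_of_nonneg_left hSle hexp0) _
    _ ≤ _ := by
        have h1 : 0 ≤ (1 - Real.exp (-(θ * x))) * (8 / (θ * e) + J * (8 / e * EV)) :=
          mul_nonneg (by linarith) (by positivity)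
        have h2 : 10 / e * EV = 8 / e * EV + 2 / e * EV := by ring
        rw [h2]
        linarith

end Probability

/-! ### Frequencies of atypical indices -/

open Classical in
/-- The number of indices below `J` at which `BackwardBounded` fails. -/
noncomputable def badCount (g : ℕ → ℝ) (x e : ℝ) (J : ℕ) : ℕ :=
  ((Finset.range J).filter fun m => ¬ BackwardBounded g x e m).card

/-- The summand `1` accounts for the index `0`, whose truncated predecessor is `0` again. -/
theorem card_filter_pred_le (p : ℕ → Prop) [DecidablePred p] (J : ℕ) :
    ((Finset.range J).filter fun j => p (j - 1)).card
      ≤ 1 + ((Finset.range J).filter p).card := by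
  have hsub : ((Finset.range J).filter fun j => p (j - 1)) ⊆
      {0} ∪ ((Finset.range J).filter p).image Nat.succ := by
    intro j hj
    rw [Finset.mem_filter, Finset.mem_range] at hj
    rcases Nat.eq_zero_or_pos j with h | h
    · simp [h]
    · refine Finset.mem_union_right _ (Finset.mem_image.2 ⟨j - 1, ?_, by omega⟩)
      rw [Finset.mem_filter, Finset.mem_range]
      exact ⟨by omega, hj.2⟩
  refine (Finset.card_le_card hsub).trans ((Finset.card_union_le _ _).trans ?_)
  rw [Finset.card_singleton]
  exact add_le_add_right Finset.card_image_le _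

theorem IsTrajectory.card_badArrivals_le {K : ℕ} (ξ : Fin K → ℕ → ℝ) (a : Fin K → ℝ) (x e : ℝ)
    (J : ℕ) (k : Fin K) : (badArrivals ξ a x e J k).card
      ≤ 1 + badCount (fun i => a k - ξ k (i + 1)) x e J := by
  classical
  exact card_filter_pred_le (fun m => ¬ BackwardBounded (fun i => a k - ξ k (i + 1)) x e m) J

theorem IsTrajectory.card_badServices_le {K : ℕ} (η : Fin K → ℕ → ℝ)
    (ζ : Fin K → ℕ → Fin (K + 1)) (P : Matrix (Fin K) (Fin K) ℝ) (c : Fin K → ℝ) (x e : ℝ)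
    (J : ℕ) (k : Fin K) : (badServices η ζ P c x e J k).card
      ≤ 1 + badCount (fun i => c k - η k (i + 1)) x e J
        + badCount (fun i => η k (i + 1) - c k) x e J
        + ∑ l, badCount (fun i => (if ζ k i = l.succ then (1 : ℝ) else 0) - P k l) x e J := by
  classical
  have hsub : badServices η ζ P c x e J k ⊆
      ((Finset.range J).filter fun j =>
        ¬ BackwardBounded (fun i => c k - η k (i + 1)) x e (j - 1)) ∪
      (((Finset.range J).filter fun j => ¬ BackwardBounded (fun i => η k (i + 1) - c k) x e j) ∪
      Finset.univ.biUnion fun l => (Finset.range J).filter fun j => ¬ BackwardBounded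
        (fun i => (if ζ k i = l.succ then (1 : ℝ) else 0) - P k l) x e j) := by
    intro j hj
    simp only [badServices, Finset.mem_filter] at hj
    simp only [Finset.mem_union, Finset.mem_filter, Finset.mem_biUnion, Finset.mem_univ, true_and]
    rcases hj with ⟨h0, h | h | ⟨l, h⟩⟩
    · exact Or.inl ⟨h0, h⟩
    · exact Or.inr (Or.inl ⟨h0, h⟩)
    · exact Or.inr (Or.inr ⟨l, h0, h⟩)
  refine (Finset.card_le_card hsub).trans ((Finset.card_union_le _ _).trans ?_)
  rw [add_assoc (1 + _)]
  refine add_le_add (card_filter_pred_le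
    (fun m => ¬ BackwardBounded (fun i => c k - η k (i + 1)) x e m) J)
    ((Finset.card_union_le _ _).trans (add_le_add (le_of_eq ?_) ?_))
  · simp only [badCount]
  · refine Finset.card_biUnion_le.trans (le_of_eq (Finset.sum_congr rfl fun l _ => ?_))
    simp only [badCount]

theorem badCount_eq_sum {Ω : Type*} (Y : ℕ → Ω → ℝ) (x e : ℝ) (J : ℕ) (ω : Ω) :
    (badCount (fun i => Y i ω) x e J : ℝ) = ∑ m ∈ Finset.range J,
      {ω | ¬ BackwardBounded (fun i => Y i ω) x e m}.indicator (fun _ => (1 : ℝ)) ω := by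
  classical
  simp only [badCount, Finset.card_filter, Set.indicator_apply, Set.mem_ofPred_eq]
  push_cast
  rfl

section Probability

variable {Ω : Type*} [MeasurableSpace Ω] {μ : Measure Ω}

theorem measurableSet_backwardBounded {Y : ℕ → Ω → ℝ} (hY : ∀ i, Measurable (Y i)) (x e : ℝ)
    (m : ℕ) : MeasurableSet {ω | BackwardBounded (fun i => Y i ω) x e m} := by
  simp only [BackwardBounded]
  refine measurableSet_setOfPred.2 (Measurable.forall fun j => Measurable.forall fun _ => ?_)
  exact measurableSet_setOfPred.1 (measurableSet_le
    (Finset.measurable_fun_sum _ fun i _ => hY i) measurable_const)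

variable [IsProbabilityMeasure μ]

theorem integrable_badCount {Y : ℕ → Ω → ℝ} (hY : ∀ i, Measurable (Y i)) (x e : ℝ) (J : ℕ) :
    Integrable (fun ω => (badCount (fun i => Y i ω) x e J : ℝ)) μ := by
  simp only [badCount_eq_sum]
  exact integrable_finsetSum _ fun m _ => (integrable_const (1 : ℝ)).indicator
    (measurableSet_backwardBounded hY x e m).compl

theorem integral_badCount {Y : ℕ → Ω → ℝ} (hY : ∀ i, Measurable (Y i)) (x e : ℝ) (J : ℕ) :
    ∫ ω, (badCount (fun i => Y i ω) x e J : ℝ) ∂μ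
      = ∑ m ∈ Finset.range J, μ.real {ω | ¬ BackwardBounded (fun i => Y i ω) x e m} := by
  simp only [badCount_eq_sum]
  refine (integral_finsetSum _ fun m _ => (integrable_const (1 : ℝ)).indicator
    (measurableSet_backwardBounded hY x e m).compl).trans ?_
  refine Finset.sum_congr rfl fun m _ => ?_
  have h := integral_indicator_const (μ := μ) (1 : ℝ) (measurableSet_backwardBounded hY x e m).compl
  rw [smul_eq_mul, mul_one] at h
  exact h

theorem exists_measureReal_compl_le {A : ℕ → Set Ω} (hA : ∀ n, MeasurableSet (A n))
    (hmono : Monotone A) (hae : ∀ᵐ ω ∂μ, ∃ n, ω ∈ A n) {δ : ℝ} (hδ : 0 < δ) :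
    ∃ n, μ.real (A n)ᶜ ≤ δ := by
  have h1 := tendsto_measure_iUnion_atTop (μ := μ) hmono
  have h2 : μ (⋃ n, A n) = 1 := by
    rw [← mem_ae_iff_prob_eq_one (MeasurableSet.iUnion hA)]
    filter_upwards [hae] with ω hω
    exact Set.mem_iUnion.2 hω
  rw [h2] at h1
  have h3 : Tendsto (fun n => μ.real (A n)) atTop (𝓝 1) := by
    exact (ENNReal.tendsto_toReal ENNReal.one_ne_top).comp h1
  obtain ⟨n, hn⟩ := (h3.eventually_const_lt (show 1 - δ < 1 by linarith)).exists
  refine ⟨n, ?_⟩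
  rw [probReal_compl_eq_one_sub (hA n)]
  linarith

end Probability

/-- Provides a number of spacings, linear in `n`, that surely suffices for the clock to pass `n`
eventually. The average omits `x 0`, whose law is unrestricted. -/
theorem lt_sum_of_tendsto_average {x : ℕ → ℝ} (hx : ∀ i, 0 ≤ x i) {m : ℝ}
    (h : Tendsto (fun n : ℕ => (∑ i ∈ Finset.range n, x (i + 1)) / n) atTop (𝓝 m)) {d : ℕ}
    (hd : 1 < d * m) : ∀ᶠ n : ℕ in atTop, (n : ℝ) < ∑ i ∈ Finset.range (d * n + 1), x i := by
  have hd0 : 0 < d := Nat.pos_of_ne_zero fun h0 => by simp [h0] at hd; linarith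
  have hd0' : (0 : ℝ) < d := by exact_mod_cast hd0
  have h1 : 1 / (d : ℝ) < m := by rwa [div_lt_iff₀' hd0']
  have h2 : Tendsto (fun n : ℕ => d * n) atTop atTop := tendsto_id.const_mul_atTop' hd0
  filter_upwards [h2.eventually (h.eventually_const_lt h1), eventually_gt_atTop 0] with n hn hn0
  have hn0' : (0 : ℝ) < n := by exact_mod_cast hn0
  rw [Finset.sum_range_succ']
  push_cast at hn
  rw [div_lt_div_iff₀ hd0' (by positivity)] at hn
  have := hx 0
  nlinarith

theorem tendsto_sum_atTop_of_tendsto_average {x : ℕ → ℝ} (hx : ∀ i, 0 ≤ x i) {m : ℝ} (hm : 0 < m)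
    (h : Tendsto (fun n : ℕ => (∑ i ∈ Finset.range n, x (i + 1)) / n) atTop (𝓝 m)) :
    Tendsto (fun n => ∑ i ∈ Finset.range n, x i) atTop atTop := by
  obtain ⟨d, hd⟩ := exists_nat_gt (1 / m)
  have h1 := lt_sum_of_tendsto_average hx h ((div_lt_iff₀ hm).1 hd)
  have hmono : Monotone fun n => ∑ i ∈ Finset.range n, x i :=
    monotone_nat_of_le_succ fun n => by rw [Finset.sum_range_succ]; linarith [hx n]
  refine tendsto_atTop_atTop_of_monotone hmono fun b => ?_
  obtain ⟨n, hn, hbn⟩ := (h1.and (tendsto_natCast_atTop_atTop.eventually_ge_atTop b)).exists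
  exact ⟨_, hbn.trans hn.le⟩

/-! ### Independence, laws of large numbers and stationarity of networks -/

namespace Network

variable {K : ℕ} {P : Matrix (Fin K) (Fin K) ℝ} {Ω : Type u} [MeasurableSpace Ω] {Pr : Measure Ω}

theorem routing_nonneg (N : Network P Pr) (k l : Fin K) : 0 ≤ P k l := by
  rw [← N.routing_law k 0 l]; exact measureReal_nonneg

theorem routing_le_one [IsProbabilityMeasure Pr] (N : Network P Pr) (k l : Fin K) :
    P k l ≤ 1 := by
  rw [← N.routing_law k 0 l]; exact measureReal_le_one

theorem iIndepFun_arr (N : Network P Pr) (k : Fin K) :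
    iIndepFun (fun i => N.ξ k (i + 1)) Pr :=
  (iIndepFun_iff_iIndep _ _ _).2 (N.indep.precomp (g := fun i => Source.arr k i)
    fun _ _ h => by injection h)

theorem iIndepFun_svc (N : Network P Pr) (k : Fin K) :
    iIndepFun (fun i => N.η k (i + 1)) Pr :=
  (iIndepFun_iff_iIndep _ _ _).2 (N.indep.precomp (g := fun i => Source.svc k i)
    fun _ _ h => by injection h)

theorem iIndepFun_route (N : Network P Pr) (k : Fin K) : iIndepFun (fun i => N.ζ k i) Pr :=
  (iIndepFun_iff_iIndep _ _ _).2 (N.indep.precomp (g := fun i => Source.route k i)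
    fun _ _ h => by injection h)

theorem tendsto_average_arr (N : Network P Pr) (k : Fin K) : ∀ᵐ ω ∂Pr,
    Tendsto (fun n : ℕ => (∑ i ∈ Finset.range n, N.ξ k (i + 1) ω) / n) atTop
      (𝓝 (∫ ω, N.ξ k 1 ω ∂Pr)) :=
  strong_law_ae_real (fun i => N.ξ k (i + 1)) (N.ξ_integrable k)
    (fun _ _ hij => (N.iIndepFun_arr k).indepFun hij) (N.ξ_ident k)

theorem tendsto_average_svc (N : Network P Pr) (k : Fin K) : ∀ᵐ ω ∂Pr,
    Tendsto (fun n : ℕ => (∑ i ∈ Finset.range n, N.η k (i + 1) ω) / n) atTop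
      (𝓝 (∫ ω, N.η k 1 ω ∂Pr)) :=
  strong_law_ae_real (fun i => N.η k (i + 1)) (N.η_integrable k)
    (fun _ _ hij => (N.iIndepFun_svc k).indepFun hij) (N.η_ident k)

theorem ae_isTrajectory (N : Network P Pr) : ∀ᵐ ω ∂Pr,
    IsTrajectory (fun k i => N.ξ k i ω) (fun k i => N.η k i ω) (fun k i => N.ζ k i ω)
      (fun k t => N.Q k t ω) := by
  filter_upwards [ae_all_iff.2 fun k => ae_all_iff.2 (N.ξ_nonneg k),
    ae_all_iff.2 fun k => ae_all_iff.2 (N.η_nonneg k), ae_all_iff.2 N.tendsto_average_arr,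
    ae_all_iff.2 N.tendsto_average_svc, N.rightCont, N.dynamics] with ω h1 h2 h3 h4 h5 h6
  exact ⟨h1, h2, fun k => tendsto_sum_atTop_of_tendsto_average (h1 k) (N.ξ_mean_pos k) (h3 k),
    fun k => tendsto_sum_atTop_of_tendsto_average (h2 k) (N.η_mean_pos k) (h4 k), h5, h6⟩

theorem Stationary.measure_queue_eq {N : Network P Pr} (hN : N.Stationary) (k : Fin K) {t : ℝ}
    (ht : 0 ≤ t) (s : Set ℕ) : Pr {ω | N.Q k t ω ∈ s} = Pr {ω | N.Q k 0 ω ∈ s} := by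
  have h := (hN t ht 1 (fun _ => 0) (fun _ => le_rfl)).comp
    (u := fun q : Fin 1 → Fin K → ℕ => q 0 k)
    ((measurable_pi_apply k).comp (measurable_pi_apply 0))
  have h2 := h.measure_mem_eq (s := s) (MeasurableSet.of_discrete)
  simpa [Function.comp_def, Set.preimage] using h2

/-- With high probability the initial data are bounded and the partial sums grow linearly. -/
theorem exists_typical_set [IsProbabilityMeasure Pr] (N : Network P Pr) {d : ℕ}
    (hdξ : ∀ k, 1 < d * ∫ ω, N.ξ k 1 ω ∂Pr) (hdη : ∀ k, 1 < d * ∫ ω, N.η k 1 ω ∂Pr)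
    {δ : ℝ} (hδ : 0 < δ) : ∃ (M : ℕ) (G : Set Ω), MeasurableSet G ∧ Pr.real Gᶜ ≤ δ ∧
      ∀ ω ∈ G, ∀ k, (N.Q k 0 ω : ℝ) ≤ M ∧ N.ξ k 0 ω ≤ M ∧ N.η k 0 ω ≤ M ∧ ∀ n : ℕ, M ≤ n →
        (n : ℝ) < ∑ i ∈ Finset.range (d * n + 1), N.ξ k i ω ∧
        (n : ℝ) < ∑ i ∈ Finset.range (d * n + 1), N.η k i ω := by
  set A : ℕ → Set Ω := fun M => {ω | ∀ k, (N.Q k 0 ω : ℝ) ≤ M ∧ N.ξ k 0 ω ≤ M ∧ N.η k 0 ω ≤ M ∧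
      ∀ n : ℕ, M ≤ n → (n : ℝ) < ∑ i ∈ Finset.range (d * n + 1), N.ξ k i ω ∧
        (n : ℝ) < ∑ i ∈ Finset.range (d * n + 1), N.η k i ω} with hA
  have hmeas (M : ℕ) : MeasurableSet (A M) := by
    refine measurableSet_setOfPred.2 (Measurable.forall fun k => Measurable.and ?_ (Measurable.and ?_
      (Measurable.and ?_ (Measurable.forall fun n => Measurable.forall fun _ =>
        Measurable.and ?_ ?_))))
    · exact measurableSet_setOfPred.1 (measurableSet_le
        (measurable_from_top.comp (N.measurable_Q k 0 le_rfl)) measurable_const)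
    · exact measurableSet_setOfPred.1 (measurableSet_le (N.measurable_ξ k 0) measurable_const)
    · exact measurableSet_setOfPred.1 (measurableSet_le (N.measurable_η k 0) measurable_const)
    · exact measurableSet_setOfPred.1 (measurableSet_lt measurable_const
        (Finset.measurable_fun_sum _ fun i _ => N.measurable_ξ k i))
    · exact measurableSet_setOfPred.1 (measurableSet_lt measurable_const
        (Finset.measurable_fun_sum _ fun i _ => N.measurable_η k i))
  have hmono : Monotone A := by
    intro M M' hMM' ω hω k
    have h : (M : ℝ) ≤ M' := by exact_mod_cast hMM'
    obtain ⟨h1, h2, h3, h4⟩ := hω k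
    exact ⟨h1.trans h, h2.trans h, h3.trans h, fun n hn => h4 n (hMM'.trans hn)⟩
  have hae : ∀ᵐ ω ∂Pr, ∃ M, ω ∈ A M := by
    filter_upwards [ae_all_iff.2 fun k => ae_all_iff.2 (N.ξ_nonneg k),
      ae_all_iff.2 fun k => ae_all_iff.2 (N.η_nonneg k), ae_all_iff.2 N.tendsto_average_arr,
      ae_all_iff.2 N.tendsto_average_svc] with ω h1 h2 h3 h4
    have h5 (k : Fin K) : ∀ᶠ M : ℕ in atTop, (N.Q k 0 ω : ℝ) ≤ M ∧ N.ξ k 0 ω ≤ M ∧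
        N.η k 0 ω ≤ M ∧ ∀ n : ℕ, M ≤ n →
          (n : ℝ) < ∑ i ∈ Finset.range (d * n + 1), N.ξ k i ω ∧
          (n : ℝ) < ∑ i ∈ Finset.range (d * n + 1), N.η k i ω := by
      have hnat := fun b : ℝ =>
        (tendsto_natCast_atTop_atTop (R := ℝ)).eventually_ge_atTop b
      refine (hnat _).and ((hnat _).and ((hnat _).and ?_))
      exact eventually_forall_ge_atTop.2 ((lt_sum_of_tendsto_average (h1 k) (h3 k) (hdξ k)).and
        (lt_sum_of_tendsto_average (h2 k) (h4 k) (hdη k)))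
    exact (eventually_all.2 h5).exists
  obtain ⟨M, hM⟩ := exists_measureReal_compl_le hmeas hmono hae hδ
  exact ⟨M, A M, hmeas M, hM, fun ω hω => hω⟩

end Network

/-! ### Integrals -/

section Integral

variable {Ω : Type*} [MeasurableSpace Ω] {μ : Measure Ω} {f g : Ω → ℝ} {A B : ℝ}

theorem integral_add_le_add (hf : Integrable f μ ∧ ∫ ω, f ω ∂μ ≤ A)
    (hg : Integrable g μ ∧ ∫ ω, g ω ∂μ ≤ B) :
    Integrable (fun ω => f ω + g ω) μ ∧ ∫ ω, (f ω + g ω) ∂μ ≤ A + B :=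
  ⟨hf.1.add hg.1, (integral_add hf.1 hg.1).trans_le (add_le_add hf.2 hg.2)⟩

theorem integral_const_mul_le_mul (hf : Integrable f μ ∧ ∫ ω, f ω ∂μ ≤ A) {c : ℝ} (hc : 0 ≤ c) :
    Integrable (fun ω => c * f ω) μ ∧ ∫ ω, c * f ω ∂μ ≤ c * A :=
  ⟨hf.1.const_mul c, (integral_const_mul c f).trans_le (mul_le_mul_of_nonneg_left hf.2 hc)⟩

theorem integral_sum_le_card_mul {ι : Type*} (s : Finset ι) {f : ι → Ω → ℝ}
    (hf : ∀ i ∈ s, Integrable (f i) μ ∧ ∫ ω, f i ω ∂μ ≤ A) :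
    Integrable (fun ω => ∑ i ∈ s, f i ω) μ ∧ ∫ ω, ∑ i ∈ s, f i ω ∂μ ≤ s.card * A := by
  refine ⟨integrable_finsetSum _ fun i hi => (hf i hi).1, ?_⟩
  rw [integral_finsetSum _ fun i hi => (hf i hi).1, ← nsmul_eq_mul, ← Finset.sum_const]
  exact Finset.sum_le_sum fun i hi => (hf i hi).2

theorem integral_const_le [IsProbabilityMeasure μ] (c : ℝ) :
    Integrable (fun _ : Ω => c) μ ∧ ∫ _, c ∂μ ≤ c :=
  ⟨integrable_const c, by simp⟩

end Integral

/-- Division by `n` removes everything that depends on the initial data. -/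
theorem le_of_forall_mul_le_add {X Y c : ℝ} (h : ∀ᶠ n : ℕ in atTop, n * X ≤ n * Y + c) :
    X ≤ Y := by
  by_contra! hlt
  have h1 := tendsto_natCast_atTop_atTop.eventually_gt_atTop (c / (X - Y))
  obtain ⟨n, hn, hn2⟩ := (h.and h1).exists
  rw [div_lt_iff₀ (sub_pos.2 hlt)] at hn2
  linarith

/-! ### From the frequency of atypical indices to stationary tails -/

namespace Network

variable {K : ℕ} {P : Matrix (Fin K) (Fin K) ℝ} {Ω : Type u} [MeasurableSpace Ω] {Pr : Measure Ω}

/-- The frequency with which the sequences driving the network behave atypically is at most `p`. -/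
structure RareAtypical (N : Network P Pr) (x e p c₀ : ℝ) : Prop where
  arr : ∀ k J, ∑ m ∈ Finset.range J, Pr.real {ω | ¬ BackwardBounded
    (fun i => (∫ ω', N.ξ k 1 ω' ∂Pr) - N.ξ k (i + 1) ω) x e m} ≤ J * p + c₀
  svc_lower : ∀ k J, ∑ m ∈ Finset.range J, Pr.real {ω | ¬ BackwardBounded
    (fun i => (∫ ω', N.η k 1 ω' ∂Pr) - N.η k (i + 1) ω) x e m} ≤ J * p + c₀
  svc_upper : ∀ k J, ∑ m ∈ Finset.range J, Pr.real {ω | ¬ BackwardBounded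
    (fun i => N.η k (i + 1) ω - (∫ ω', N.η k 1 ω' ∂Pr)) x e m} ≤ J * p + c₀
  route : ∀ k l J, ∑ m ∈ Finset.range J, Pr.real {ω | ¬ BackwardBounded
    (fun i => (if N.ζ k i ω = l.succ then (1 : ℝ) else 0) - P k l) x e m} ≤ J * p + c₀

theorem arrRate_pos (N : Network P Pr) (k : Fin K) : 0 < N.arrRate k :=
  one_div_pos.2 (N.ξ_mean_pos k)

theorem svcRate_pos (N : Network P Pr) (k : Fin K) : 0 < N.svcRate k :=
  one_div_pos.2 (N.η_mean_pos k)

theorem mean_mul_arrRate (N : Network P Pr) (k : Fin K) :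
    (∫ ω, N.ξ k 1 ω ∂Pr) * N.arrRate k = 1 :=
  mul_one_div_cancel (N.ξ_mean_pos k).ne'

theorem mean_mul_svcRate (N : Network P Pr) (k : Fin K) :
    (∫ ω, N.η k 1 ω ∂Pr) * N.svcRate k = 1 :=
  mul_one_div_cancel (N.η_mean_pos k).ne'

theorem measurable_routeDev (N : Network P Pr) (k l : Fin K) (i : ℕ) :
    Measurable fun ω => (if N.ζ k i ω = l.succ then (1 : ℝ) else 0) - P k l :=
  (measurable_from_top (f := fun z : Fin (K + 1) =>
    (if z = l.succ then (1 : ℝ) else 0) - P k l)).comp (N.measurable_ζ k i)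

/-- Separates the residual time, which is bounded only on the typical set, from the identically
distributed ones; `v ^ 2 + v ≤ 2 * v ^ 2 + 1` leaves only a second moment. -/
theorem sum_length_shift_le {v : ℕ → ℝ} (hv : ∀ j, 0 ≤ v j) {M y : ℝ} (hvM : v 0 ≤ M)
    (hy : 0 < y) (J : ℕ) : ∑ j ∈ Finset.range J, (v j + 1) * v j / y
      ≤ (M + 1) * M / y + 1 / y * ∑ j ∈ Finset.range J, (2 * v (j + 1) ^ 2 + 1) := by
  have hv0 := hv 0
  have hM0 : 0 ≤ M := hv0.trans hvM
  calc ∑ j ∈ Finset.range J, (v j + 1) * v j / y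
      ≤ ∑ j ∈ Finset.range (J + 1), (v j + 1) * v j / y :=
        Finset.sum_le_sum_of_subset_of_nonneg (Finset.range_mono (Nat.le_succ _)) fun j _ _ => by
          have := hv j
          positivity
    _ = (v 0 + 1) * v 0 / y + ∑ j ∈ Finset.range J, (v (j + 1) + 1) * v (j + 1) / y := by
        rw [Finset.sum_range_succ', add_comm]
    _ ≤ _ := by
        refine add_le_add (by gcongr) ?_
        rw [Finset.mul_sum]
        refine Finset.sum_le_sum fun j _ => ?_
        rw [one_div_mul_eq_div]
        refine div_le_div_of_nonneg_right ?_ hy.le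
        nlinarith [sq_nonneg (v (j + 1) - 1)]

/-- A bound for the number of integer times at which station `l` is in an atypical state. -/
noncomputable def atypicalBound (N : Network P Pr) (x e y M : ℝ) (J : ℕ) (l : Fin K) (ω : Ω) : ℝ :=
  (3 * (y + 1) + 3 * ((M + 1) * M) / y)
  + ((y + 1) * (badCount (fun i => (∫ ω', N.ξ l 1 ω' ∂Pr) - N.ξ l (i + 1) ω) x e J : ℝ)
  + (2 * (y + 1) * (badCount (fun i => (∫ ω', N.η l 1 ω' ∂Pr) - N.η l (i + 1) ω) x e J : ℝ)
  + (2 * (y + 1) * (badCount (fun i => N.η l (i + 1) ω - (∫ ω', N.η l 1 ω' ∂Pr)) x e J : ℝ)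
  + (2 * (y + 1) * ∑ l', (badCount (fun i =>
      (if N.ζ l i ω = l'.succ then (1 : ℝ) else 0) - P l l') x e J : ℝ)
  + (2 / y * ∑ j ∈ Finset.range J, (2 * N.ξ l (j + 1) ω ^ 2 + 1)
  + 1 / y * ∑ j ∈ Finset.range J, (2 * N.η l (j + 1) ω ^ 2 + 1))))))

theorem atypicalBound_nonneg (N : Network P Pr) {x e y M : ℝ} (hy : 0 < y) (hM : 0 ≤ M) (J : ℕ)
    (l : Fin K) (ω : Ω) : 0 ≤ N.atypicalBound x e y M J l ω := by
  unfold atypicalBound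
  positivity

theorem integral_sum_sq_le [IsProbabilityMeasure Pr] {Y : ℕ → Ω → ℝ} {m₂ : ℝ}
    (hid : ∀ i, IdentDistrib (Y (i + 1)) (Y 1) Pr Pr)
    (h : Integrable (fun ω => Y 1 ω ^ 2) Pr ∧ ∫ ω, Y 1 ω ^ 2 ∂Pr ≤ m₂) (J : ℕ) :
    Integrable (fun ω => ∑ j ∈ Finset.range J, (2 * Y (j + 1) ω ^ 2 + 1)) Pr ∧
      ∫ ω, ∑ j ∈ Finset.range J, (2 * Y (j + 1) ω ^ 2 + 1) ∂Pr ≤ J * (2 * m₂ + 1) := by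
  have h1 := integral_sum_le_card_mul (μ := Pr) (A := 2 * m₂ + 1) (Finset.range J)
    (f := fun j ω => 2 * Y (j + 1) ω ^ 2 + 1) fun j _ => by
      have h2 : IdentDistrib (fun ω => Y (j + 1) ω ^ 2) (fun ω => Y 1 ω ^ 2) Pr Pr :=
        (hid j).comp (u := fun z => z ^ 2) (by fun_prop)
      exact integral_add_le_add (integral_const_mul_le_mul
        ⟨h2.integrable_iff.2 h.1, h2.integral_eq.trans_le h.2⟩ zero_le_two)
        (integral_const_le 1)
  rwa [Finset.card_range] at h1

theorem integral_atypicalBound_le [IsProbabilityMeasure Pr] (N : Network P Pr)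
    {x e y M p c₀ m₂ : ℝ} (hy : 0 < y)
    (hξ2 : ∀ k, Integrable (fun ω => N.ξ k 1 ω ^ 2) Pr ∧ ∫ ω, N.ξ k 1 ω ^ 2 ∂Pr ≤ m₂)
    (hη2 : ∀ k, Integrable (fun ω => N.η k 1 ω ^ 2) Pr ∧ ∫ ω, N.η k 1 ω ^ 2 ∂Pr ≤ m₂)
    (hrare : N.RareAtypical x e p c₀) (J : ℕ) (l : Fin K) :
    Integrable (N.atypicalBound x e y M J l) Pr ∧ ∫ ω, N.atypicalBound x e y M J l ω ∂Pr ≤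
      (3 * (y + 1) + 3 * ((M + 1) * M) / y) + ((2 * K + 5) * (y + 1) * (J * p + c₀)
        + 3 * (2 * m₂ + 1) / y * J) := by
  have hcount {Y : ℕ → Ω → ℝ} (hY : ∀ i, Measurable (Y i))
      (h : ∑ m ∈ Finset.range J, Pr.real {ω | ¬ BackwardBounded (fun i => Y i ω) x e m}
        ≤ J * p + c₀) : Integrable (fun ω => (badCount (fun i => Y i ω) x e J : ℝ)) Pr ∧
        ∫ ω, (badCount (fun i => Y i ω) x e J : ℝ) ∂Pr ≤ J * p + c₀ :=
    ⟨integrable_badCount hY x e J, (integral_badCount hY x e J).trans_le h⟩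
  have key : Integrable (N.atypicalBound x e y M J l) Pr ∧
      ∫ ω, N.atypicalBound x e y M J l ω ∂Pr ≤
        (3 * (y + 1) + 3 * ((M + 1) * M) / y) + ((y + 1) * (J * p + c₀)
        + (2 * (y + 1) * (J * p + c₀) + (2 * (y + 1) * (J * p + c₀)
        + (2 * (y + 1) * (K * (J * p + c₀))
        + (2 / y * (J * (2 * m₂ + 1)) + 1 / y * (J * (2 * m₂ + 1))))))) := by
    refine integral_add_le_add (integral_const_le _) ?_
    refine integral_add_le_add (integral_const_mul_le_mul (hcount
      (fun i => measurable_const.sub (N.measurable_ξ l _)) (hrare.arr l J)) (by positivity)) ?_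
    refine integral_add_le_add (integral_const_mul_le_mul (hcount
      (fun i => measurable_const.sub (N.measurable_η l _)) (hrare.svc_lower l J))
      (by positivity)) ?_
    refine integral_add_le_add (integral_const_mul_le_mul (hcount
      (fun i => (N.measurable_η l _).sub measurable_const) (hrare.svc_upper l J))
      (by positivity)) ?_
    refine integral_add_le_add (integral_const_mul_le_mul ?_ (by positivity)) ?_
    · have h1 := integral_sum_le_card_mul (μ := Pr) Finset.univ fun l' _ =>
        hcount (N.measurable_routeDev l l') (hrare.route l l' J)
      rwa [Finset.card_univ, Fintype.card_fin] at h1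
    · exact integral_add_le_add (integral_const_mul_le_mul
        (integral_sum_sq_le (N.ξ_ident l) (hξ2 l) J) (by positivity)) (integral_const_mul_le_mul
        (integral_sum_sq_le (N.η_ident l) (hη2 l) J) (by positivity))
  refine ⟨key.1, key.2.trans_eq ?_⟩
  ring

theorem card_long_queue_le_atypicalBound (N : Network P Pr) {ω : Ω}
    (hω : IsTrajectory (fun k i => N.ξ k i ω) (fun k i => N.η k i ω) (fun k i => N.ζ k i ω)
      (fun k t => N.Q k t ω)) {x e y z t₀ M : ℝ} (hy : 0 < y) (ht₀ : 0 ≤ t₀) {k : Fin K}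
    (hreg : ∀ t, t₀ ≤ t → IsTrajectory.Regular (fun k i => N.ξ k i ω) (fun k i => N.η k i ω)
      (fun k i => N.ζ k i ω) (fun k t => N.Q k t ω) P (fun k => ∫ ω', N.ξ k 1 ω' ∂Pr)
      (fun k => ∫ ω', N.η k 1 ω' ∂Pr) x e t → (N.Q k t ω : ℝ) ≤ z)
    (hξM : ∀ k, N.ξ k 0 ω ≤ M) (hηM : ∀ k, N.η k 0 ω ≤ M) {n J : ℕ}
    (hξJ : ∀ k, (n : ℝ) < ∑ i ∈ Finset.range J, N.ξ k i ω)
    (hηJ : ∀ k, (n : ℝ) < ∑ i ∈ Finset.range J, N.η k i ω) :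
    (((Finset.Icc 1 n).filter fun s : ℕ => z < (N.Q k s ω : ℝ)).card : ℝ)
      ≤ (t₀ + 1) + ∑ l, N.atypicalBound x e y M J l ω := by
  refine (hω.card_long_queue_le hy ht₀ hreg hξJ hηJ).trans
    (add_le_add_right (Finset.sum_le_sum fun l _ => ?_) _)
  have h2 : ((IsTrajectory.badArrivals (fun k i => N.ξ k i ω)
      (fun k => ∫ ω', N.ξ k 1 ω' ∂Pr) x e J l).card : ℝ) ≤ _ :=
    Nat.cast_le.2 (IsTrajectory.card_badArrivals_le (fun k i => N.ξ k i ω)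
      (fun k => ∫ ω', N.ξ k 1 ω' ∂Pr) x e J l)
  have h3 : ((IsTrajectory.badServices (fun k i => N.η k i ω) (fun k i => N.ζ k i ω) P
      (fun k => ∫ ω', N.η k 1 ω' ∂Pr) x e J l).card : ℝ) ≤ _ :=
    Nat.cast_le.2 (IsTrajectory.card_badServices_le (fun k i => N.η k i ω)
      (fun k i => N.ζ k i ω) P (fun k => ∫ ω', N.η k 1 ω' ∂Pr) x e J l)
  push_cast at h2 h3
  have h5 := sum_length_shift_le (hω.ξ_nonneg l) (hξM l) hy J
  have h6 := sum_length_shift_le (hω.η_nonneg l) (hηM l) hy J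
  have h7 := mul_le_mul_of_nonneg_right h2 (show 0 ≤ y + 1 by linarith)
  have h8 := mul_le_mul_of_nonneg_right h3 (show 0 ≤ y + 1 by linarith)
  rw [atypicalBound, mul_div_assoc 3, show (2 : ℝ) / y = 2 * (1 / y) by ring]
  linarith

/-- Averaging over time bounds the stationary tail probability by a linear growth rate. -/
theorem measureReal_queue_le_of_card_le [IsProbabilityMeasure Pr] (N : Network P Pr)
    (hN : N.Stationary) (k : Fin K) {z δ A : ℝ} {n : ℕ} {G : Set Ω} (hG : MeasurableSet G)
    (hGδ : Pr.real Gᶜ ≤ δ) {F : Ω → ℝ} (hF0 : ∀ ω, 0 ≤ F ω)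
    (hF : Integrable F Pr ∧ ∫ ω, F ω ∂Pr ≤ A)
    (hcard : ∀ᵐ ω ∂Pr, ω ∈ G →
      (((Finset.Icc 1 n).filter fun s : ℕ => z < (N.Q k s ω : ℝ)).card : ℝ) ≤ F ω) :
    n * Pr.real {ω | z < N.Q k 0 ω} ≤ n * δ + A := by
  set X := Pr.real {ω | z < N.Q k 0 ω} with hX
  set E : ℕ → Set Ω := fun s => {ω | z < N.Q k s ω} with hE
  have hEmeas (s : ℕ) : MeasurableSet (E s) :=
    measurableSet_lt measurable_const
      (measurable_from_top.comp (N.measurable_Q k s (Nat.cast_nonneg s)))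
  have hEX (s : ℕ) : Pr.real (E s) = X :=
    congrArg ENNReal.toReal (hN.measure_queue_eq k (Nat.cast_nonneg s) {q | z < q})
  have hpath : ∀ᵐ ω ∂Pr, ∑ s ∈ Finset.Icc 1 n, (E s ∩ G).indicator (fun _ => (1 : ℝ)) ω
      ≤ F ω := by
    filter_upwards [hcard] with ω hω
    by_cases hωG : ω ∈ G
    · refine le_of_eq_of_le ?_ (hω hωG)
      rw [Finset.card_filter]
      push_cast
      refine Finset.sum_congr rfl fun s _ => ?_
      by_cases hs : z < N.Q k s ω
      · rw [if_pos hs, Set.indicator_of_mem (show ω ∈ E s ∩ G from ⟨hs, hωG⟩)]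
      · rw [if_neg hs, Set.indicator_of_notMem fun h => hs h.1]
    · refine le_of_eq_of_le ?_ (hF0 ω)
      exact Finset.sum_eq_zero fun s _ => Set.indicator_of_notMem (fun h => hωG h.2) _
  have hEGi (s : ℕ) : Integrable ((E s ∩ G).indicator fun _ => (1 : ℝ)) Pr :=
    (integrable_const (1 : ℝ)).indicator ((hEmeas s).inter hG)
  have hint := integral_mono_ae (integrable_finsetSum (Finset.Icc 1 n) fun s _ => hEGi s)
    hF.1 hpath
  rw [integral_finsetSum _ fun s _ => hEGi s] at hint
  -- By stationarity each of the `n` times contributes the same probability `X`, at most `δ` of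
  -- which lies outside `G`.
  have hsumX : ∑ _s ∈ Finset.Icc 1 n, X ≤ ∑ s ∈ Finset.Icc 1 n,
      (δ + ∫ ω, (E s ∩ G).indicator (fun _ => (1 : ℝ)) ω ∂Pr) := by
    refine Finset.sum_le_sum fun s _ => ?_
    rw [integral_indicator_const _ ((hEmeas s).inter hG), smul_eq_mul, mul_one, ← hEX s,
      add_comm]
    have hsub : E s ⊆ (E s ∩ G) ∪ Gᶜ := fun ω hω => by
      by_cases h : ω ∈ G
      · exact Or.inl ⟨hω, h⟩
      · exact Or.inr h
    exact (measureReal_mono hsub).trans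
      ((measureReal_union_le _ _).trans (add_le_add_right hGδ _))
  rw [Finset.sum_add_distrib, Finset.sum_const, Finset.sum_const, Nat.card_Icc,
    nsmul_eq_mul, nsmul_eq_mul, Nat.add_sub_cancel] at hsumX
  linarith [hF.2]

/-- The stationary queue lengths exceed a multiple of `x` with probability of order `√p`, if
atypical blocks at level `x` have frequency at most `p`. -/
theorem measureReal_queue_le [IsProbabilityMeasure Pr] (N : Network P Pr) (hN : N.Stationary)
    (hP : spectralRadius ℂ (P.map (fun x : ℝ => (x : ℂ))) < 1) {nu w : Fin K → ℝ}
    {L x e κ p c₀ m₂ : ℝ} (hL : 1 ≤ L) (hlamL : ∀ k, N.arrRate k ≤ L)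
    (hmuL : ∀ k, N.svcRate k ≤ L) (hnu : ∀ k, nu k < N.svcRate k) (hκ : 0 < κ)
    (hnulam : ∀ k, nu k - ∑ l, P l k * nu l = N.arrRate k + κ)
    (hw : ∀ k, w k - ∑ l, P l k * w l = 1)
    (hx : 1 ≤ x) (he : 0 ≤ e) (hLe : L * e ≤ 1 / 2) (heκ : 6 * (K + 1) * L ^ 2 * e ≤ κ / 2)
    (hξ2 : ∀ k, Integrable (fun ω => N.ξ k 1 ω ^ 2) Pr ∧ ∫ ω, N.ξ k 1 ω ^ 2 ∂Pr ≤ m₂)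
    (hη2 : ∀ k, Integrable (fun ω => N.η k 1 ω ^ 2) Pr ∧ ∫ ω, N.η k 1 ω ^ 2 ∂Pr ≤ m₂)
    (hp : 0 < p) (hp1 : p ≤ 1) (hrare : N.RareAtypical x e p c₀) (k : Fin K) :
    Pr.real {ω | (6 * (K + 1) * L ^ 2 + 1) * x * w k < N.Q k 0 ω}
      ≤ (L + 1) * K * (4 * K + 13 + 6 * m₂) * √p := by
  set z := (6 * ((K : ℝ) + 1) * L ^ 2 + 1) * x * w k with hz
  set X := Pr.real {ω | z < N.Q k 0 ω} with hX
  -- This level balances the cost `y * p` of the short spacings at atypical indices with the cost `1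
  -- / y` of the long spacings.
  set y := 1 / √p with hy
  have hsq : 0 < √p := Real.sqrt_pos.2 hp
  have hsq1 : √p ≤ 1 := Real.sqrt_le_one.2 hp1
  have hy0 : 0 < y := one_div_pos.2 hsq
  -- An integer exceeding all rates, so that `d * n + 1` spacings eventually cover the time interval
  -- up to `n`.
  set d := ⌊L⌋₊ + 1 with hd
  have hdL : L < d := by rw [hd]; push_cast; exact Nat.lt_floor_add_one L
  have hdL' : (d : ℝ) ≤ L + 1 := by
    rw [hd]; push_cast; linarith [Nat.floor_le (show 0 ≤ L by linarith)]
  have hd_mean (a r : ℝ) (har : a * r = 1) (ha : 0 < a) (hr : r ≤ L) : 1 < d * a := by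
    rw [← har, mul_comm]
    exact mul_lt_mul_of_pos_right (hr.trans_lt hdL) ha
  have hm₂ : 0 ≤ m₂ := (integral_nonneg fun ω => sq_nonneg _).trans (hξ2 k).2
  set b := (K : ℝ) * ((2 * K + 5) * ((y + 1) * p) + 3 * (2 * m₂ + 1) / y) with hb
  -- `M`, the typical set and the waiting time `t₀` depend on `δ` but the growth rate `d * b` does
  -- not, so `n` tends to infinity first and `δ` to zero afterwards.
  have hbound (δ : ℝ) (hδ : 0 < δ) : X ≤ δ + d * b := by
    obtain ⟨M, G, hG, hGδ, hGprop⟩ := N.exists_typical_set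
      (fun k => hd_mean _ _ (N.mean_mul_arrRate k) (N.ξ_mean_pos k) (hlamL k))
      (fun k => hd_mean _ _ (N.mean_mul_svcRate k) (N.η_mean_pos k) (hmuL k)) hδ
    set t₀ : ℝ := M + 2 * (1 + L) * M / κ with ht₀
    have ht₀0 : 0 ≤ t₀ := by positivity
    refine le_of_forall_mul_le_add (c := t₀ + 1 + K * (3 * (y + 1) + 3 * ((M + 1) * M) / y
      + (2 * K + 5) * (y + 1) * (p + c₀) + 3 * (2 * m₂ + 1) / y)) ?_
    filter_upwards [eventually_ge_atTop M] with n hn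
    set J := d * n + 1 with hJ
    have hFtot := integral_add_le_add (integral_const_le (μ := Pr) (t₀ + 1))
      (integral_sum_le_card_mul Finset.univ fun l _ =>
        N.integral_atypicalBound_le (M := M) hy0 hξ2 hη2 hrare J l)
    rw [Finset.card_univ, Fintype.card_fin] at hFtot
    have hfin := N.measureReal_queue_le_of_card_le hN k (z := z) (n := n) hG hGδ (fun ω =>
      add_nonneg (by linarith) (Finset.sum_nonneg fun l _ =>
        N.atypicalBound_nonneg hy0 (Nat.cast_nonneg M) J l ω)) hFtot (by
        filter_upwards [N.ae_isTrajectory] with ω hω hωG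
        have hprop := hGprop ω hωG
        exact N.card_long_queue_le_atypicalBound hω hy0 ht₀0 (fun t ht hreg =>
          hω.queue_le_of_regular N.routing_nonneg N.routing_le_one hP
            N.arrRate_pos N.svcRate_pos N.mean_mul_arrRate N.mean_mul_svcRate hL hlamL hmuL hnu hκ
            hnulam hw hx he hLe heκ (Nat.cast_nonneg M) (fun k => (hprop k).1)
            (fun k => (hprop k).2.1) (fun k => (hprop k).2.2.1) ht hreg k)
          (fun k => (hprop k).2.1) (fun k => (hprop k).2.2.1)
          (fun k => ((hprop k).2.2.2 n hn).1) (fun k => ((hprop k).2.2.2 n hn).2))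
    have hJn : (J : ℝ) = d * n + 1 := by rw [hJ]; push_cast; ring
    refine hfin.trans (le_of_eq ?_)
    rw [hJn, hb]
    ring
  have hX1 : X ≤ d * b := le_of_forall_pos_le_add fun δ hδ => by linarith [hbound δ hδ]
  have hyp : (y + 1) * p ≤ 2 * √p := by
    have h1 : √p * √p = p := Real.mul_self_sqrt hp.le
    have h2 : y * p = √p := by rw [hy, one_div_mul_eq_div, div_eq_iff hsq.ne', h1]
    have h3 : √p * √p ≤ √p * 1 := mul_le_mul_of_nonneg_left hsq1 hsq.le
    rw [add_mul, h2]
    linarith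
  have hb1 : b ≤ K * (4 * K + 13 + 6 * m₂) * √p := by
    have h1 : 3 * (2 * m₂ + 1) / y = 3 * (2 * m₂ + 1) * √p := by rw [hy]; field_simp
    rw [hb, h1, mul_assoc (K : ℝ) (4 * K + 13 + 6 * m₂)]
    refine mul_le_mul_of_nonneg_left ?_ (Nat.cast_nonneg (α := ℝ) K)
    have h2 := mul_le_mul_of_nonneg_left hyp (show (0 : ℝ) ≤ 2 * (K : ℝ) + 5 by positivity)
    linarith
  have hb0 : 0 ≤ b := by positivity
  calc X ≤ d * b := hX1
    _ ≤ (L + 1) * b := mul_le_mul_of_nonneg_right hdL' hb0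
    _ ≤ (L + 1) * (K * (4 * K + 13 + 6 * m₂) * √p) :=
        mul_le_mul_of_nonneg_left hb1 (by linarith)
    _ = _ := by ring

end Network

/-! ### Moment bounds -/

section Probability

variable {Ω : Type*} [MeasurableSpace Ω] {μ : Measure Ω}

theorem integral_le_of_ae_le {f g : Ω → ℝ} {B : ℝ} (hf : AEStronglyMeasurable f μ)
    (h0 : ∀ᵐ ω ∂μ, 0 ≤ f ω) (hfg : ∀ᵐ ω ∂μ, f ω ≤ g ω)
    (hg : Integrable g μ ∧ ∫ ω, g ω ∂μ ≤ B) : Integrable f μ ∧ ∫ ω, f ω ∂μ ≤ B := by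
  have hfi : Integrable f μ := by
    refine hg.1.mono' hf ?_
    filter_upwards [h0, hfg] with ω h1 h2
    rwa [Real.norm_eq_abs, abs_of_nonneg h1]
  exact ⟨hfi, (integral_mono_ae hfi hg.1 hfg).trans hg.2⟩

theorem integral_le_toReal_of_lintegral_le {f : Ω → ℝ} {B : ENNReal}
    (hf : AEStronglyMeasurable f μ) (h0 : ∀ᵐ ω ∂μ, 0 ≤ f ω) (hB : B < ⊤)
    (h : ∫⁻ ω, ENNReal.ofReal (f ω) ∂μ ≤ B) : Integrable f μ ∧ ∫ ω, f ω ∂μ ≤ B.toReal := by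
  refine ⟨⟨hf, ?_⟩, ?_⟩
  · rw [hasFiniteIntegral_iff_ofReal h0]
    exact h.trans_lt hB
  · rw [integral_eq_lintegral_of_nonneg_ae h0 hf]
    exact ENNReal.toReal_mono hB.ne h

variable [IsProbabilityMeasure μ]

/-- For routing decisions only the probabilities of the destinations are given; the law of a shifted
indicator is determined by such a probability. -/
theorem identDistrib_ite_sub {p q : Ω → Prop} [DecidablePred p] [DecidablePred q] {a : ℝ}
    (hp : MeasurableSet {ω | p ω}) (hq : MeasurableSet {ω | q ω})
    (h : μ.real {ω | p ω} = μ.real {ω | q ω}) :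
    IdentDistrib (fun ω => (if p ω then (1 : ℝ) else 0) - a)
      (fun ω => (if q ω then (1 : ℝ) else 0) - a) μ μ := by
  have hm (r : Ω → Prop) [DecidablePred r] (hr : MeasurableSet {ω | r ω}) :
      Measurable fun ω => (if r ω then (1 : ℝ) else 0) - a :=
    (Measurable.ite hr measurable_const measurable_const).sub_const a
  have h' : μ {ω | p ω} = μ {ω | q ω} := (measureReal_eq_measureReal_iff).1 h
  have hc : μ {ω | p ω}ᶜ = μ {ω | q ω}ᶜ := by
    rw [prob_compl_eq_one_sub hp, prob_compl_eq_one_sub hq, h']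
  refine ⟨(hm p hp).aemeasurable, (hm q hq).aemeasurable, Measure.ext fun s hs => ?_⟩
  rw [Measure.map_apply (hm p hp) hs, Measure.map_apply (hm q hq) hs]
  have hpre (r : Ω → Prop) [DecidablePred r] :
      (fun ω => (if r ω then (1 : ℝ) else 0) - a) ⁻¹' s
        = {ω | (r ω ∧ 1 - a ∈ s) ∨ (¬ r ω ∧ -a ∈ s)} := by
    ext ω
    by_cases hr : r ω <;> simp [hr]
  rw [hpre p, hpre q]
  by_cases h1 : 1 - a ∈ s <;> by_cases h0 : -a ∈ s
  · simp [h1, h0, em]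
  · simpa [h1, h0] using h'
  · simpa [h1, h0, Set.compl_ofPred] using hc
  · simp [h1, h0]

/-- The frequency of atypical indices for random variables that are bounded above. -/
theorem sum_not_backwardBounded_le_of_le {Y : ℕ → Ω → ℝ} (hY : ∀ i, Measurable (Y i))
    (hind : iIndepFun Y μ) (hid : ∀ i, IdentDistrib (Y i) (Y 0) μ μ) (hint : Integrable (Y 0) μ)
    {x e θ C B s V : ℝ} (hint2 : Integrable (fun ω => Y 0 ω ^ 2) μ ∧ ∫ ω, Y 0 ω ^ 2 ∂μ ≤ s)
    (hmean : ∫ ω, Y 0 ω ∂μ = 0) (hx : 0 ≤ x) (he : 0 < e) (hθ : 0 < θ) (hθ1 : θ ≤ 1)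
    (hB : 0 ≤ B) (hYB : ∀ᵐ ω ∂μ, Y 0 ω ≤ B) (hC : s * Real.exp B ≤ C)
    (hθC : θ * C ≤ e / 4) (hθe : θ * e ≤ 4) (hV : 0 ≤ V) (J : ℕ) :
    ∑ m ∈ Finset.range J, μ.real {ω | ¬ BackwardBounded (fun i => Y i ω) x e m}
      ≤ J * (4 * Real.exp (-(θ * x)) + 10 / e * V) + 8 / (θ * e) := by
  have h1 : ∫ ω, (if Y 0 ω ≤ B then Y 0 ω ^ 2 * Real.exp (θ * max (Y 0 ω) 0) else 0) ∂μ ≤ C := by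
    refine le_trans ?_ hC
    have hm : Measurable fun z : ℝ => if z ≤ B then z ^ 2 * Real.exp (θ * max z 0) else 0 :=
      Measurable.ite measurableSet_Iic (by fun_prop) measurable_const
    refine (integral_le_of_ae_le (hm.comp (hY 0)).aestronglyMeasurable
      (Eventually.of_forall fun ω => ?_) (g := fun ω => Y 0 ω ^ 2 * Real.exp B)
      (Eventually.of_forall fun ω => ?_) ⟨hint2.1.mul_const _, ?_⟩).2
    · simp only [Function.comp_apply]
      split_ifs
      · positivity
      · exact le_rfl
    · simp only [Function.comp_apply]
      split_ifs with h
      · refine mul_le_mul_of_nonneg_left (Real.exp_le_exp.2 ?_) (sq_nonneg _)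
        have h3 : max (Y 0 ω) 0 ≤ B := max_le h hB
        have h4 : 0 ≤ max (Y 0 ω) 0 := le_max_right _ _
        nlinarith
      · positivity
    · rw [integral_mul_const]
      exact mul_le_mul_of_nonneg_right hint2.2 (Real.exp_pos _).le
  have h2 := sum_not_backwardBounded_le hY hind hid hint hint2.1 hmean hx he hθ hB h1 hθC hθe J
  -- Truncation at the upper bound `B` removes nothing, so the tail term vanishes; `V` is added
  -- afterwards to give all sequences the same bound.
  have h3 : ∫ ω, (if Y 0 ω ≤ B then 0 else Y 0 ω) ∂μ = 0 := by
    refine integral_eq_zero_of_ae ?_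
    filter_upwards [hYB] with ω hω
    rw [if_pos hω]; rfl
  rw [h3, mul_zero, add_zero] at h2
  have h4 : (J : ℝ) * (4 * Real.exp (-(θ * x)))
      ≤ J * (4 * Real.exp (-(θ * x)) + 10 / e * V) :=
    mul_le_mul_of_nonneg_left (by linarith [show 0 ≤ 10 / e * V by positivity])
      (Nat.cast_nonneg J)
  linarith

end Probability

/-! ### Rarity of atypical indices from moments -/

namespace Network

variable {K : ℕ} {P : Matrix (Fin K) (Fin K) ℝ} {Ω : Type u} [MeasurableSpace Ω] {Pr : Measure Ω}

theorem mean_le_one_add [IsProbabilityMeasure Pr] {Y : Ω → ℝ} {m₂ : ℝ} (hY : Integrable Y Pr)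
    (h : Integrable (fun ω => Y ω ^ 2) Pr ∧ ∫ ω, Y ω ^ 2 ∂Pr ≤ m₂) : ∫ ω, Y ω ∂Pr ≤ 1 + m₂ := by
  have h1 := integral_add_le_add (integral_const_le (μ := Pr) 1) h
  refine (integral_mono hY h1.1 fun ω => ?_).trans h1.2
  nlinarith [sq_nonneg (Y ω - 1)]

/-- Second moment of a centred nonnegative random variable. -/
theorem integral_sq_sub_mean_le [IsProbabilityMeasure Pr] {Y : Ω → ℝ} {m₂ : ℝ}
    (hY0 : ∀ᵐ ω ∂Pr, 0 ≤ Y ω) (hY : Integrable Y Pr)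
    (h : Integrable (fun ω => Y ω ^ 2) Pr ∧ ∫ ω, Y ω ^ 2 ∂Pr ≤ m₂) :
    Integrable (fun ω => (Y ω - ∫ ω', Y ω' ∂Pr) ^ 2) Pr ∧
      ∫ ω, (Y ω - ∫ ω', Y ω' ∂Pr) ^ 2 ∂Pr ≤ 2 * (1 + m₂) ^ 2 := by
  have ha0 : 0 ≤ ∫ ω', Y ω' ∂Pr := integral_nonneg_of_ae hY0
  have ha1 := mean_le_one_add hY h
  have hm₂ : 0 ≤ m₂ := (integral_nonneg fun ω => sq_nonneg _).trans h.2
  set a := ∫ ω', Y ω' ∂Pr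
  have h1 := integral_le_of_ae_le (f := fun ω => (Y ω - a) ^ 2)
    ((hY.1.sub aestronglyMeasurable_const).pow 2) (Eventually.of_forall fun ω => sq_nonneg _)
    (g := fun ω => a ^ 2 + Y ω ^ 2) (by
      filter_upwards [hY0] with ω hω
      nlinarith [mul_nonneg ha0 hω]) (integral_add_le_add (integral_const_le (a ^ 2)) h)
  exact ⟨h1.1, h1.2.trans (by nlinarith)⟩

/-- Atypical blocks are rare if the service times have suitable truncated moments. -/
theorem rareAtypical_of_moments [IsProbabilityMeasure Pr] (N : Network P Pr)
    {x e θ y C V m₂ : ℝ}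
    (hξ2 : ∀ k, Integrable (fun ω => N.ξ k 1 ω ^ 2) Pr ∧ ∫ ω, N.ξ k 1 ω ^ 2 ∂Pr ≤ m₂)
    (hη2 : ∀ k, Integrable (fun ω => N.η k 1 ω ^ 2) Pr ∧ ∫ ω, N.η k 1 ω ^ 2 ∂Pr ≤ m₂)
    (hx : 0 ≤ x) (he : 0 < e) (he4 : e ≤ 4) (hθ : 0 < θ) (hθ1 : θ ≤ 1) (hy : 1 + m₂ ≤ y)
    (hm₂ : 0 ≤ m₂) (hC : 2 * (1 + m₂) ^ 2 * Real.exp (1 + m₂) ≤ C)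
    (hsvc : ∀ k, Integrable (fun ω => if N.η k 1 ω ≤ 2 * y then
        (N.η k 1 ω ^ 2 + (1 + m₂) ^ 2) * Real.exp (θ * N.η k 1 ω) else 0) Pr ∧
      ∫ ω, (if N.η k 1 ω ≤ 2 * y then
        (N.η k 1 ω ^ 2 + (1 + m₂) ^ 2) * Real.exp (θ * N.η k 1 ω) else 0) ∂Pr ≤ C)
    (htail : ∀ k, ∫ ω, (if N.η k 1 ω ≤ y then 0 else N.η k 1 ω) ∂Pr ≤ V) (hV : 0 ≤ V)
    (hθC : θ * C ≤ e / 4) :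
    N.RareAtypical x e (4 * Real.exp (-(θ * x)) + 10 / e * V) (8 / (θ * e)) := by
  have hθe : θ * e ≤ 4 := by nlinarith
  have hy0 : 0 ≤ y := by linarith
  have hsub (a : ℝ) : Measurable fun z : ℝ => a - z := by fun_prop
  have hsub' (a : ℝ) : Measurable fun z : ℝ => z - a := by fun_prop
  refine ⟨fun k => ?_, fun k => ?_, fun k => ?_, fun k l => ?_⟩
  -- Only arrivals that come too fast matter, and `a - ξ` is bounded above by the mean `a ≤ 1 + m₂`.
  · set a := ∫ ω', N.ξ k 1 ω' ∂Pr with ha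
    refine sum_not_backwardBounded_le_of_le (Y := fun i ω => a - N.ξ k (i + 1) ω)
      (fun i => (hsub a).comp (N.measurable_ξ k _))
      ((N.iIndepFun_arr k).comp (fun _ z => a - z) fun _ => hsub a)
      (fun i => (N.ξ_ident k i).comp (hsub a)) ((integrable_const a).sub (N.ξ_integrable k))
      (s := 2 * (1 + m₂) ^ 2) (B := 1 + m₂) ?_ ?_ hx he hθ hθ1 (by linarith) ?_ hC hθC hθe hV
    · have h := integral_sq_sub_mean_le (N.ξ_nonneg k 1) (N.ξ_integrable k) (hξ2 k)
      simp only [zero_add]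
      simpa only [← neg_sub a, neg_sq, ← ha] using h
    · simp only [zero_add]
      rw [integral_sub (integrable_const a) (N.ξ_integrable k)]
      simp [ha]
    · filter_upwards [N.ξ_nonneg k 1] with ω hω
      simp only [zero_add]
      linarith [mean_le_one_add (N.ξ_integrable k) (hξ2 k)]
  · set a := ∫ ω', N.η k 1 ω' ∂Pr with ha
    refine sum_not_backwardBounded_le_of_le (Y := fun i ω => a - N.η k (i + 1) ω)
      (fun i => (hsub a).comp (N.measurable_η k _))
      ((N.iIndepFun_svc k).comp (fun _ z => a - z) fun _ => hsub a)
      (fun i => (N.η_ident k i).comp (hsub a)) ((integrable_const a).sub (N.η_integrable k))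
      (s := 2 * (1 + m₂) ^ 2) (B := 1 + m₂) ?_ ?_ hx he hθ hθ1 (by linarith) ?_ hC hθC hθe hV
    · have h := integral_sq_sub_mean_le (N.η_nonneg k 1) (N.η_integrable k) (hη2 k)
      simp only [zero_add]
      simpa only [← neg_sub a, neg_sq, ← ha] using h
    · simp only [zero_add]
      rw [integral_sub (integrable_const a) (N.η_integrable k)]
      simp [ha]
    · filter_upwards [N.η_nonneg k 1] with ω hω
      simp only [zero_add]
      linarith [mean_le_one_add (N.η_integrable k) (hη2 k)]
  -- Slow services are the one deviation unbounded above. On `η - a ≤ y` one has `η ≤ 2 * y`, since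
  -- `a ≤ 1 + m₂ ≤ y`; this is the source of the `2 * y` in the moment condition.
  · intro J
    set a := ∫ ω', N.η k 1 ω' ∂Pr with ha
    have ha0 : 0 ≤ a := (N.η_mean_pos k).le
    have ha1 : a ≤ 1 + m₂ := mean_le_one_add (N.η_integrable k) (hη2 k)
    have hmeas : Measurable fun z : ℝ =>
        if z - a ≤ y then (z - a) ^ 2 * Real.exp (θ * max (z - a) 0) else 0 :=
      Measurable.ite (measurableSet_le (by fun_prop) measurable_const) (by fun_prop)
        measurable_const
    have hC' : ∫ ω, (if N.η k 1 ω - a ≤ y then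
        (N.η k 1 ω - a) ^ 2 * Real.exp (θ * max (N.η k 1 ω - a) 0) else 0) ∂Pr ≤ C := by
      refine (integral_le_of_ae_le (hmeas.comp (N.measurable_η k 1)).aestronglyMeasurable
        (Eventually.of_forall fun ω => ?_) ?_ (hsvc k)).2
      · simp only [Function.comp_apply]
        split_ifs
        · positivity
        · exact le_rfl
      · filter_upwards [N.η_nonneg k 1] with ω hω
        simp only [Function.comp_apply]
        split_ifs with h1 h2 h2
        · have h3 : (N.η k 1 ω - a) ^ 2 ≤ N.η k 1 ω ^ 2 + (1 + m₂) ^ 2 := by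
            nlinarith [mul_nonneg hω ha0]
          have h4 : max (N.η k 1 ω - a) 0 ≤ N.η k 1 ω := max_le (by linarith) hω
          gcongr
        · linarith
        · positivity
        · exact le_rfl
    have h := sum_not_backwardBounded_le (Y := fun i ω => N.η k (i + 1) ω - a) (μ := Pr)
      (fun i => (hsub' a).comp (N.measurable_η k _))
      ((N.iIndepFun_svc k).comp (fun _ z => z - a) fun _ => hsub' a)
      (fun i => (N.η_ident k i).comp (hsub' a)) ((N.η_integrable k).sub (integrable_const a))
      (integral_sq_sub_mean_le (N.η_nonneg k 1) (N.η_integrable k) (hη2 k)).1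
      (by
        simp only [zero_add]
        rw [integral_sub (N.η_integrable k) (integrable_const a)]
        simp [ha]) hx he hθ hy0 hC' hθC hθe J
    refine h.trans ?_
    have hmv : Measurable fun z : ℝ => if z - a ≤ y then 0 else z - a :=
      Measurable.ite (measurableSet_le (by fun_prop) measurable_const) measurable_const
        (by fun_prop)
    have hmv' : Measurable fun z : ℝ => if z ≤ y then 0 else z :=
      Measurable.ite measurableSet_Iic measurable_const measurable_id
    have hti : Integrable (fun ω => if N.η k 1 ω ≤ y then 0 else N.η k 1 ω) Pr := by
      refine (N.η_integrable k).mono (hmv'.comp (N.measurable_η k 1)).aestronglyMeasurable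
        (Eventually.of_forall fun ω => ?_)
      split_ifs <;> simp
    have hVle : ∫ ω, (if N.η k (0 + 1) ω - a ≤ y then 0 else N.η k (0 + 1) ω - a) ∂Pr ≤ V := by
      refine (integral_le_of_ae_le (hmv.comp (N.measurable_η k 1)).aestronglyMeasurable
        (Eventually.of_forall fun ω => ?_) ?_ ⟨hti, htail k⟩).2
      · simp only [Function.comp_apply]
        split_ifs
        · exact le_rfl
        · linarith
      · filter_upwards [N.η_nonneg k 1] with ω hω
        simp only [Function.comp_apply]
        split_ifs <;> linarith
    have := mul_le_mul_of_nonneg_left hVle (show 0 ≤ 10 / e by positivity)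
    have := mul_le_mul_of_nonneg_left this (Nat.cast_nonneg (α := ℝ) J)
    linarith
  · have hp0 := N.routing_nonneg k l
    have hp1 := N.routing_le_one k l
    have hm : Measurable fun z : Fin (K + 1) => (if z = l.succ then (1 : ℝ) else 0) - P k l :=
      measurable_from_top
    have hbd (ω : Ω) : |(if N.ζ k 0 ω = l.succ then (1 : ℝ) else 0) - P k l| ≤ 1 := by
      rw [abs_le]
      split_ifs <;> constructor <;> linarith
    have hset (i : ℕ) : MeasurableSet {ω | N.ζ k i ω = l.succ} :=
      N.measurable_ζ k i (MeasurableSet.singleton _)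
    have hmean (i : ℕ) : ∫ ω, ((if N.ζ k i ω = l.succ then (1 : ℝ) else 0) - P k l) ∂Pr = 0 := by
      have h1 : (fun ω => if N.ζ k i ω = l.succ then (1 : ℝ) else 0)
          = {ω | N.ζ k i ω = l.succ}.indicator fun _ => 1 := by
        funext ω; simp [Set.indicator_apply]
      rw [integral_sub (by rw [h1]; exact (integrable_const (1 : ℝ)).indicator (hset i))
        (integrable_const _), h1, integral_indicator_const _ (hset i), N.routing_law k i l]
      simp
    have hint : Integrable (fun ω => (if N.ζ k 0 ω = l.succ then (1 : ℝ) else 0) - P k l) Pr :=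
      (integrable_const (1 : ℝ)).mono' (N.measurable_routeDev k l 0).aestronglyMeasurable
        (Eventually.of_forall hbd)
    have hid (i : ℕ) : IdentDistrib
        (fun ω => (if N.ζ k i ω = l.succ then (1 : ℝ) else 0) - P k l)
        (fun ω => (if N.ζ k 0 ω = l.succ then (1 : ℝ) else 0) - P k l) Pr Pr :=
      identDistrib_ite_sub (hset i) (hset 0)
        (by rw [N.routing_law k i l, N.routing_law k 0 l])
    refine sum_not_backwardBounded_le_of_le
      (Y := fun i ω => (if N.ζ k i ω = l.succ then (1 : ℝ) else 0) - P k l)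
      (fun i => N.measurable_routeDev k l i)
      ((N.iIndepFun_route k).comp
        (fun _ (z : Fin (K + 1)) => (if z = l.succ then (1 : ℝ) else 0) - P k l) fun _ => hm)
      hid hint (s := 1) (B := 1)
      (integral_le_of_ae_le ((N.measurable_routeDev k l 0).pow_const 2).aestronglyMeasurable
        (Eventually.of_forall fun ω => sq_nonneg _)
        (Eventually.of_forall fun ω => by
          have := abs_le.1 (hbd ω)
          exact (sq_le_one_iff_abs_le_one _).2 (hbd ω)) (integral_const_le 1))
      (hmean 0) hx he hθ hθ1 zero_le_one
      (Eventually.of_forall fun ω => (abs_le.1 (hbd ω)).2) (le_trans ?_ hC) hθC hθe hV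
    have h1 : Real.exp 1 ≤ Real.exp (1 + m₂) := Real.exp_le_exp.2 (by linarith)
    have h2 : 1 ≤ 2 * (1 + m₂) ^ 2 := by nlinarith
    exact mul_le_mul h2 h1 (Real.exp_pos _).le (by positivity)

end Network

/-! ### Uniform tail bounds -/

namespace Network

variable {K : ℕ} {P : Matrix (Fin K) (Fin K) ℝ} {Ω : Type u} [MeasurableSpace Ω] {Pr : Measure Ω}

/-- Bounds on the second moments, and on the truncated exponential moments and the tails of the
service times. -/
structure HasMomentBounds (N : Network P Pr) (m₂ θ y C V : ℝ) : Prop where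
  arr_sq : ∀ k, Integrable (fun ω => N.ξ k 1 ω ^ 2) Pr ∧ ∫ ω, N.ξ k 1 ω ^ 2 ∂Pr ≤ m₂
  svc_sq : ∀ k, Integrable (fun ω => N.η k 1 ω ^ 2) Pr ∧ ∫ ω, N.η k 1 ω ^ 2 ∂Pr ≤ m₂
  svc_exp : ∀ k, Integrable (fun ω => if N.η k 1 ω ≤ 2 * y then
      (N.η k 1 ω ^ 2 + (1 + m₂) ^ 2) * Real.exp (θ * N.η k 1 ω) else 0) Pr ∧
    ∫ ω, (if N.η k 1 ω ≤ 2 * y then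
      (N.η k 1 ω ^ 2 + (1 + m₂) ^ 2) * Real.exp (θ * N.η k 1 ω) else 0) ∂Pr ≤ C
  svc_tail : ∀ k, ∫ ω, (if N.η k 1 ω ≤ y then 0 else N.η k 1 ω) ∂Pr ≤ V

/-- A tail bound for the queue lengths of stationary networks, uniform over networks with given
bounds on the rates and the second moments. -/
theorem exists_measureReal_queue_le (hP : spectralRadius ℂ (P.map (fun x : ℝ => (x : ℂ))) < 1)
    {L m₂ : ℝ} (hL : 1 ≤ L) (hm₂ : 0 ≤ m₂) (k : Fin K) :
    ∃ A : ℝ, 1 ≤ A ∧ ∀ (Ω : Type u) [MeasurableSpace Ω] (Pr : Measure Ω) [IsProbabilityMeasure Pr]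
      (N : Network P Pr), N.Stationary → (∀ k, N.arrRate k ≤ L) → (∀ k, N.svcRate k ≤ L) →
      ∀ κ x θ y C V : ℝ, 0 < κ → κ ≤ 1 →
      (∀ k, Matrix.mulVec (1 - P.transpose)⁻¹ (fun l => N.arrRate l + κ) k < N.svcRate k) →
      1 ≤ x → 0 < θ → θ ≤ 1 → 1 + m₂ ≤ y → 0 ≤ V → A ≤ C → θ * (C * A) ≤ κ →
      N.HasMomentBounds m₂ θ y C V →
      Pr.real {ω | A * x < N.Q k 0 ω} ≤ A * √(Real.exp (-(θ * x)) + V / κ) := by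
  by_cases hP0 : ∀ i j, 0 ≤ P i j
  swap
  · exact ⟨1, le_rfl, fun Ω _ Pr _ N => absurd N.routing_nonneg hP0⟩
  -- A negative entry of `P` excludes any network. From here on `I - Pᵀ` is inverse-positive and `w`
  -- converts a bound on `z - Pᵀ z` into one on `z`.
  set w : Fin K → ℝ := Matrix.mulVec (1 - P.transpose)⁻¹ (fun _ => 1)
  have hw (j : Fin K) : w j - ∑ l, P l j * w l = 1 := inv_mulVec_sub_sum hP0 hP _ j
  have hw0 : 1 ≤ w k := by
    have := sub_sum_le_of_nonneg hP0 hP (z := w) (fun j => by rw [hw]; exact zero_le_one) k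
    rwa [hw] at this
  have hK : 1 ≤ (K : ℝ) := by
    have : 1 ≤ K := Nat.one_le_of_lt k.2
    exact_mod_cast this
  obtain ⟨B, hB⟩ : ∃ B : ℝ, B = (L + 1) * K * (4 * K + 13 + 6 * m₂) := ⟨_, rfl⟩
  have hB1 : 1 ≤ B := by
    rw [hB]
    have h1 : 1 ≤ (L + 1) * K := one_le_mul_of_one_le_of_one_le (by linarith) hK
    exact one_le_mul_of_one_le_of_one_le h1 (by linarith)
  obtain ⟨c, hc⟩ : ∃ c : ℝ, c = 12 * ((K : ℝ) + 1) * L ^ 2 := ⟨_, rfl⟩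
  have hL2 : 1 ≤ L ^ 2 := one_le_pow₀ hL
  have hc1 : 24 * L ^ 2 ≤ c := by nlinarith
  have hc0 : 0 < c := by linarith
  -- The summands serve, in order, the condition `θ * C ≤ e / 4`, the comparison of `B * √p` with
  -- the claimed bound, the moment constant of the bounded sequences, and the level of the queue.
  obtain ⟨A, hA⟩ : ∃ A : ℝ, A = 4 * c + 10 * c * B + 2 * (1 + m₂) ^ 2 * Real.exp (1 + m₂)
    + (6 * (K + 1) * L ^ 2 + 1) * w k := ⟨_, rfl⟩
  have hE0 : 0 ≤ 2 * (1 + m₂) ^ 2 * Real.exp (1 + m₂) := by positivity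
  have hW0 : 0 ≤ (6 * (K + 1) * L ^ 2 + 1) * w k := by positivity
  have hcB : 0 ≤ 10 * c * B := by positivity
  have hA4c : 4 * c ≤ A := by linarith
  have hAcB : 10 * c * B ≤ A := by linarith
  have hA0 : 0 ≤ A := by linarith
  refine ⟨A, by linarith, fun Ω _ Pr _ N hN hlam hmu κ x θ y C V hκ hκ1 hdrift hx hθ hθ1 hy hV hAC
    hθC hm => ?_⟩
  -- With this slope the fluid error `6 * (K + 1) * L ^ 2 * e` is exactly half the drift `κ`.
  set e := κ / c with he
  have he0 : 0 < e := by positivity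
  have hec : e * c = κ := div_mul_cancel₀ _ hc0.ne'
  have he1 : e ≤ 1 / 24 := by
    rw [he, div_le_iff₀ hc0]; linarith
  have hrare := N.rareAtypical_of_moments (x := x) (e := e) hm.arr_sq hm.svc_sq (by linarith) he0
    (by linarith) hθ hθ1 hy hm₂ (by linarith) hm.svc_exp hm.svc_tail hV (by
      have hC0 : 0 ≤ C := hA0.trans hAC
      have : θ * C * (4 * c) ≤ θ * C * A := mul_le_mul_of_nonneg_left hA4c (by positivity)
      rw [he, div_div, le_div_iff₀ (by positivity)]
      linarith)
  set p := 4 * Real.exp (-(θ * x)) + 10 / e * V with hp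
  have hp0 : 0 < p := by positivity
  have hpe : B * √p ≤ A * √(Real.exp (-(θ * x)) + V / κ) := by
    have h1 : p ≤ (10 * c) * (Real.exp (-(θ * x)) + V / κ) := by
      have : 10 / e * V = 10 * c * (V / κ) := by
        rw [he]; field_simp
      rw [hp, this]
      have := mul_le_mul_of_nonneg_right (show 4 ≤ 10 * c by linarith)
        (Real.exp_pos (-(θ * x))).le
      linarith
    have h10 : √(10 * c) ≤ 10 * c := Real.sqrt_le_iff.2
      ⟨by positivity, le_self_pow₀ (by linarith) two_ne_zero⟩
    have hBA : B * √(10 * c) ≤ A := by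
      have := mul_le_mul_of_nonneg_left h10 (show 0 ≤ B by linarith)
      linarith
    calc B * √p ≤ B * √((10 * c) * (Real.exp (-(θ * x)) + V / κ)) := by gcongr
      _ = B * √(10 * c) * √(Real.exp (-(θ * x)) + V / κ) := by
        rw [Real.sqrt_mul (by positivity), mul_assoc]
      _ ≤ A * √(Real.exp (-(θ * x)) + V / κ) := by
        gcongr
  refine le_trans ?_ hpe
  -- If `p > 1` the claimed bound exceeds one, because `B ≥ 1`.
  rcases lt_or_ge 1 p with hp1 | hp1
  · have : 1 ≤ √p := Real.one_le_sqrt.2 hp1.le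
    exact measureReal_le_one.trans (one_le_mul_of_one_le_of_one_le hB1 this)
  · rw [hB]
    refine le_trans (measureReal_mono ?_) (N.measureReal_queue_le hN hP hL hlam hmu hdrift hκ
      (inv_mulVec_sub_sum hP0 hP _) hw hx he0.le ?_ ?_ hm.arr_sq hm.svc_sq hp0 hp1 hrare k)
    · intro ω hω
      simp only [Set.mem_ofPred_eq] at hω ⊢
      refine lt_of_le_of_lt ?_ hω
      have : (6 * (K + 1) * L ^ 2 + 1) * w k ≤ A := by linarith
      have := mul_le_mul_of_nonneg_right this (show 0 ≤ x by linarith)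
      linarith
    · have h1 : e * (24 * L ^ 2) ≤ e * c := mul_le_mul_of_nonneg_left hc1 he0.le
      have h2 : e * L ≤ e * L ^ 2 :=
        mul_le_mul_of_nonneg_left (le_self_pow₀ hL two_ne_zero) he0.le
      linarith
    · rw [← hec, hc]; apply le_of_eq; ring

/-- The tail bound of `exists_measureReal_queue_le`, for a scaled queue length at any time. -/
theorem exists_measure_scaled_queue_le
    (hP : spectralRadius ℂ (P.map (fun x : ℝ => (x : ℂ))) < 1)
    {L m₂ : ℝ} (hL : 1 ≤ L) (hm₂ : 0 ≤ m₂) (k : Fin K) :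
    ∃ A : ℝ, 1 ≤ A ∧ ∀ (Ω : Type u) [MeasurableSpace Ω] (Pr : Measure Ω) [IsProbabilityMeasure Pr]
      (N : Network P Pr), N.Stationary → (∀ k, N.arrRate k ≤ L) → (∀ k, N.svcRate k ≤ L) →
      ∀ κ u s t θ y C V : ℝ, 0 < κ → κ ≤ 1 →
      (∀ k, Matrix.mulVec (1 - P.transpose)⁻¹ (fun l => N.arrRate l + κ) k < N.svcRate k) →
      0 < s → 0 ≤ t → 2 * A ≤ u * s → 0 < θ → θ ≤ 1 → 1 + m₂ ≤ y → 0 ≤ V → A ≤ C →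
      θ * (C * A) ≤ κ → N.HasMomentBounds m₂ θ y C V →
      Pr {ω | u ≤ (N.Q k t ω : ℝ) / s}
        ≤ ENNReal.ofReal (A * √(Real.exp (-(θ * (u * s / (2 * A)))) + V / κ)) := by
  obtain ⟨A, hA, h⟩ := exists_measureReal_queue_le hP hL hm₂ k
  refine ⟨A, hA, fun Ω _ Pr _ N hN hlam hmu κ u s t θ y C V hκ hκ1 hdrift hs ht hus hθ hθ1 hy hV hAC
    hθC hm => ?_⟩
  have hA0 : 0 < A := by linarith
  have hx : 1 ≤ u * s / (2 * A) := (one_le_div (by positivity)).2 hus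
  refine le_trans ?_ (ENNReal.ofReal_le_ofReal
    (h Ω Pr N hN hlam hmu κ _ θ y C V hκ hκ1 hdrift hx hθ hθ1 hy hV hAC hθC hm))
  rw [ofReal_measureReal]
  refine (hN.measure_queue_eq k ht {q | u ≤ (q : ℝ) / s}).le.trans ?_
  refine measure_mono fun ω hω => ?_
  simp only [Set.mem_ofPred_eq] at hω ⊢
  rw [le_div_iff₀ hs] at hω
  -- Taking half the level turns the event with `≤` into the one with strict inequality.
  have : A * (u * s / (2 * A)) = u * s / 2 := by field_simp
  rw [this]
  linarith

end Network

/-! ### Limits -/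

section Limits

theorem tendsto_limsup_zero {f : ℝ → ℕ → ENNReal} {h : ℝ → ℝ}
    (hf : ∀ᶠ u in atTop, ∀ᶠ n in atTop, f u n ≤ ENNReal.ofReal (h u))
    (hh : Tendsto h atTop (𝓝 0)) :
    Tendsto (fun u => limsup (f u) atTop) atTop (𝓝 0) := by
  have h' : Tendsto (fun u => ENNReal.ofReal (h u)) atTop (𝓝 0) := by
    simpa using ENNReal.tendsto_ofReal hh
  refine tendsto_of_tendsto_of_tendsto_of_le_of_le' tendsto_const_nhds h'
    (Eventually.of_forall fun _ => zero_le) ?_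
  filter_upwards [hf] with u hu
  exact limsup_le_of_le (h := hu)

/-- The factor `2` in the exponents is consumed by the square root; the prefactor is at least one,
so its power with exponent `1 / v ≤ 1` does not exceed it. -/
theorem rpow_one_div_le_of_le_sqrt {q : ENNReal} {A M c v E W : ℝ} (hA : 1 ≤ A) (hM : 0 ≤ M)
    (hv : 1 ≤ v) (hE : E ≤ Real.exp (-(2 * c * v))) (hW : W ≤ M * Real.exp (-(2 * c * v)))
    (hq : q ≤ ENNReal.ofReal (A * √(E + W))) :
    q ^ (1 / v) ≤ ENNReal.ofReal (A * √(1 + M) * Real.exp (-c)) := by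
  have hv0 : 0 < v := by linarith
  set D := A * √(1 + M) with hD
  have hD1 : 1 ≤ D := one_le_mul_of_one_le_of_one_le hA (Real.one_le_sqrt.2 (by linarith))
  have h1 : A * √(E + W) ≤ D * Real.exp (-(c * v)) := by
    have h2 : E + W ≤ (1 + M) * Real.exp (-(c * v)) ^ 2 := by
      have : Real.exp (-(c * v)) ^ 2 = Real.exp (-(2 * c * v)) := by
        rw [← Real.exp_nat_mul]; congr 1; push_cast; ring
      rw [this]; linarith
    calc A * √(E + W) ≤ A * √((1 + M) * Real.exp (-(c * v)) ^ 2) := by gcongr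
      _ = D * Real.exp (-(c * v)) := by
        rw [Real.sqrt_mul (by linarith), Real.sqrt_sq (Real.exp_pos _).le, hD]; ring
  calc q ^ (1 / v) ≤ ENNReal.ofReal (D * Real.exp (-(c * v))) ^ (1 / v) :=
        ENNReal.rpow_le_rpow (hq.trans (ENNReal.ofReal_le_ofReal h1)) (by positivity)
    _ = ENNReal.ofReal ((D * Real.exp (-(c * v))) ^ (1 / v)) :=
        ENNReal.ofReal_rpow_of_nonneg (by positivity) (by positivity)
    _ ≤ ENNReal.ofReal (D * Real.exp (-c)) := by
        refine ENNReal.ofReal_le_ofReal ?_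
        rw [Real.mul_rpow (by positivity) (Real.exp_pos _).le, ← Real.exp_mul]
        have h3 : D ^ (1 / v) ≤ D := by
          have := Real.rpow_le_rpow_of_exponent_le hD1 (show 1 / v ≤ 1 by
            rw [div_le_one hv0]; exact hv)
          rwa [Real.rpow_one] at this
        have h4 : -(c * v) * (1 / v) = -c := by field_simp
        rw [h4]
        gcongr

theorem tendsto_limsup_rpow_zero {q : ℝ → ℕ → ENNReal} {v : ℕ → ℝ} {E W : ℝ → ℕ → ℝ} {A M c : ℝ}
    (hA : 1 ≤ A) (hM : 0 ≤ M) (hc : 0 < c) (hv : ∀ᶠ n in atTop, 1 ≤ v n)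
    (h : ∀ᶠ u in atTop, ∀ᶠ n in atTop, E u n ≤ Real.exp (-(2 * (c * u) * v n)) ∧
      W u n ≤ M * Real.exp (-(2 * (c * u) * v n)) ∧
      q u n ≤ ENNReal.ofReal (A * √(E u n + W u n))) :
    Tendsto (fun u => limsup (fun n => q u n ^ (1 / v n)) atTop) atTop (𝓝 0) := by
  refine tendsto_limsup_zero (h := fun u => A * √(1 + M) * Real.exp (-(c * u))) ?_ ?_
  · filter_upwards [h] with u hu
    filter_upwards [hu, hv] with n hn hvn
    exact rpow_one_div_le_of_le_sqrt hA hM hvn hn.1 hn.2.1 hn.2.2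
  · have : Tendsto (fun u : ℝ => Real.exp (-(c * u))) atTop (𝓝 0) :=
      Real.tendsto_exp_neg_atTop_nhds_zero.comp (tendsto_id.const_mul_atTop hc)
    simpa using this.const_mul (A * √(1 + M))

theorem exists_pos_le_one_forall_le {ι : Type*} [Finite ι] {f : ι → ℝ} (hf : ∀ i, 0 < f i) :
    ∃ c : ℝ, 0 < c ∧ c ≤ 1 ∧ ∀ i, c ≤ f i := by
  have h1 : ∀ᶠ c : ℝ in 𝓝[>] 0, ∀ i, c ≤ f i := eventually_all.2 fun i =>
    (eventually_le_nhds (hf i)).filter_mono nhdsWithin_le_nhds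
  have h2 : ∀ᶠ c : ℝ in 𝓝[>] 0, c ≤ 1 :=
    (eventually_le_nhds one_pos).filter_mono nhdsWithin_le_nhds
  obtain ⟨c, ⟨h1, h2⟩, h3⟩ := ((h1.and h2).and self_mem_nhdsWithin).exists
  exact ⟨c, h3, h2, h1⟩

theorem exists_eventually_forall_le {ι : Type*} [Fintype ι] {v : ℕ → ι → ℝ} {a : ι → ℝ}
    (h : Tendsto v atTop (𝓝 a)) : ∃ L : ℝ, 1 ≤ L ∧ ∀ᶠ n in atTop, ∀ i, v n i ≤ L := by
  refine ⟨‖a‖ + 1, by linarith [norm_nonneg a], ?_⟩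
  filter_upwards [h.norm.eventually (eventually_le_nhds (lt_add_one ‖a‖))] with n hn i
  exact (le_abs_self _).trans ((norm_le_pi_norm (v n) i).trans hn)

/-- Half of the stretched exponential pays for the polynomial: for `z ≥ 1` and `m ≥ 2 / β`, `z ^ 2 ≤
(z ^ β) ^ m`, and the exponential series bounds this power. -/
theorem exists_sq_mul_exp_le {α β c : ℝ} (hα : 0 < α) (hβ : 0 < β) (hc : 0 ≤ c) :
    ∃ D : ℝ, 0 ≤ D ∧ ∀ z : ℝ, 0 ≤ z →
      (z ^ 2 + z + c) * Real.exp (α / 2 * z ^ β) ≤ D * Real.exp (α * z ^ β) := by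
  obtain ⟨m, hm⟩ := exists_nat_ge (2 / β)
  set F : ℝ := (m.factorial : ℝ) * (2 / α) ^ m with hF
  have hF0 : 0 ≤ F := by positivity
  refine ⟨(2 + c) * (1 + F), by positivity, fun z hz => ?_⟩
  have hz0 : 0 ≤ α / 2 * z ^ β := by positivity
  have hexp : Real.exp (α * z ^ β) = Real.exp (α / 2 * z ^ β) * Real.exp (α / 2 * z ^ β) := by
    rw [← Real.exp_add]; congr 1; ring
  have h1 := Real.one_le_exp hz0
  have key : z ^ 2 + z + c ≤ (2 + c) * (1 + F) * Real.exp (α / 2 * z ^ β) := by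
    rcases le_total z 1 with hz1 | hz1
    · have h2 : z ^ 2 + z + c ≤ 2 + c := by nlinarith
      have h3 : 1 ≤ (1 + F) * Real.exp (α / 2 * z ^ β) :=
        one_le_mul_of_one_le_of_one_le (by linarith) h1
      nlinarith
    · have h2 : z ^ 2 + z + c ≤ (2 + c) * z ^ 2 := by
        have := one_le_pow₀ (n := 2) hz1
        nlinarith
      have h3 : z ^ 2 ≤ F * Real.exp (α / 2 * z ^ β) := by
        have h4 := Real.pow_div_factorial_le_exp _ hz0 m
        have h5 : z ^ 2 ≤ (z ^ β) ^ m := by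
          rw [← Real.rpow_natCast, ← Real.rpow_natCast, ← Real.rpow_mul hz]
          refine Real.rpow_le_rpow_of_exponent_le hz1 ?_
          push_cast
          rw [div_le_iff₀ hβ] at hm
          linarith
        have h6 : F * ((α / 2 * z ^ β) ^ m / m.factorial) = (z ^ β) ^ m := by
          rw [hF, mul_pow (α / 2)]
          generalize z ^ β = w
          have : (2 / α) ^ m * (α / 2) ^ m = 1 := by
            rw [← mul_pow, div_mul_div_comm, mul_comm 2 α, div_self (by positivity), one_pow]
          have hfac : (m.factorial : ℝ) ≠ 0 := by positivity
          rw [mul_assoc, mul_div_assoc', mul_div_cancel₀ _ hfac, ← mul_assoc, this, one_mul]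
        calc z ^ 2 ≤ (z ^ β) ^ m := h5
          _ = F * ((α / 2 * z ^ β) ^ m / m.factorial) := h6.symm
          _ ≤ _ := by gcongr
      have h7 : z ^ 2 ≤ (1 + F) * Real.exp (α / 2 * z ^ β) := by
        nlinarith [Real.exp_pos (α / 2 * z ^ β)]
      calc _ ≤ _ := h2
        _ ≤ (2 + c) * ((1 + F) * Real.exp (α / 2 * z ^ β)) := by gcongr
        _ = _ := by ring
  rw [hexp, ← mul_assoc]
  gcongr

end Limits

/-! ### Truncated moments under each of the moment conditions -/

section Moments

theorem exists_forall_integral_le {ι : Type*} [Fintype ι] {Ω : ℕ → Type u}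
    [∀ n, MeasurableSpace (Ω n)] {Pr : ∀ n, Measure (Ω n)} {f : ∀ n, ι → Ω n → ℝ}
    (hf : ∀ n i, AEStronglyMeasurable (f n i) (Pr n)) (h0 : ∀ n i, ∀ᵐ ω ∂(Pr n), 0 ≤ f n i ω)
    (h : ∀ i, (⨆ n, ∫⁻ ω, ENNReal.ofReal (f n i ω) ∂(Pr n)) < ⊤) :
    ∃ m : ℝ, 0 ≤ m ∧ ∀ n i, Integrable (f n i) (Pr n) ∧ ∫ ω, f n i ω ∂(Pr n) ≤ m := by
  refine ⟨∑ i, (⨆ n, ∫⁻ ω, ENNReal.ofReal (f n i ω) ∂(Pr n)).toReal,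
    Finset.sum_nonneg fun _ _ => ENNReal.toReal_nonneg, fun n i => ?_⟩
  have h1 := integral_le_toReal_of_lintegral_le (hf n i) (h0 n i) (h i)
    (le_iSup (fun n => ∫⁻ ω, ENNReal.ofReal (f n i ω) ∂(Pr n)) n)
  exact ⟨h1.1, h1.2.trans (Finset.single_le_sum (f := fun i =>
    (⨆ n, ∫⁻ ω, ENNReal.ofReal (f n i ω) ∂(Pr n)).toReal)
    (fun _ _ => ENNReal.toReal_nonneg) (Finset.mem_univ i))⟩

variable {Ω : Type*} [MeasurableSpace Ω] {μ : Measure Ω} {Y : Ω → ℝ}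

theorem integral_ite_sq_mul_exp_le [IsProbabilityMeasure μ] {θ y m c : ℝ} (hY : Measurable Y) (hθ : 0 ≤ θ)
    (hθy : θ * (2 * y) ≤ 2) (hc : 0 ≤ c)
    (h2 : Integrable (fun ω => Y ω ^ 2) μ ∧ ∫ ω, Y ω ^ 2 ∂μ ≤ m) :
    Integrable (fun ω => if Y ω ≤ 2 * y then (Y ω ^ 2 + c) * Real.exp (θ * Y ω) else 0) μ ∧
      ∫ ω, (if Y ω ≤ 2 * y then (Y ω ^ 2 + c) * Real.exp (θ * Y ω) else 0) ∂μ
        ≤ Real.exp 2 * (m + c) := by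
  have hm : Measurable fun z : ℝ => if z ≤ 2 * y then (z ^ 2 + c) * Real.exp (θ * z) else 0 :=
    Measurable.ite measurableSet_Iic (by fun_prop) measurable_const
  refine integral_le_of_ae_le (hm.comp hY).aestronglyMeasurable (Eventually.of_forall fun ω => ?_)
    (Eventually.of_forall fun ω => ?_)
    (integral_const_mul_le_mul (integral_add_le_add h2 (integral_const_le c)) (Real.exp_pos 2).le)
  · split_ifs
    · positivity
    · exact le_rfl
  · split_ifs with h
    · rw [mul_comm]
      gcongr
      exact (mul_le_mul_of_nonneg_left h hθ).trans hθy
    · positivity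

theorem integral_ite_le_div_rpow {y m δ : ℝ} (hY : Measurable Y) (h0 : ∀ᵐ ω ∂μ, 0 ≤ Y ω)
    (hy : 0 < y) (hδ : 0 ≤ δ)
    (h2 : Integrable (fun ω => Y ω ^ (1 + δ)) μ ∧ ∫ ω, Y ω ^ (1 + δ) ∂μ ≤ m) :
    ∫ ω, (if Y ω ≤ y then 0 else Y ω) ∂μ ≤ (y ^ δ)⁻¹ * m := by
  have hm : Measurable fun z : ℝ => if z ≤ y then 0 else z :=
    Measurable.ite measurableSet_Iic measurable_const measurable_id
  refine (integral_le_of_ae_le (hm.comp hY).aestronglyMeasurable ?_ ?_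
    (integral_const_mul_le_mul h2 (by positivity : 0 ≤ (y ^ δ)⁻¹))).2
  · filter_upwards [h0] with ω hω
    simp only [Function.comp_apply]
    split_ifs
    · exact le_rfl
    · exact hω
  · filter_upwards [h0] with ω hω
    simp only [Function.comp_apply]
    split_ifs with h
    · positivity
    · push Not at h
      have hYp : 0 < Y ω := hy.trans h
      rw [Real.rpow_add hYp, Real.rpow_one, inv_mul_eq_div, le_div_iff₀ (by positivity)]
      gcongr

/-- The linear exponent `θ z` need only lie below `α / 2 * z ^ β` on the truncation range; for `β <
1` this ties `θ` to `y`. -/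
theorem integral_ite_sq_mul_exp_le_of_exp {θ y m c α β D : ℝ} (hY : Measurable Y)
    (h0 : ∀ᵐ ω ∂μ, 0 ≤ Y ω) (hc : 0 ≤ c) (hD : 0 ≤ D)
    (hθy : ∀ z, 0 ≤ z → z ≤ 2 * y → θ * z ≤ α / 2 * z ^ β)
    (hDz : ∀ z : ℝ, 0 ≤ z →
      (z ^ 2 + z + c) * Real.exp (α / 2 * z ^ β) ≤ D * Real.exp (α * z ^ β))
    (h2 : Integrable (fun ω => Real.exp (α * Y ω ^ β)) μ ∧
      ∫ ω, Real.exp (α * Y ω ^ β) ∂μ ≤ m) :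
    Integrable (fun ω => if Y ω ≤ 2 * y then (Y ω ^ 2 + c) * Real.exp (θ * Y ω) else 0) μ ∧
      ∫ ω, (if Y ω ≤ 2 * y then (Y ω ^ 2 + c) * Real.exp (θ * Y ω) else 0) ∂μ ≤ D * m := by
  have hm : Measurable fun z : ℝ => if z ≤ 2 * y then (z ^ 2 + c) * Real.exp (θ * z) else 0 :=
    Measurable.ite measurableSet_Iic (by fun_prop) measurable_const
  refine integral_le_of_ae_le (hm.comp hY).aestronglyMeasurable (Eventually.of_forall fun ω => ?_)
    ?_ (integral_const_mul_le_mul h2 hD)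
  · split_ifs
    · positivity
    · exact le_rfl
  · filter_upwards [h0] with ω hω
    split_ifs with h
    · refine le_trans ?_ (hDz _ hω)
      have := hθy _ hω h
      gcongr
      linarith
    · positivity

theorem integral_ite_le_mul_exp {y m c α β D : ℝ} (hY : Measurable Y)
    (h0 : ∀ᵐ ω ∂μ, 0 ≤ Y ω) (hc : 0 ≤ c) (hα : 0 < α) (hβ : 0 < β) (hD : 0 ≤ D) (hy : 0 ≤ y)
    (hDz : ∀ z : ℝ, 0 ≤ z →
      (z ^ 2 + z + c) * Real.exp (α / 2 * z ^ β) ≤ D * Real.exp (α * z ^ β))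
    (h2 : Integrable (fun ω => Real.exp (α * Y ω ^ β)) μ ∧
      ∫ ω, Real.exp (α * Y ω ^ β) ∂μ ≤ m) :
    ∫ ω, (if Y ω ≤ y then 0 else Y ω) ∂μ ≤ D * Real.exp (-(α / 2 * y ^ β)) * m := by
  have hm : Measurable fun z : ℝ => if z ≤ y then 0 else z :=
    Measurable.ite measurableSet_Iic measurable_const measurable_id
  refine (integral_le_of_ae_le (hm.comp hY).aestronglyMeasurable ?_ ?_
    (integral_const_mul_le_mul h2 (by positivity : 0 ≤ D * Real.exp (-(α / 2 * y ^ β))))).2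
  · filter_upwards [h0] with ω hω
    simp only [Function.comp_apply]
    split_ifs
    · exact le_rfl
    · exact hω
  · filter_upwards [h0] with ω hω
    simp only [Function.comp_apply]
    split_ifs with h
    · positivity
    · push Not at h
      have h3 : y ^ β ≤ Y ω ^ β := Real.rpow_le_rpow hy h.le hβ.le
      have h4 : Real.exp (α / 2 * y ^ β) ≤ Real.exp (α / 2 * Y ω ^ β) := by gcongr
      rw [Real.exp_neg, mul_right_comm, ← div_eq_mul_inv, le_div_iff₀ (Real.exp_pos _)]
      refine le_trans ?_ (hDz _ hω)
      have : Y ω ≤ Y ω ^ 2 + Y ω + c := by nlinarith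
      gcongr

theorem integral_sq_le_of_exp {m c α β D : ℝ} (hY : Measurable Y)
    (h0 : ∀ᵐ ω ∂μ, 0 ≤ Y ω) (hc : 0 ≤ c) (hα : 0 < α) (hD : 0 ≤ D)
    (hDz : ∀ z : ℝ, 0 ≤ z →
      (z ^ 2 + z + c) * Real.exp (α / 2 * z ^ β) ≤ D * Real.exp (α * z ^ β))
    (h2 : Integrable (fun ω => Real.exp (α * Y ω ^ β)) μ ∧
      ∫ ω, Real.exp (α * Y ω ^ β) ∂μ ≤ m) :
    Integrable (fun ω => Y ω ^ 2) μ ∧ ∫ ω, Y ω ^ 2 ∂μ ≤ D * m := by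
  refine integral_le_of_ae_le (hY.pow_const 2).aestronglyMeasurable
    (Eventually.of_forall fun ω => sq_nonneg _) ?_ (integral_const_mul_le_mul h2 hD)
  filter_upwards [h0] with ω hω
  refine le_trans ?_ (hDz _ hω)
  have h3 : 1 ≤ Real.exp (α / 2 * Y ω ^ β) := Real.one_le_exp (by positivity)
  nlinarith [sq_nonneg (Y ω)]

theorem integral_sq_le_of_rpow [IsProbabilityMeasure μ] {m ε : ℝ} (hY : Measurable Y)
    (h0 : ∀ᵐ ω ∂μ, 0 ≤ Y ω) (hε : 0 ≤ ε)
    (h2 : Integrable (fun ω => Y ω ^ (2 + ε)) μ ∧ ∫ ω, Y ω ^ (2 + ε) ∂μ ≤ m) :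
    Integrable (fun ω => Y ω ^ 2) μ ∧ ∫ ω, Y ω ^ 2 ∂μ ≤ 1 + m := by
  refine integral_le_of_ae_le (hY.pow_const 2).aestronglyMeasurable
    (Eventually.of_forall fun ω => sq_nonneg _) ?_ (integral_add_le_add (integral_const_le 1) h2)
  filter_upwards [h0] with ω hω
  rcases le_total (Y ω) 1 with h | h
  · have : 0 ≤ Y ω ^ (2 + ε) := by positivity
    nlinarith
  · have := Real.rpow_le_rpow_of_exponent_le h (show (2 : ℝ) ≤ 2 + ε by linarith)
    rw [Real.rpow_two] at this
    linarith

end Moments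

/-! ### Uniform drift -/

namespace Network

variable {K : ℕ} {P : Matrix (Fin K) (Fin K) ℝ}

/-- With `nu` the left-hand vector of the conclusion, `(I - Pᵀ)(mu - nu)` is eventually larger than
`κ / a n`: the limit gives at least `2 * κ / a n` for `(I - Pᵀ) mu - lam`, half of which goes to the
added drift. Inverse positivity then gives `nu < mu`. -/
theorem exists_eventually_drift (hP : spectralRadius ℂ (P.map (fun x : ℝ => (x : ℂ))) < 1)
    {lam mu : ℕ → Fin K → ℝ} {a : ℕ → ℝ} {r : Fin K → ℝ} (hP0 : ∀ i j, 0 ≤ P i j)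
    (ha : ∀ᶠ n in atTop, 0 < a n) (hr : ∀ k, r k < 0)
    (h : Tendsto (fun n => a n • (lam n - Matrix.mulVec (1 - P.transpose) (mu n))) atTop (𝓝 r)) :
    ∃ κ : ℝ, 0 < κ ∧ κ ≤ 1 ∧ ∀ᶠ n in atTop, ∀ k,
      Matrix.mulVec (1 - P.transpose)⁻¹ (fun l => lam n l + κ / a n) k < mu n k := by
  obtain ⟨κ, hκ, hκ1, hκr⟩ := exists_pos_le_one_forall_le (f := fun k => -(r k) / 4)
    fun k => by have := hr k; linarith
  refine ⟨κ, hκ, hκ1, ?_⟩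
  have h1 : ∀ᶠ n in atTop, ∀ k,
      a n * (lam n k - Matrix.mulVec (1 - P.transpose) (mu n) k) < r k / 2 :=
    eventually_all.2 fun k => (tendsto_pi_nhds.1 h k).eventually_lt_const (by linarith [hr k])
  filter_upwards [h1, ha] with n hn han k
  set nu := Matrix.mulVec (1 - P.transpose)⁻¹ (fun l => lam n l + κ / a n) with hnu
  have hz (j : Fin K) : κ / a n < (mu n j - nu j) - ∑ l, P l j * (mu n l - nu l) := by
    have h2 := inv_mulVec_sub_sum hP0 hP (fun l => lam n l + κ / a n) j
    rw [← hnu] at h2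
    have h3 := hn j
    rw [one_sub_transpose_mulVec] at h3
    simp only [mul_sub, Finset.sum_sub_distrib]
    have h4 : κ / a n * a n = κ := div_mul_cancel₀ _ han.ne'
    have h5 := hκr j
    have h6 : a n * (κ / a n) * 2 + a n * (lam n j - (mu n j - ∑ l, P l j * mu n l)) < a n * 0 := by
      linarith
    rw [mul_assoc, ← mul_add] at h6
    have := lt_of_mul_lt_mul_left h6 han.le
    linarith
  have hκa : 0 < κ / a n := by positivity
  have := sub_sum_le_of_nonneg hP0 hP (z := fun j => mu n j - nu j)
    (fun j => (hκa.trans (hz j)).le) k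
  linarith [hz k]

theorem Subcritical.exists_drift {Ω : Type u} [MeasurableSpace Ω] {Pr : Measure Ω}
    {N : Network P Pr} (hN : N.Subcritical) :
    ∃ κ : ℝ, 0 < κ ∧ κ ≤ 1 ∧ ∀ k,
      Matrix.mulVec (1 - P.transpose)⁻¹ (fun l => N.arrRate l + κ) k < N.svcRate k := by
  have h1 : ∀ᶠ κ : ℝ in 𝓝[>] 0, ∀ k,
      Matrix.mulVec (1 - P.transpose)⁻¹ (fun l => N.arrRate l + κ) k < N.svcRate k := by
    refine eventually_all.2 fun k => ?_
    have hc : Continuous fun κ : ℝ =>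
        Matrix.mulVec (1 - P.transpose)⁻¹ (fun l => N.arrRate l + κ) k := by
      refine (continuous_apply k).comp (continuous_const.matrix_mulVec ?_)
      fun_prop
    exact ((hc.tendsto 0).eventually_lt_const (by simpa using hN k)).filter_mono
      nhdsWithin_le_nhds
  have h2 : ∀ᶠ κ : ℝ in 𝓝[>] 0, κ ≤ 1 :=
    (eventually_le_nhds one_pos).filter_mono nhdsWithin_le_nhds
  obtain ⟨c, ⟨h1, h2⟩, h3⟩ := ((h1.and h2).and self_mem_nhdsWithin).exists
  exact ⟨c, h3, h2, h1⟩

end Network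

/-! ### Deviations of the queue lengths -/

namespace Network

variable {K : ℕ} {P : Matrix (Fin K) (Fin K) ℝ}

theorem HasMomentBounds.mono {Ω : Type u} [MeasurableSpace Ω] {Pr : Measure Ω} {N : Network P Pr}
    {m₂ θ y C C' V : ℝ} (h : N.HasMomentBounds m₂ θ y C V) (hC : C ≤ C') :
    N.HasMomentBounds m₂ θ y C' V :=
  ⟨h.arr_sq, h.svc_sq, fun k => ⟨(h.svc_exp k).1, (h.svc_exp k).2.trans hC⟩, h.svc_tail⟩

variable {Ω : ℕ → Type u} [∀ n, MeasurableSpace (Ω n)] {Pr : ∀ n, Measure (Ω n)}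

theorem exists_forall_integral_arr_svc_le (N : ∀ n, Network P (Pr n)) {g : ℝ → ℝ}
    (hg : Measurable g) (hg0 : ∀ z, 0 ≤ z → 0 ≤ g z)
    (h : ∀ k, (⨆ n, ∫⁻ ω, ENNReal.ofReal (g ((N n).genArr k ω)) ∂(Pr n)) < ⊤ ∧
      (⨆ n, ∫⁻ ω, ENNReal.ofReal (g ((N n).genSvc k ω)) ∂(Pr n)) < ⊤) :
    ∃ m : ℝ, 0 ≤ m ∧ ∀ n k,
      (Integrable (fun ω => g ((N n).ξ k 1 ω)) (Pr n) ∧ ∫ ω, g ((N n).ξ k 1 ω) ∂(Pr n) ≤ m) ∧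
      (Integrable (fun ω => g ((N n).η k 1 ω)) (Pr n) ∧ ∫ ω, g ((N n).η k 1 ω) ∂(Pr n) ≤ m) := by
  obtain ⟨m, hm, hξ⟩ := exists_forall_integral_le (Pr := Pr)
    (f := fun n (k : Fin K) ω => g ((N n).ξ k 1 ω))
    (fun n k => (hg.comp ((N n).measurable_ξ k 1)).aestronglyMeasurable)
    (fun n k => ((N n).ξ_nonneg k 1).mono fun ω hω => hg0 _ hω) (fun k => (h k).1)
  obtain ⟨m', hm', hη⟩ := exists_forall_integral_le (Pr := Pr)
    (f := fun n (k : Fin K) ω => g ((N n).η k 1 ω))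
    (fun n k => (hg.comp ((N n).measurable_η k 1)).aestronglyMeasurable)
    (fun n k => ((N n).η_nonneg k 1).mono fun ω hω => hg0 _ hω) (fun k => (h k).2)
  exact ⟨max m m', le_max_of_le_left hm, fun n k =>
    ⟨⟨(hξ n k).1, (hξ n k).2.trans (le_max_left _ _)⟩,
      ⟨(hη n k).1, (hη n k).2.trans (le_max_right _ _)⟩⟩⟩

variable [∀ n, IsProbabilityMeasure (Pr n)]

/-- Large and moderate deviation bounds, with the moment conditions given in the form in which
they are used. -/
theorem tendsto_limsup_measure_queue_rpow
    (hP : spectralRadius ℂ (P.map (fun x : ℝ => (x : ℂ))) < 1) (N : ∀ n, Network P (Pr n))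
    (hN : ∀ n, (N n).Stationary) {b : ℕ → ℝ} {κ a₀ m₂ C M L : ℝ} (hL : 1 ≤ L)
    (hlam : ∀ᶠ n in atTop, ∀ k, (N n).arrRate k ≤ L)
    (hmu : ∀ᶠ n in atTop, ∀ k, (N n).svcRate k ≤ L)
    (hb : Tendsto b atTop atTop) (hρ : ∀ᶠ n : ℕ in atTop, 1 ≤ √n / b n) (hκ : 0 < κ) (hκ1 : κ ≤ 1)
    (hdrift : ∀ᶠ n : ℕ in atTop, ∀ k, Matrix.mulVec (1 - P.transpose)⁻¹
      (fun l => (N n).arrRate l + κ / (√n / b n)) k < (N n).svcRate k)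
    (ha₀ : 0 < a₀) (hm₂ : 0 ≤ m₂) (hM : 0 ≤ M)
    (hmom : ∀ a, 0 < a → a ≤ a₀ → ∀ R : ℝ, ∀ᶠ n : ℕ in atTop, ∃ y V, 1 + m₂ ≤ y ∧ 0 ≤ V ∧
      (N n).HasMomentBounds m₂ (a / (√n / b n)) y C V ∧
      V * (√n / b n) ≤ M * Real.exp (-(R * b n ^ 2)))
    (k : Fin K) {t : ℝ} (ht : 0 ≤ t) :
    Tendsto (fun u : ℝ => limsup (fun n : ℕ =>
      (Pr n {ω | u ≤ ((N n).Q k (n * t) ω : ℝ) / (b n * √n)}) ^ (1 / (b n) ^ 2)) atTop)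
      atTop (𝓝 0) := by
  obtain ⟨A, hA, hbound⟩ := exists_measure_scaled_queue_le hP hL hm₂ k
  have hA0 : 0 < A := by linarith
  obtain ⟨C', hC'⟩ : ∃ C', C' = max A C := ⟨_, rfl⟩
  have hAC : A ≤ C' := hC' ▸ le_max_left _ _
  have hCC : C ≤ C' := hC' ▸ le_max_right _ _
  have hC0 : 0 < C' := by linarith
  -- With drift `κ / ρ`, where `ρ = √n / b n`, the largest admissible exponent is `θ = a / ρ` with
  -- `a` fixed. At `x = u * b n * √n / (2 * A)` this gives `θ * x` proportional to `u * b n ^ 2`.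
  obtain ⟨a, ha, haa₀, ha1, haκ⟩ : ∃ a, 0 < a ∧ a ≤ a₀ ∧ a ≤ 1 ∧ a * (C' * A) ≤ κ := by
    refine ⟨min a₀ (min 1 (κ / (C' * A))), by positivity, min_le_left _ _,
      (min_le_right _ _).trans (min_le_left _ _), ?_⟩
    rw [← le_div_iff₀ (by positivity)]
    exact (min_le_right _ _).trans (min_le_right _ _)
  refine tendsto_limsup_rpow_zero (c := a / (4 * A)) (M := M / κ) (A := A)
    (E := fun u n => Real.exp (-(2 * (a / (4 * A) * u) * b n ^ 2)))
    (W := fun u n => M / κ * Real.exp (-(2 * (a / (4 * A) * u) * b n ^ 2)))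
    hA (by positivity) (by positivity) ?_ ?_
  · filter_upwards [hb.eventually_ge_atTop 1] with n hn
    exact one_le_pow₀ hn
  filter_upwards [eventually_ge_atTop (2 * A)] with u hu
  -- The rate `R` demanded of the tail term grows with `u`, which is why the moment condition is
  -- required for every `R`, with a truncation level that may depend on it.
  filter_upwards [hlam, hmu, hb.eventually_ge_atTop 1, hρ, hdrift,
    hmom a ha haa₀ (2 * (a / (4 * A) * u))] with n h1 h2 hbn hρn hd hmn
  refine ⟨le_rfl, le_rfl, ?_⟩
  obtain ⟨y, V, hy, hV, hmb, hVM⟩ := hmn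
  have hb0 : 0 < b n := by linarith
  have hs : b n ≤ √n := by rwa [one_le_div hb0] at hρn
  have hs1 : 1 ≤ √(n : ℝ) := hbn.trans hs
  have hs0 : 0 < √(n : ℝ) := by linarith
  set ρ := √(n : ℝ) / b n with hρdef
  have hρ0 : 0 < ρ := by positivity
  have hκρ : κ / ρ ≤ 1 := by rw [div_le_one hρ0]; linarith
  have hθ1 : a / ρ ≤ 1 := by rw [div_le_one hρ0]; linarith
  have hus : 2 * A ≤ u * (b n * √n) := by
    have : 1 ≤ b n * √(n : ℝ) := one_le_mul_of_one_le_of_one_le hbn hs1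
    nlinarith
  refine (hbound (Ω n) (Pr n) (N n) (hN n) h1 h2 (κ / ρ) u (b n * √n) (n * t) (a / ρ) y C' V
    (by positivity) hκρ hd (by positivity) (by positivity) hus (by positivity) hθ1 hy hV hAC
    (by rw [div_mul_eq_mul_div]; gcongr) (hmb.mono hCC)).trans ?_
  refine ENNReal.ofReal_le_ofReal ?_
  have hE : a / ρ * (u * (b n * √n) / (2 * A)) = 2 * (a / (4 * A) * u) * b n ^ 2 := by
    rw [hρdef]; field_simp; ring
  have hW : V / (κ / ρ) ≤ M / κ * Real.exp (-(2 * (a / (4 * A) * u) * b n ^ 2)) := by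
    rw [div_div_eq_mul_div, div_mul_eq_mul_div]
    gcongr
  rw [hE]
  gcongr

/-- Large deviations. -/
theorem tendsto_limsup_measure_queue_large
    (hP : spectralRadius ℂ (P.map (fun x : ℝ => (x : ℂ))) < 1)
    {Ω : Type u} [MeasurableSpace Ω] {Pr : Measure Ω} [IsProbabilityMeasure Pr] (N : Network P Pr)
    (hsub : N.Subcritical) (hN : N.Stationary) {α : ℝ} (hα : 0 < α)
    (hmom : ∀ k, ∫⁻ ω, ENNReal.ofReal (Real.exp (α * N.genArr k ω)) ∂Pr < ⊤ ∧
      ∫⁻ ω, ENNReal.ofReal (Real.exp (α * N.genSvc k ω)) ∂Pr < ⊤)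
    (k : Fin K) {t : ℝ} (ht : 0 ≤ t) :
    Tendsto (fun u : ℝ => limsup (fun n : ℕ =>
      (Pr {ω | u ≤ (N.Q k (n * t) ω : ℝ) / n}) ^ (1 / (n : ℝ))) atTop) atTop (𝓝 0) := by
  obtain ⟨m, hm, hmexp⟩ := exists_forall_integral_arr_svc_le (Pr := fun _ => Pr) (fun _ => N)
    (g := fun z => Real.exp (α * z ^ (1 : ℝ)))
    (by fun_prop) (fun z _ => (Real.exp_pos _).le) (by simpa using hmom)
  replace hmexp := hmexp 0
  obtain ⟨D₀, hD₀, hDz₀⟩ := exists_sq_mul_exp_le hα one_pos le_rfl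
  set m₂ := D₀ * m with hm₂
  have hm₂0 : 0 ≤ m₂ := by positivity
  -- A second application is needed because this constant depends on `m₂`, which is itself obtained
  -- from the first.
  obtain ⟨D, hD, hDz⟩ := exists_sq_mul_exp_le hα one_pos (sq_nonneg (1 + m₂))
  obtain ⟨L, hL, hlamL⟩ := exists_eventually_forall_le (tendsto_const_nhds (x := N.arrRate))
  obtain ⟨L', hL', hmuL⟩ := exists_eventually_forall_le (tendsto_const_nhds (x := N.svcRate))
  obtain ⟨κ, hκ, hκ1, hdrift⟩ := hsub.exists_drift
  have hone : ∀ᶠ n : ℕ in atTop, √(n : ℝ) / √n = 1 := by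
    filter_upwards [eventually_gt_atTop 0] with n hn
    exact div_self (Real.sqrt_pos.2 (by exact_mod_cast hn)).ne'
  -- Large deviations are the case `b n = √n` of a constant sequence of networks: `√n / b n = 1` and
  -- the drift stays fixed.
  have h := tendsto_limsup_measure_queue_rpow (Pr := fun _ => Pr) hP (fun _ => N) (fun _ => hN)
    (b := fun n => √n) (κ := κ) (a₀ := α / 2) (m₂ := m₂) (C := D * m) (M := D * m)
    (hL.trans (le_max_left L L')) (hlamL.mono fun n hn k => (hn k).trans (le_max_left L L'))
    (hmuL.mono fun n hn k => (hn k).trans (le_max_right L L'))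
    (Real.tendsto_sqrt_atTop.comp tendsto_natCast_atTop_atTop) (hone.mono fun n hn => hn.ge)
    hκ hκ1 (hone.mono fun n hn => by rw [hn, div_one]; exact hdrift) (by positivity) hm₂0
    (by positivity) ?_ k ht
  · simpa only [Real.mul_self_sqrt (Nat.cast_nonneg _), Real.sq_sqrt (Nat.cast_nonneg _)] using h
  intro a ha haα R
  filter_upwards [hone] with n hn
  have hy0 : 1 + m₂ ≤ 2 * |R| / α * n + (1 + m₂) := le_add_of_nonneg_left (by positivity)
  -- Truncation at a level linear in `n`, with slope chosen so that `α / 2 * y ≥ |R| * n`.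
  refine ⟨2 * |R| / α * n + (1 + m₂),
    D * Real.exp (-(α / 2 * (2 * |R| / α * n + (1 + m₂)) ^ (1 : ℝ))) * m, hy0, by positivity,
    ⟨fun k => ?_, fun k => ?_, fun k => ?_, fun k => ?_⟩, ?_⟩
  · exact integral_sq_le_of_exp (N.measurable_ξ k 1) (N.ξ_nonneg k 1) le_rfl hα hD₀ hDz₀
      (hmexp k).1
  · exact integral_sq_le_of_exp (N.measurable_η k 1) (N.η_nonneg k 1) le_rfl hα hD₀ hDz₀
      (hmexp k).2
  · refine integral_ite_sq_mul_exp_le_of_exp (N.measurable_η k 1) (N.η_nonneg k 1) (sq_nonneg _) hD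
      (fun z hz _ => ?_) hDz (hmexp k).2
    rw [hn, div_one, Real.rpow_one]
    gcongr
  · exact integral_ite_le_mul_exp (N.measurable_η k 1) (N.η_nonneg k 1) (sq_nonneg _) hα one_pos hD
      (by linarith) hDz (hmexp k).2
  · rw [hn, mul_one, mul_right_comm, Real.rpow_one, Real.sq_sqrt (Nat.cast_nonneg _)]
    have h1 : α / 2 * (2 * |R| / α * n) = |R| * n := by field_simp
    have h2 : R * n ≤ |R| * n := by gcongr; exact le_abs_self R
    have h3 : 0 ≤ α / 2 * (1 + m₂) := by positivity
    refine mul_le_mul_of_nonneg_left (Real.exp_le_exp.2 ?_) (by positivity)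
    rw [mul_add]
    linarith

/-- Normal deviations. -/
theorem tendsto_limsup_measure_queue_normal
    (hP : spectralRadius ℂ (P.map (fun x : ℝ => (x : ℂ))) < 1) (N : ∀ n, Network P (Pr n))
    {lam mu r : Fin K → ℝ} (hN : ∀ n, (N n).Stationary)
    (hlam : Tendsto (fun n => (N n).arrRate) atTop (𝓝 lam))
    (hmu : Tendsto (fun n => (N n).svcRate) atTop (𝓝 mu)) (hr : ∀ k, r k < 0)
    (hlim : Tendsto (fun n : ℕ => √(n : ℝ) •
      ((N n).arrRate - Matrix.mulVec (1 - P.transpose) (N n).svcRate)) atTop (𝓝 r))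
    (hmom : ∀ k, (⨆ n, ∫⁻ ω, ENNReal.ofReal ((N n).genArr k ω ^ 2) ∂(Pr n)) < ⊤ ∧
      (⨆ n, ∫⁻ ω, ENNReal.ofReal ((N n).genSvc k ω ^ 2) ∂(Pr n)) < ⊤)
    (k : Fin K) {t : ℝ} (ht : 0 ≤ t) :
    Tendsto (fun u : ℝ => limsup (fun n : ℕ =>
      Pr n {ω | u ≤ ((N n).Q k (n * t) ω : ℝ) / √n}) atTop) atTop (𝓝 0) := by
  obtain ⟨m₂, hm₂, hm⟩ := exists_forall_integral_arr_svc_le N (g := fun z => z ^ 2)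
    (by fun_prop) (fun z _ => sq_nonneg z) hmom
  obtain ⟨L, hL, hlamL⟩ := exists_eventually_forall_le hlam
  obtain ⟨L', hL', hmuL⟩ := exists_eventually_forall_le hmu
  obtain ⟨A, hA, hbound⟩ := exists_measure_scaled_queue_le hP (hL.trans (le_max_left L L')) hm₂ k
  have hsq : Tendsto (fun n : ℕ => √(n : ℝ)) atTop atTop :=
    Real.tendsto_sqrt_atTop.comp tendsto_natCast_atTop_atTop
  obtain ⟨κ, hκ, hκ1, hdrift⟩ := exists_eventually_drift hP (N 0).routing_nonneg
    (hsq.eventually_gt_atTop 0) hr hlim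
  have hA0 : 0 < A := by linarith
  obtain ⟨C, hC⟩ : ∃ C, C = max A (Real.exp 2 * (m₂ + (1 + m₂) ^ 2)) := ⟨_, rfl⟩
  have hAC : A ≤ C := hC ▸ le_max_left _ _
  have hCC : Real.exp 2 * (m₂ + (1 + m₂) ^ 2) ≤ C := hC ▸ le_max_right _ _
  have hC0 : 0 < C := by linarith
  obtain ⟨a, ha, ha1, haκ⟩ : ∃ a, 0 < a ∧ a ≤ 1 ∧ a * (C * A) ≤ κ := by
    refine ⟨min 1 (κ / (C * A)), by positivity, min_le_left _ _, ?_⟩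
    rw [← le_div_iff₀ (by positivity)]
    exact min_le_right _ _
  refine tendsto_limsup_zero
    (h := fun u => A * √(Real.exp (-(a / (2 * A) * √u)) + m₂ / κ * (√u)⁻¹)) ?_ ?_
  swap
  · have h1 : Tendsto (fun u : ℝ => Real.exp (-(a / (2 * A) * √u))) atTop (𝓝 0) :=
      Real.tendsto_exp_neg_atTop_nhds_zero.comp
        (Real.tendsto_sqrt_atTop.const_mul_atTop (by positivity))
    have h2 := (tendsto_inv_atTop_zero.comp Real.tendsto_sqrt_atTop).const_mul (m₂ / κ)
    simpa using ((h1.add h2).sqrt).const_mul A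
  filter_upwards [eventually_ge_atTop 1] with u hu
  have hw : 1 ≤ √u := Real.one_le_sqrt.2 hu
  have hw0 : 0 < √u := by linarith
  filter_upwards [hlamL, hmuL, hdrift, hsq.eventually_ge_atTop (2 * A),
    hsq.eventually_ge_atTop (1 + m₂)] with n h1 h2 hd hn1 hn2
  have hs1 : 1 ≤ √(n : ℝ) := by linarith
  have hs0 : 0 < √(n : ℝ) := by linarith
  have hws : √(n : ℝ) ≤ √u * √n := le_mul_of_one_le_left hs0.le hw
  -- Second moments alone allow only `θ` of order `1 / y`, and a tail mean of order `1 / y`. With `y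
  -- = √u * √n` the exponent `θ * x` is of order `√u` and `V` over the drift of order `1 / √u`, so
  -- both terms vanish as `u` grows.
  have hmb : (N n).HasMomentBounds m₂ (a / (√u * √n)) (√u * √n) C ((√u * √n)⁻¹ * m₂) := by
    refine ⟨fun k => (hm n k).1, fun k => (hm n k).2, fun k => ?_, fun k => ?_⟩
    · have h := integral_ite_sq_mul_exp_le ((N n).measurable_η k 1)
        (show 0 ≤ a / (√u * √n) by positivity) (y := √u * √n)
        (by rw [div_mul_eq_mul_div, div_le_iff₀ (by positivity)]; nlinarith)
        (sq_nonneg (1 + m₂)) (hm n k).2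
      exact ⟨h.1, h.2.trans hCC⟩
    · have h := integral_ite_le_div_rpow (y := √u * √n) (δ := 1) (m := m₂)
        ((N n).measurable_η k 1) ((N n).η_nonneg k 1) (by positivity) zero_le_one
        (by simpa only [one_add_one_eq_two, Real.rpow_two] using (hm n k).2)
      rwa [Real.rpow_one] at h
  refine (hbound (Ω n) (Pr n) (N n) (hN n) (fun k => (h1 k).trans (le_max_left L L'))
    (fun k => (h2 k).trans (le_max_right L L')) (κ / √n) u (√n) (n * t) (a / (√u * √n))
    (√u * √n) C ((√u * √n)⁻¹ * m₂) (by positivity) (by rw [div_le_one hs0]; linarith) hd hs0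
    (by positivity) (by nlinarith) (by positivity) (by rw [div_le_one (by positivity)]; linarith)
    (hn2.trans hws) (by positivity) hAC
    (by rw [div_mul_eq_mul_div]; gcongr) hmb).trans ?_
  refine ENNReal.ofReal_le_ofReal (le_of_eq ?_)
  have hE : a / (√u * √n) * (u * √n / (2 * A)) = a / (2 * A) * √u := by
    nth_rewrite 2 [← Real.sq_sqrt (show 0 ≤ u by linarith)]
    field_simp
  have hW : (√u * √n)⁻¹ * m₂ / (κ / √n) = m₂ / κ * (√u)⁻¹ := by
    field_simp
  rw [hE, hW]

/-- Moderate deviations, with power moments. -/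
theorem tendsto_limsup_measure_queue_moderate_of_rpow
    (hP : spectralRadius ℂ (P.map (fun x : ℝ => (x : ℂ))) < 1) (N : ∀ n, Network P (Pr n))
    {lam mu r : Fin K → ℝ} {b : ℕ → ℝ} (hN : ∀ n, (N n).Stationary)
    (hlam : Tendsto (fun n => (N n).arrRate) atTop (𝓝 lam))
    (hmu : Tendsto (fun n => (N n).svcRate) atTop (𝓝 mu)) (hr : ∀ k, r k < 0)
    (hb : Tendsto b atTop atTop) (hbn : Tendsto (fun n : ℕ => √(n : ℝ) / b n) atTop atTop)
    (hlim : Tendsto (fun n : ℕ => (√(n : ℝ) / b n) •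
      ((N n).arrRate - Matrix.mulVec (1 - P.transpose) (N n).svcRate)) atTop (𝓝 r))
    {ε : ℝ} (hε : 0 < ε)
    (hmom : ∀ k, (⨆ n, ∫⁻ ω, ENNReal.ofReal ((N n).genArr k ω ^ (2 + ε)) ∂(Pr n)) < ⊤ ∧
      (⨆ n, ∫⁻ ω, ENNReal.ofReal ((N n).genSvc k ω ^ (2 + ε)) ∂(Pr n)) < ⊤)
    (hlog : Tendsto (fun n : ℕ => √(Real.log n) / b n) atTop atTop)
    (k : Fin K) {t : ℝ} (ht : 0 ≤ t) :
    Tendsto (fun u : ℝ => limsup (fun n : ℕ =>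
      (Pr n {ω | u ≤ ((N n).Q k (n * t) ω : ℝ) / (b n * √n)}) ^ (1 / (b n) ^ 2)) atTop)
      atTop (𝓝 0) := by
  obtain ⟨m, hm, hmr⟩ := exists_forall_integral_arr_svc_le N (g := fun z => z ^ (2 + ε))
    (by fun_prop) (fun z hz => Real.rpow_nonneg hz _) hmom
  have hsq (n : ℕ) (j : Fin K) := integral_sq_le_of_rpow ((N n).measurable_η j 1)
    ((N n).η_nonneg j 1) hε.le (hmr n j).2
  obtain ⟨L, hL, hlamL⟩ := exists_eventually_forall_le hlam
  obtain ⟨L', hL', hmuL⟩ := exists_eventually_forall_le hmu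
  obtain ⟨κ, hκ, hκ1, hdrift⟩ := exists_eventually_drift hP (N 0).routing_nonneg
    (hbn.eventually_gt_atTop 0) hr hlim
  refine tendsto_limsup_measure_queue_rpow hP N hN (a₀ := 1) (m₂ := 1 + m)
    (C := Real.exp 2 * (1 + m + (1 + (1 + m)) ^ 2)) (M := m)
    (hL.trans (le_max_left L L')) (hlamL.mono fun n hn k => (hn k).trans (le_max_left L L'))
    (hmuL.mono fun n hn k => (hn k).trans (le_max_right L L'))
    hb (hbn.eventually_ge_atTop 1) hκ hκ1 hdrift one_pos (by positivity) hm ?_ k ht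
  intro a ha ha1 R
  filter_upwards [hbn.eventually_ge_atTop (1 + (1 + m)), hb.eventually_ge_atTop 1,
    hlog.eventually_ge_atTop (2 + 4 * |R| / ε)] with n hρ hbn1 hlogn
  have hb0 : 0 < b n := by linarith
  obtain ⟨ρ, hρdef⟩ : ∃ ρ, ρ = √(n : ℝ) / b n := ⟨_, rfl⟩
  rw [← hρdef] at hρ ⊢
  have hρ0 : 0 < ρ := by linarith
  -- Truncation at `y = ρ` keeps `θ * y` bounded, and the tail mean times `ρ` is of order `ρ ^
  -- (-ε)`.
  refine ⟨ρ, (ρ ^ (1 + ε))⁻¹ * m, hρ, by positivity,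
    ⟨fun j => integral_sq_le_of_rpow ((N n).measurable_ξ j 1) ((N n).ξ_nonneg j 1) hε.le
      (hmr n j).1, hsq n, fun j => ?_, fun j => ?_⟩, ?_⟩
  · exact integral_ite_sq_mul_exp_le ((N n).measurable_η j 1) (by positivity)
      (by rw [div_mul_eq_mul_div, div_le_iff₀ hρ0]; nlinarith) (sq_nonneg _) (hsq n j)
  · exact integral_ite_le_div_rpow ((N n).measurable_η j 1) ((N n).η_nonneg j 1) hρ0
      (by positivity) (by simpa only [← add_assoc, one_add_one_eq_two] using (hmr n j).2)
  · have hs0 : 0 < √(n : ℝ) := by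
      have := mul_pos hρ0 hb0
      rwa [hρdef, div_mul_cancel₀ _ hb0.ne'] at this
    have hn0 : (0 : ℝ) < n := Real.sqrt_pos.1 hs0
    set S := 2 + 4 * |R| / ε with hS
    have hS2 : 2 ≤ S := le_add_of_nonneg_right (by positivity)
    have hlog1 : S ^ 2 * b n ^ 2 ≤ Real.log n := by
      rw [le_div_iff₀ hb0] at hlogn
      have h1 : 0 < √(Real.log n) := lt_of_lt_of_le (by positivity) hlogn
      have h2 := Real.sq_sqrt (Real.sqrt_pos.1 h1).le
      rw [← h2, ← mul_pow]
      gcongr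
    have hlogρ : Real.log ρ = Real.log n / 2 - Real.log (b n) := by
      rw [hρdef, Real.log_div hs0.ne' hb0.ne', Real.log_sqrt hn0.le]
    have hlogb : Real.log (b n) ≤ b n ^ 2 :=
      (Real.log_le_self hb0.le).trans (le_self_pow₀ hbn1 two_ne_zero)
    -- `log ρ` is `log n / 2` up to `log (b n) ≤ b n ^ 2`, and `log n` dominates every multiple of
    -- `b n ^ 2`; `S` is the multiple needed for the given `R`.
    have hkey : R * b n ^ 2 ≤ ε * Real.log ρ := by
      have h1 : S * b n ^ 2 ≤ Real.log n / 2 := by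
        have := mul_le_mul_of_nonneg_right (show S * 2 ≤ S ^ 2 by nlinarith) (sq_nonneg (b n))
        linarith
      have h2 : (4 * |R| / ε) * b n ^ 2 ≤ Real.log ρ := by
        rw [hlogρ]
        have : (4 * |R| / ε) * b n ^ 2 = S * b n ^ 2 - 2 * b n ^ 2 := by rw [hS]; ring
        rw [this]
        linarith [sq_nonneg (b n)]
      have h3 := mul_le_mul_of_nonneg_left h2 hε.le
      have h4 : ε * (4 * |R| / ε * b n ^ 2) = 4 * (|R| * b n ^ 2) := by field_simp
      have h5 : R * b n ^ 2 ≤ |R| * b n ^ 2 := by gcongr; exact le_abs_self R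
      have h6 : 0 ≤ |R| * b n ^ 2 := by positivity
      linarith
    have hrp : (ρ ^ (1 + ε))⁻¹ * ρ = Real.exp (-(ε * Real.log ρ)) := by
      rw [Real.rpow_add hρ0, Real.rpow_one, Real.rpow_def_of_pos hρ0, Real.exp_neg, mul_comm ε]
      field_simp
    rw [mul_right_comm, hrp, mul_comm]
    gcongr

/-- Moderate deviations, with stretched exponential moments. -/
theorem tendsto_limsup_measure_queue_moderate_of_exp
    (hP : spectralRadius ℂ (P.map (fun x : ℝ => (x : ℂ))) < 1) (N : ∀ n, Network P (Pr n))
    {lam mu r : Fin K → ℝ} {b : ℕ → ℝ} (hN : ∀ n, (N n).Stationary)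
    (hlam : Tendsto (fun n => (N n).arrRate) atTop (𝓝 lam))
    (hmu : Tendsto (fun n => (N n).svcRate) atTop (𝓝 mu)) (hr : ∀ k, r k < 0)
    (hb : Tendsto b atTop atTop) (hbn : Tendsto (fun n : ℕ => √(n : ℝ) / b n) atTop atTop)
    (hlim : Tendsto (fun n : ℕ => (√(n : ℝ) / b n) •
      ((N n).arrRate - Matrix.mulVec (1 - P.transpose) (N n).svcRate)) atTop (𝓝 r))
    {α β : ℝ} (hα : 0 < α) (hβ : 0 < β) (hβ1 : β ≤ 1)
    (hmom : ∀ k,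
      (⨆ n, ∫⁻ ω, ENNReal.ofReal (Real.exp (α * (N n).genArr k ω ^ β)) ∂(Pr n)) < ⊤ ∧
      (⨆ n, ∫⁻ ω, ENNReal.ofReal (Real.exp (α * (N n).genSvc k ω ^ β)) ∂(Pr n)) < ⊤)
    (hT : Tendsto (fun n : ℕ => (n : ℝ) ^ (β / 2) / b n ^ (2 - β)) atTop atTop)
    (k : Fin K) {t : ℝ} (ht : 0 ≤ t) :
    Tendsto (fun u : ℝ => limsup (fun n : ℕ =>
      (Pr n {ω | u ≤ ((N n).Q k (n * t) ω : ℝ) / (b n * √n)}) ^ (1 / (b n) ^ 2)) atTop)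
      atTop (𝓝 0) := by
  obtain ⟨m, hm, hmexp⟩ := exists_forall_integral_arr_svc_le N
    (g := fun z => Real.exp (α * z ^ β)) (by fun_prop) (fun z _ => (Real.exp_pos _).le) hmom
  obtain ⟨D₀, hD₀, hDz₀⟩ := exists_sq_mul_exp_le hα hβ le_rfl
  set m₂ := D₀ * m with hm₂
  have hm₂0 : 0 ≤ m₂ := by positivity
  obtain ⟨D, hD, hDz⟩ := exists_sq_mul_exp_le hα hβ (sq_nonneg (1 + m₂))
  -- Used at the end to absorb the polynomial factor `ρ` into half of the tail exponent.
  obtain ⟨D', hD', hDz'⟩ := exists_sq_mul_exp_le (half_pos hα) hβ le_rfl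
  obtain ⟨L, hL, hlamL⟩ := exists_eventually_forall_le hlam
  obtain ⟨L', hL', hmuL⟩ := exists_eventually_forall_le hmu
  obtain ⟨κ, hκ, hκ1, hdrift⟩ := exists_eventually_drift hP (N 0).routing_nonneg
    (hbn.eventually_gt_atTop 0) hr hlim
  refine tendsto_limsup_measure_queue_rpow hP N hN (a₀ := 1) (m₂ := m₂)
    (C := D * m) (M := D * m * D')
    (hL.trans (le_max_left L L')) (hlamL.mono fun n hn k => (hn k).trans (le_max_left L L'))
    (hmuL.mono fun n hn k => (hn k).trans (le_max_right L L'))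
    hb (hbn.eventually_ge_atTop 1) hκ hκ1 hdrift one_pos hm₂0 (by positivity) ?_ k ht
  intro a ha ha1 R
  filter_upwards [hbn.eventually_ge_atTop (1 + m₂), hb.eventually_ge_atTop 1,
    hT.eventually_ge_atTop (4 / α + 4 * |R| / α)] with n hρ hbn1 hTn
  have hb0 : 0 < b n := by linarith
  have hs0 : 0 < √(n : ℝ) := by
    have := mul_pos (show 0 < √(n : ℝ) / b n by linarith) hb0
    rwa [div_mul_cancel₀ _ hb0.ne'] at this
  obtain ⟨T, hTdef⟩ : ∃ T, T = (n : ℝ) ^ (β / 2) / b n ^ (2 - β) := ⟨_, rfl⟩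
  rw [← hTdef] at hTn
  have hR0 : 0 ≤ 4 * |R| / α := by positivity
  have hα4 : 0 < 4 / α := by positivity
  have hT0 : 0 < T := by linarith
  obtain ⟨y, hydef⟩ : ∃ y, y = b n * √(n : ℝ) := ⟨_, rfl⟩
  have hy0 : 0 < y := by rw [hydef]; positivity
  -- For truncation at `y = b n * √n`, the order of the queue itself, the growth condition says
  -- exactly that `y ^ β` dominates `b n ^ 2`.
  have hyβ : y ^ β = b n ^ 2 * T := by
    rw [hydef, hTdef, Real.mul_rpow hb0.le hs0.le, Real.rpow_sub hb0, Real.rpow_two,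
      Real.sqrt_eq_rpow, ← Real.rpow_mul (Nat.cast_nonneg n), one_div_mul_eq_div]
    have : b n ^ β ≠ 0 := (Real.rpow_pos_of_pos hb0 β).ne'
    field_simp
  obtain ⟨ρ, hρdef⟩ : ∃ ρ, ρ = √(n : ℝ) / b n := ⟨_, rfl⟩
  rw [← hρdef] at hρ ⊢
  have hρ0 : 0 < ρ := by linarith
  have hρb : ρ * b n ^ 2 = y := by rw [hρdef, hydef]; field_simp
  have hρy : ρ ≤ y := by
    rw [← hρb]
    exact le_mul_of_one_le_right hρ0.le (one_le_pow₀ hbn1)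
  -- Write `z = z ^ (1 - β) * z ^ β`. As `β ≤ 1`, the first factor is largest at the end of the
  -- range, where it is at most `2 * ρ / T`; hence `θ` times it is at most `2 / T ≤ α / 2`.
  have hθz (z : ℝ) (hz : 0 ≤ z) (hzy : z ≤ 2 * y) : a / ρ * z ≤ α / 2 * z ^ β := by
    rcases hz.eq_or_lt with rfl | hz0
    · rw [mul_zero]; positivity
    have h1 : z ^ (1 - β) ≤ 2 * y ^ (1 - β) := by
      calc z ^ (1 - β) ≤ (2 * y) ^ (1 - β) :=
            Real.rpow_le_rpow hz hzy (by linarith)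
        _ = 2 ^ (1 - β) * y ^ (1 - β) := Real.mul_rpow zero_le_two hy0.le
        _ ≤ 2 * y ^ (1 - β) := by
          gcongr
          have := Real.rpow_le_rpow_of_exponent_le one_le_two (show 1 - β ≤ 1 by linarith)
          rwa [Real.rpow_one] at this
    have h2 : z = z ^ (1 - β) * z ^ β := by
      rw [← Real.rpow_add hz0, sub_add_cancel, Real.rpow_one]
    have h3 : y ^ (1 - β) = ρ / T := by
      rw [Real.rpow_sub hy0, Real.rpow_one, hyβ, ← hρb]
      field_simp
    have h4 : a / ρ * z ^ (1 - β) ≤ α / 2 := by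
      rw [h3] at h1
      calc a / ρ * z ^ (1 - β) ≤ 1 / ρ * (2 * (ρ / T)) := by gcongr
        _ = 2 / T := by field_simp
        _ ≤ α / 2 := by
          rw [div_le_div_iff₀ hT0 two_pos]
          have h5 := mul_le_mul_of_nonneg_left (show 4 / α ≤ T by linarith) hα.le
          rw [mul_div_cancel₀ _ hα.ne'] at h5
          linarith
    calc a / ρ * z = a / ρ * z ^ (1 - β) * z ^ β := by rw [mul_assoc, ← h2]
      _ ≤ α / 2 * z ^ β := by gcongr
  refine ⟨y, D * Real.exp (-(α / 2 * y ^ β)) * m, by linarith, by positivity,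
    ⟨fun j => ?_, fun j => ?_, fun j => ?_, fun j => ?_⟩, ?_⟩
  · exact integral_sq_le_of_exp ((N n).measurable_ξ j 1) ((N n).ξ_nonneg j 1) le_rfl hα hD₀ hDz₀
      (hmexp n j).1
  · exact integral_sq_le_of_exp ((N n).measurable_η j 1) ((N n).η_nonneg j 1) le_rfl hα hD₀ hDz₀
      (hmexp n j).2
  · exact integral_ite_sq_mul_exp_le_of_exp ((N n).measurable_η j 1) ((N n).η_nonneg j 1)
      (sq_nonneg _) hD hθz hDz (hmexp n j).2
  · exact integral_ite_le_mul_exp ((N n).measurable_η j 1) ((N n).η_nonneg j 1) (sq_nonneg _) hα hβ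
      hD hy0.le hDz (hmexp n j).2
  · have h1 : ρ ≤ D' * Real.exp (α / 4 * y ^ β) := by
      have h2 := hDz' ρ hρ0.le
      have h3 : Real.exp (α / 2 * ρ ^ β)
          = Real.exp (α / 4 * ρ ^ β) * Real.exp (α / 2 / 2 * ρ ^ β) := by
        rw [← Real.exp_add]; congr 1; ring
      rw [h3, ← mul_assoc] at h2
      have h4 := le_of_mul_le_mul_right h2 (Real.exp_pos _)
      calc ρ ≤ ρ ^ 2 + ρ + 0 := by nlinarith [sq_nonneg ρ]
        _ ≤ _ := h4
        _ ≤ D' * Real.exp (α / 4 * y ^ β) := by gcongr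
    -- A quarter of `α` is left in the exponent once `ρ` has been absorbed, which explains the
    -- threshold `4 * |R| / α` for `T`.
    have h5 : R * b n ^ 2 ≤ α / 4 * y ^ β := by
      have h6 := mul_le_mul_of_nonneg_left (show 4 * |R| / α ≤ T by linarith)
        (show 0 ≤ α / 4 * b n ^ 2 by positivity)
      have h7 : α / 4 * b n ^ 2 * (4 * |R| / α) = |R| * b n ^ 2 := by field_simp
      have h8 : R * b n ^ 2 ≤ |R| * b n ^ 2 := by gcongr; exact le_abs_self R
      rw [hyβ]
      linarith
    calc D * Real.exp (-(α / 2 * y ^ β)) * m * ρ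
        ≤ D * Real.exp (-(α / 2 * y ^ β)) * m * (D' * Real.exp (α / 4 * y ^ β)) := by gcongr
      _ = D * m * D' * (Real.exp (-(α / 2 * y ^ β)) * Real.exp (α / 4 * y ^ β)) := by ring
      _ = D * m * D' * Real.exp (-(α / 4 * y ^ β)) := by
        rw [← Real.exp_add]; congr 2; ring
      _ ≤ D * m * D' * Real.exp (-(R * b n ^ 2)) := by gcongr

end Network

end GenJackson

theorem theorem3p1 {K : ℕ} (P : Matrix (Fin K) (Fin K) ℝ)
    (hP : spectralRadius ℂ (P.map (fun x : ℝ => (x : ℂ))) < 1) :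
    -- large deviations
    (∀ (Ω : Type u) [MeasurableSpace Ω] (Pr : Measure Ω) [IsProbabilityMeasure Pr]
        (N : GenJackson.Network P Pr),
      N.Subcritical → N.Stationary →
      (∃ θ : ℝ, 0 < θ ∧ ∀ k,
        ∫⁻ ω, ENNReal.ofReal (Real.exp (θ * N.genArr k ω)) ∂Pr < ⊤ ∧
        ∫⁻ ω, ENNReal.ofReal (Real.exp (θ * N.genSvc k ω)) ∂Pr < ⊤) →
      ∀ (k : Fin K) (t : ℝ), 0 ≤ t →
        Tendsto (fun u : ℝ => limsup (fun n : ℕ =>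
          (Pr {ω | u ≤ (N.Q k (n * t) ω : ℝ) / n}) ^ (1 / (n : ℝ))) atTop) atTop (𝓝 0)) ∧
    -- normal deviations
    (∀ (Ω : ℕ → Type u) [∀ n, MeasurableSpace (Ω n)] (Pr : ∀ n, Measure (Ω n))
        [∀ n, IsProbabilityMeasure (Pr n)] (N : ∀ n, GenJackson.Network P (Pr n))
        (lam mu r : Fin K → ℝ),
      (∀ n, (N n).Subcritical) → (∀ n, (N n).Stationary) →
      Tendsto (fun n => (N n).arrRate) atTop (𝓝 lam) →
      Tendsto (fun n => (N n).svcRate) atTop (𝓝 mu) →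
      (∀ k, 0 < lam k) → (∀ k, 0 < mu k) → (∀ k, r k < 0) →
      Tendsto (fun n : ℕ => Real.sqrt n •
        ((N n).arrRate - Matrix.mulVec (1 - P.transpose) (N n).svcRate)) atTop (𝓝 r) →
      (∀ k, (⨆ n, ∫⁻ ω, ENNReal.ofReal ((N n).genArr k ω ^ 2) ∂(Pr n)) < ⊤ ∧
        (⨆ n, ∫⁻ ω, ENNReal.ofReal ((N n).genSvc k ω ^ 2) ∂(Pr n)) < ⊤) →
      ∀ (k : Fin K) (t : ℝ), 0 ≤ t →
        Tendsto (fun u : ℝ => limsup (fun n : ℕ =>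
          Pr n {ω | u ≤ ((N n).Q k (n * t) ω : ℝ) / Real.sqrt n}) atTop) atTop (𝓝 0)) ∧
    -- moderate deviations
    (∀ (Ω : ℕ → Type u) [∀ n, MeasurableSpace (Ω n)] (Pr : ∀ n, Measure (Ω n))
        [∀ n, IsProbabilityMeasure (Pr n)] (N : ∀ n, GenJackson.Network P (Pr n))
        (lam mu r : Fin K → ℝ) (b : ℕ → ℝ),
      (∀ n, (N n).Subcritical) → (∀ n, (N n).Stationary) →
      Tendsto (fun n => (N n).arrRate) atTop (𝓝 lam) →
      Tendsto (fun n => (N n).svcRate) atTop (𝓝 mu) →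
      (∀ k, 0 < lam k) → (∀ k, 0 < mu k) → (∀ k, r k < 0) →
      Tendsto b atTop atTop →
      Tendsto (fun n : ℕ => b n / Real.sqrt n) atTop (𝓝 0) →
      Tendsto (fun n : ℕ => (Real.sqrt n / b n) •
        ((N n).arrRate - Matrix.mulVec (1 - P.transpose) (N n).svcRate)) atTop (𝓝 r) →
      ((∃ ε : ℝ, 0 < ε ∧
          (∀ k, (⨆ n, ∫⁻ ω, ENNReal.ofReal ((N n).genArr k ω ^ (2 + ε)) ∂(Pr n)) < ⊤ ∧
            (⨆ n, ∫⁻ ω, ENNReal.ofReal ((N n).genSvc k ω ^ (2 + ε)) ∂(Pr n)) < ⊤) ∧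
          Tendsto (fun n : ℕ => Real.sqrt (Real.log n) / b n) atTop atTop) ∨
        (∃ α β : ℝ, 0 < α ∧ 0 < β ∧ β ≤ 1 ∧
          (∀ k, (⨆ n, ∫⁻ ω, ENNReal.ofReal
              (Real.exp (α * (N n).genArr k ω ^ β)) ∂(Pr n)) < ⊤ ∧
            (⨆ n, ∫⁻ ω, ENNReal.ofReal
              (Real.exp (α * (N n).genSvc k ω ^ β)) ∂(Pr n)) < ⊤) ∧
          Tendsto (fun n : ℕ => (n : ℝ) ^ (β / 2) / b n ^ (2 - β)) atTop atTop)) →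
      ∀ (k : Fin K) (t : ℝ), 0 ≤ t →
        Tendsto (fun u : ℝ => limsup (fun n : ℕ =>
          (Pr n {ω | u ≤ ((N n).Q k (n * t) ω : ℝ) / (b n * Real.sqrt n)}) ^ (1 / (b n) ^ 2))
          atTop) atTop (𝓝 0)) := by
  refine ⟨fun Ω _ Pr _ N hsub hN ⟨θ, hθ, hmom⟩ k t ht =>
      N.tendsto_limsup_measure_queue_large hP hsub hN hθ hmom k ht,
    fun Ω _ Pr _ N lam mu r _ hN hlam hmu _ _ hr hlim hmom k t ht =>
      GenJackson.Network.tendsto_limsup_measure_queue_normal hP N hN hlam hmu hr hlim hmom k ht,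
    fun Ω _ Pr _ N lam mu r b _ hN hlam hmu _ _ hr hb hbn hlim hmom k t ht => ?_⟩
  have hbn' : Tendsto (fun n : ℕ => √(n : ℝ) / b n) atTop atTop := by
    have hpos : ∀ᶠ n : ℕ in atTop, 0 < b n / √(n : ℝ) := by
      filter_upwards [hb.eventually_gt_atTop 0, eventually_gt_atTop 0] with n h1 h2
      have : 0 < √(n : ℝ) := Real.sqrt_pos.2 (by exact_mod_cast h2)
      positivity
    simpa only [Function.comp_def, inv_div] using tendsto_inv_nhdsGT_zero.comp
      (tendsto_nhdsWithin_of_tendsto_nhds_of_eventually_within _ hbn hpos)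
  rcases hmom with ⟨ε, hε, hmom, hlog⟩ | ⟨α, β, hα, hβ, hβ1, hmom, hT⟩
  · exact GenJackson.Network.tendsto_limsup_measure_queue_moderate_of_rpow hP N hN hlam hmu hr hb
      hbn' hlim hε hmom hlog k ht
  · exact GenJackson.Network.tendsto_limsup_measure_queue_moderate_of_exp hP N hN hlam hmu hr hb
      hbn' hlim hα hβ hβ1 hmom hT k ht
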